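/- Work in homotopy type theory (HoTT): intensional Martin-Löf type theory with a cumulative hierarchy of Russell-style universes $\mathcal U_0, \mathcal U_1, \ldots$, $\Pi$- and $\Sigma$-types with judgmental $\eta$-rules, coproducts, empty type, unit type, natural numbers, identity types, function extensionality, univalence, and the circle as a higher inductive type. Write $a = b$ for the identity type; a path over $p$ is a path out of the transport along $p$. A *wild CwF* (category with families, without any truncation condition) is an element of the iterated $\Sigma$-type of the following 26 components, where each equation is an identity type, quantified over all its variables (so each law is data): - $\mathsf{Con} : \mathcal U$; $\mathsf{Sub} : \mathsf{Con} \to \mathsf{Con} \to \mathcal U$; $\circ : \mathsf{Sub}\,\Theta\,\Delta \to \mathsf{Sub}\,\Gamma\,\Theta \to \mathsf{Sub}\,\Gamma\,\Delta$; $\mathsf{assoc} : (\sigma\circ\delta)\circ\nu = \sigma\circ(\delta\circ\nu)$; - $\mathsf{id} : \mathsf{Sub}\,\Gamma\,\Gamma$; $\mathsf{idl}_\sigma : \mathsf{id}\circ\sigma = \sigma$; $\mathsf{idr}_\sigma : \sigma\circ\mathsf{id} = \sigma$; - $\bullet : \mathsf{Con}$; $\epsilon : \mathsf{Sub}\,\Gamma\,\bullet$;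 $\bullet\eta : \sigma = \epsilon$ for every $\sigma : \mathsf{Sub}\,\Gamma\,\bullet$; - $\mathsf{Ty} : \mathsf{Con} \to \mathcal U$; $A[\sigma] : \mathsf{Ty}\,\Gamma$ for $A : \mathsf{Ty}\,\Delta$ and $\sigma : \mathsf{Sub}\,\Gamma\,\Delta$; $[\mathsf{id}] : A[\mathsf{id}] = A$; $[\circ] : A[\sigma\circ\delta] = A[\sigma][\delta]$; - $\mathsf{Tm} : (\Gamma : \mathsf{Con}) \to \mathsf{Ty}\,\Gamma \to \mathcal U$; $t[\sigma] : \mathsf{Tm}\,\Gamma\,(A[\sigma])$ for $t : \mathsf{Tm}\,\Delta\,A$ and $\sigma : \mathsf{Sub}\,\Gamma\,\Delta$; $t[\mathsf{id}] = t$ over $[\mathsf{id}]$; $t[\sigma\circ\delta] = t[\sigma][\delta]$ over $[\circ]$; - $\Gamma \triangleright A : \mathsf{Con}$ for $A : \mathsf{Ty}\,\Gamma$; $\mathsf p : \mathsf{Sub}\,(\Gamma\triangleright A)\,\Gamma$; $\mathsf q : \mathsf{Tm}\,(\Gamma\triangleright A)\,(A[\mathsf p])$; $(\sigma,t) : \mathsf{Sub}\,\Gamma\,(\Delta\triangleright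 A)$ for $\sigma : \mathsf{Sub}\,\Gamma\,\Delta$ and $t : \mathsf{Tm}\,\Gamma\,(A[\sigma])$; $\triangleright\beta_1 : \mathsf p\circ(\sigma,t) = \sigma$; $\triangleright\beta_2 : \mathsf q[\sigma,t] = t$ over $[\circ]$ and $\triangleright\beta_1$; $\triangleright\eta : (\mathsf p,\mathsf q) = \mathsf{id}$; ${,}\circ : (\sigma,t)\circ\nu = (\sigma\circ\nu, t[\nu])$, with $t[\nu]$ transported along $[\circ]^{-1}$. Universe levels are polymorphic: each occurrence of $\mathcal U$ may be a universe of a different level. **Lemma.** In homotopy type theory one can construct a wild CwF with a context $\Gamma : \mathsf{Con}$ such that $\mathsf{idl}_{\mathsf{id}(\Gamma)} \neq \mathsf{idr}_{\mathsf{id}(\Gamma)}$, as elements of the type $\mathsf{id}(\Gamma)\circ\mathsf{id}(\Gamma) = \mathsf{id}(\Gamma)$. Precisely: for every $i$ there are closed terms $C$, $\Gamma$ and $e$ such that the judgments $C : \mathsf{WildCwF}$, with contexts and types in $\mathcal U_{i+1}$ and substitutions and terms in $\mathcal U_i$, then $\Gamma : \mathsf{Con}_C$, and $e : \neg\,(\mathsf{idl}_{\mathsf{id}(\Gamma)}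 = \mathsf{idr}_{\mathsf{id}(\Gamma)})$, are derivable. -/

import Mathlib

/-! # Homotopy type theory as a formal system

Lean's own equality is proof-irrelevant, so homotopy type theory is formalised here as an object
theory: raw terms, and the derivable judgments about them. The theory is intensional Martin-Löf type
theory with a cumulative hierarchy of Russell universes `U 0, U 1, …`, `Π`- and `Σ`-types with
judgmental `η`, coproducts, the empty type, the unit type, natural numbers and identity types,
together with function extensionality, univalence, and the circle as a higher inductive type. -/

namespace HoTT

/-- The primitive constants. The eliminators (`…Ind`, and `J` for identity types) take the parameters
of the type, the motive, the methods, and finally the element that is eliminated. -/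
inductive Const where
  | empty | emptyInd
  | unit | star | unitInd
  | sum | inl | inr | sumInd
  | nat | zero | succ | natInd
  | id | refl | J
  | circle | base | loop | circleInd | circleLoop
  | funext
  | ua (i : ℕ)

/-- Raw terms (types are terms), with de Bruijn indices: the second argument of `pi`, `lam` and
`sigma` is in the scope of one more variable. -/
inductive Tm where
  | var (n : ℕ)
  | univ (i : ℕ)
  | pi (A B : Tm)
  | lam (A b : Tm)
  | app (f a : Tm)
  | sigma (A B : Tm)
  | pair (a b : Tm)
  | fst (p : Tm)
  | snd (p : Tm)
  | const (c : Const)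

namespace Tm

/-- A renaming under one binder. -/
def upRen (ρ : ℕ → ℕ) : ℕ → ℕ
  | 0 => 0
  | n + 1 => ρ n + 1

/-- Simultaneous renaming of variables. -/
def rename : (ℕ → ℕ) → Tm → Tm
  | ρ, var n => var (ρ n)
  | _, univ i => univ i
  | ρ, pi A B => pi (rename ρ A) (rename (upRen ρ) B)
  | ρ, lam A b => lam (rename ρ A) (rename (upRen ρ) b)
  | ρ, app f a => app (rename ρ f) (rename ρ a)
  | ρ, sigma A B => sigma (rename ρ A) (rename (upRen ρ) B)
  | ρ, pair a b => pair (rename ρ a) (rename ρ b)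
  | ρ, fst p => fst (rename ρ p)
  | ρ, snd p => snd (rename ρ p)
  | _, const c => const c

/-- Weakening by one variable. -/
def wk (t : Tm) : Tm := t.rename Nat.succ

/-- A substitution under one binder. -/
def upSub (σ : ℕ → Tm) : ℕ → Tm
  | 0 => var 0
  | n + 1 => (σ n).wk

/-- Simultaneous capture-avoiding substitution. -/
def subst : (ℕ → Tm) → Tm → Tm
  | σ, var n => σ n
  | _, univ i => univ i
  | σ, pi A B => pi (subst σ A) (subst (upSub σ) B)
  | σ, lam A b => lam (subst σ A) (subst (upSub σ) b)
  | σ, app f a => app (subst σ f) (subst σ a)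
  | σ, sigma A B => sigma (subst σ A) (subst (upSub σ) B)
  | σ, pair a b => pair (subst σ a) (subst σ b)
  | σ, fst p => fst (subst σ p)
  | σ, snd p => snd (subst σ p)
  | _, const c => const c

/-- The substitution that replaces variable `0` by `a` and lowers all the others. -/
def single (a : Tm) : ℕ → Tm
  | 0 => a
  | n + 1 => var n

/-- `b.inst a` is `b[a/x]`, for the variable `x` with index `0`. -/
def inst (b a : Tm) : Tm := b.subst (single a)

/-- The non-dependent function type. -/
def arr (A B : Tm) : Tm := pi A B.wk

/-- Application of a constant to a list of arguments. -/
def capp (c : Const) (args : List Tm) : Tm := args.foldl app (const c)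

end Tm

/-! ## Writing terms with named variables

An expression is a term that depends on the number `n` of variables in scope. The variable bound at
depth `n` has the index `m - (n + 1)` at depth `m`, so binders can be written as Lean functions. A
closed expression denotes the term obtained at depth `0`. -/

/-- Expressions: terms in which bound variables can be written as Lean variables. -/
def Exp : Type := ℕ → Tm

namespace Exp

/-- The variable that is bound at depth `n`. -/
def bvar (n : ℕ) : Exp := fun m => .var (m - (n + 1))

def U (i : ℕ) : Exp := fun _ => .univ i
def cst (c : Const) : Exp := fun _ => .const c
def app (f a : Exp) : Exp := fun n => .app (f n) (a n)
def pair (a b : Exp) : Exp := fun n => .pair (a n) (b n)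
def fst (p : Exp) : Exp := fun n => .fst (p n)
def snd (p : Exp) : Exp := fun n => .snd (p n)

/-- `Π (x : A), B x`. -/
def Pi (A : Exp) (B : Exp → Exp) : Exp := fun n => .pi (A n) (B (bvar n) (n + 1))

/-- `λ (x : A), b x`. -/
def Lam (A : Exp) (b : Exp → Exp) : Exp := fun n => .lam (A n) (b (bvar n) (n + 1))

/-- `Σ (x : A), B x`. -/
def Sig (A : Exp) (B : Exp → Exp) : Exp := fun n => .sigma (A n) (B (bvar n) (n + 1))

/-- `A → B`. -/
def Arr (A B : Exp) : Exp := Pi A fun _ => B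

/-- `A × B`. -/
def Prod (A B : Exp) : Exp := Sig A fun _ => B

/-- A closed term as an expression. -/
def ofClosed (t : Tm) : Exp := fun _ => t

/-- The term denoted by a closed expression. -/
def close (e : Exp) : Tm := e 0

end Exp

open Exp

infixl:90 " ⬝ₑ " => HoTT.Exp.app
infixr:60 " ⟶ₑ " => HoTT.Exp.Arr

/-! ## Identity types, transport, equivalences -/

/-- The identity type `a =_A b`. -/
def Id (A a b : Exp) : Exp := cst .id ⬝ₑ A ⬝ₑ a ⬝ₑ b

/-- `refl_a : a =_A a`. -/
def rfle (A a : Exp) : Exp := cst .refl ⬝ₑ A ⬝ₑ a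

/-- Path induction with motive `C`, base case `c`, applied to the path `p : x =_A y`. -/
def pathInd (A : Exp) (C : Exp → Exp → Exp → Exp) (c : Exp → Exp) (x y p : Exp) : Exp :=
  cst .J ⬝ₑ A ⬝ₑ (Lam A fun x => Lam A fun y => Lam (Id A x y) fun p => C x y p) ⬝ₑ (Lam A c)
    ⬝ₑ x ⬝ₑ y ⬝ₑ p

/-- Transport of `u : P x` along `p : x =_A y`, an element of `P y`. -/
def transport (A : Exp) (P : Exp → Exp) (x y p u : Exp) : Exp :=
  pathInd A (fun x y _ => P x ⟶ₑ P y) (fun x => Lam (P x) fun u => u) x y p ⬝ₑ u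

/-- The inverse path `p⁻¹ : y =_A x`. -/
def inv (A x y p : Exp) : Exp :=
  pathInd A (fun x y _ => Id A y x) (fun x => rfle A x) x y p

/-- `apd_f(p) : transport p (f x) = f y`, for `f : Π (x : A), P x` and `p : x =_A y`. -/
def apd (A : Exp) (P : Exp → Exp) (f x y p : Exp) : Exp :=
  pathInd A (fun x y p => Id (P y) (transport A P x y p (f ⬝ₑ x)) (f ⬝ₑ y))
    (fun x => rfle (P x) (f ⬝ₑ x)) x y p

/-- `f : A → B` is an equivalence: it has a right inverse and a left inverse. -/
def isEquiv (A B f : Exp) : Exp :=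
  Prod (Sig (B ⟶ₑ A) fun g => Pi B fun b => Id B (f ⬝ₑ (g ⬝ₑ b)) b)
    (Sig (B ⟶ₑ A) fun h => Pi A fun a => Id A (h ⬝ₑ (f ⬝ₑ a)) a)

/-- `A ≃ B`. -/
def Equiv (A B : Exp) : Exp := Sig (A ⟶ₑ B) fun f => isEquiv A B f

/-- The identity equivalence `A ≃ A`. -/
def idEquiv (A : Exp) : Exp :=
  let i := Lam A fun a => a
  let r := Lam A fun a => rfle A a
  pair i (pair (pair i r) (pair i r))

/-- The canonical map `(f = g) → Π (x : A), f x = g x`. -/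
def happly (A : Exp) (B : Exp → Exp) (f g : Exp) : Exp :=
  Lam (Id (Pi A B) f g) fun p =>
    pathInd (Pi A B) (fun f g _ => Pi A fun x => Id (B x) (f ⬝ₑ x) (g ⬝ₑ x))
      (fun f => Lam A fun x => rfle (B x) (f ⬝ₑ x)) f g p

/-- The canonical map `(A = B) → (A ≃ B)`, for `A B : U i`. -/
def idToEquiv (i : ℕ) (A B : Exp) : Exp :=
  Lam (Id (U i) A B) fun p => pathInd (U i) (fun X Y _ => Equiv X Y) (fun X => idEquiv X) A B p

/-! ## The types of the constants -/

/-- The type of a constant; `i` is the level of the parameters, `j` the level of the motive. A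
constant has the stated type for all `i` and `j`. -/
def Const.type (i j : ℕ) : Const → Exp
  | .empty => U 0
  | .emptyInd => Pi (cst .empty ⟶ₑ U j) fun C => Pi (cst .empty) fun x => C ⬝ₑ x
  | .unit => U 0
  | .star => cst .unit
  | .unitInd =>
      Pi (cst .unit ⟶ₑ U j) fun C => (C ⬝ₑ cst .star) ⟶ₑ Pi (cst .unit) fun x => C ⬝ₑ x
  | .sum => U i ⟶ₑ U i ⟶ₑ U i
  | .inl => Pi (U i) fun A => Pi (U i) fun B => A ⟶ₑ cst .sum ⬝ₑ A ⬝ₑ B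
  | .inr => Pi (U i) fun A => Pi (U i) fun B => B ⟶ₑ cst .sum ⬝ₑ A ⬝ₑ B
  | .sumInd =>
      Pi (U i) fun A => Pi (U i) fun B => Pi (cst .sum ⬝ₑ A ⬝ₑ B ⟶ₑ U j) fun C =>
        (Pi A fun a => C ⬝ₑ (cst .inl ⬝ₑ A ⬝ₑ B ⬝ₑ a)) ⟶ₑ
        (Pi B fun b => C ⬝ₑ (cst .inr ⬝ₑ A ⬝ₑ B ⬝ₑ b)) ⟶ₑ
        Pi (cst .sum ⬝ₑ A ⬝ₑ B) fun x => C ⬝ₑ x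
  | .nat => U 0
  | .zero => cst .nat
  | .succ => cst .nat ⟶ₑ cst .nat
  | .natInd =>
      Pi (cst .nat ⟶ₑ U j) fun C => (C ⬝ₑ cst .zero) ⟶ₑ
        (Pi (cst .nat) fun n => C ⬝ₑ n ⟶ₑ C ⬝ₑ (cst .succ ⬝ₑ n)) ⟶ₑ
        Pi (cst .nat) fun n => C ⬝ₑ n
  | .id => Pi (U i) fun A => A ⟶ₑ A ⟶ₑ U i
  | .refl => Pi (U i) fun A => Pi A fun a => Id A a a
  | .J =>
      Pi (U i) fun A => Pi (Pi A fun x => Pi A fun y => Id A x y ⟶ₑ U j) fun C =>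
        (Pi A fun z => C ⬝ₑ z ⬝ₑ z ⬝ₑ rfle A z) ⟶ₑ
        Pi A fun x => Pi A fun y => Pi (Id A x y) fun p => C ⬝ₑ x ⬝ₑ y ⬝ₑ p
  | .circle => U 0
  | .base => cst .circle
  | .loop => Id (cst .circle) (cst .base) (cst .base)
  | .circleInd =>
      Pi (cst .circle ⟶ₑ U j) fun C => Pi (C ⬝ₑ cst .base) fun b =>
        Id (C ⬝ₑ cst .base)
          (transport (cst .circle) (fun x => C ⬝ₑ x) (cst .base) (cst .base) (cst .loop) b) b ⟶ₑ
        Pi (cst .circle) fun x => C ⬝ₑ x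
  | .circleLoop =>
      Pi (cst .circle ⟶ₑ U j) fun C => Pi (C ⬝ₑ cst .base) fun b =>
        let T := Id (C ⬝ₑ cst .base)
          (transport (cst .circle) (fun x => C ⬝ₑ x) (cst .base) (cst .base) (cst .loop) b) b
        Pi T fun l => Id T
          (apd (cst .circle) (fun x => C ⬝ₑ x) (cst .circleInd ⬝ₑ C ⬝ₑ b ⬝ₑ l)
            (cst .base) (cst .base) (cst .loop)) l
  | .funext =>
      Pi (U i) fun A => Pi (A ⟶ₑ U i) fun B =>
        Pi (Pi A fun x => B ⬝ₑ x) fun f => Pi (Pi A fun x => B ⬝ₑ x) fun g =>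
          isEquiv (Id (Pi A fun x => B ⬝ₑ x) f g) (Pi A fun x => Id (B ⬝ₑ x) (f ⬝ₑ x) (g ⬝ₑ x))
            (happly A (fun x => B ⬝ₑ x) f g)
  | .ua k =>
      Pi (U k) fun A => Pi (U k) fun B =>
        isEquiv (Id (U k) A B) (Equiv A B) (idToEquiv k A B)

/-! ## Judgments and derivations -/

/-- Contexts; the head of the list is the type of the most recent variable. -/
abbrev Ctx := List Tm

/-- The judgments `Γ ctx`, `Γ ⊢ a : A` and `Γ ⊢ a ≡ b : A`. -/
inductive Judgment where
  | ctx (Γ : Ctx)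
  | typ (Γ : Ctx) (a A : Tm)
  | eq (Γ : Ctx) (a b A : Tm)

open Tm in
/-- The type `transport^C loop b = b` of the path part in circle induction with motive `C`, for a
term `b : C base`. -/
def circleMethod (C b : Tm) : Tm :=
  capp .id [app C (const .base),
    app (capp .J [const .circle,
      lam (const .circle) (lam (const .circle) (lam (capp .id [const .circle, var 1, var 0])
        (arr (app C.wk.wk.wk (var 2)) (app C.wk.wk.wk (var 1))))),
      lam (const .circle) (lam (app C.wk (var 0)) (var 0)),
      const .base, const .base, const .loop]) b,
    b]

open Judgment Tm in
/-- The derivable judgments of homotopy type theory. -/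
inductive Derivable : Judgment → Prop where
  -- contexts and variables
  | ctx_nil : Derivable (ctx [])
  | ctx_cons {Γ A i} : Derivable (typ Γ A (univ i)) → Derivable (ctx (A :: Γ))
  | var {Γ n A} : Derivable (ctx Γ) → Γ[n]? = some A →
      Derivable (typ Γ (var n) (A.rename (· + (n + 1))))
  -- judgmental equality is an equivalence relation, and types can be converted along it
  | eq_refl {Γ a A} : Derivable (typ Γ a A) → Derivable (eq Γ a a A)
  | eq_symm {Γ a b A} : Derivable (eq Γ a b A) → Derivable (eq Γ b a A)
  | eq_trans {Γ a b c A} : Derivable (eq Γ a b A) → Derivable (eq Γ b c A) →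
      Derivable (eq Γ a c A)
  | conv {Γ a A B i} : Derivable (typ Γ a A) → Derivable (eq Γ A B (univ i)) →
      Derivable (typ Γ a B)
  | eq_conv {Γ a b A B i} : Derivable (eq Γ a b A) → Derivable (eq Γ A B (univ i)) →
      Derivable (eq Γ a b B)
  -- universes
  | univ {Γ i} : Derivable (ctx Γ) → Derivable (typ Γ (univ i) (univ (i + 1)))
  | cumul {Γ A i} : Derivable (typ Γ A (univ i)) → Derivable (typ Γ A (univ (i + 1)))
  | eq_cumul {Γ A B i} : Derivable (eq Γ A B (univ i)) → Derivable (eq Γ A B (univ (i + 1)))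
  -- dependent function types
  | pi {Γ A B i} : Derivable (typ Γ A (univ i)) → Derivable (typ (A :: Γ) B (univ i)) →
      Derivable (typ Γ (pi A B) (univ i))
  | pi_congr {Γ A A' B B' i} : Derivable (eq Γ A A' (univ i)) →
      Derivable (eq (A :: Γ) B B' (univ i)) → Derivable (eq Γ (pi A B) (pi A' B') (univ i))
  | lam {Γ A B b} : Derivable (typ (A :: Γ) b B) → Derivable (typ Γ (lam A b) (pi A B))
  | lam_congr {Γ A A' B b b' i} : Derivable (eq Γ A A' (univ i)) →
      Derivable (eq (A :: Γ) b b' B) → Derivable (eq Γ (lam A b) (lam A' b') (pi A B))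
  | app {Γ A B f a} : Derivable (typ Γ f (pi A B)) → Derivable (typ Γ a A) →
      Derivable (typ Γ (app f a) (B.inst a))
  | app_congr {Γ A B f f' a a'} : Derivable (eq Γ f f' (pi A B)) → Derivable (eq Γ a a' A) →
      Derivable (eq Γ (app f a) (app f' a') (B.inst a))
  | pi_beta {Γ A B b a} : Derivable (typ (A :: Γ) b B) → Derivable (typ Γ a A) →
      Derivable (eq Γ (app (lam A b) a) (b.inst a) (B.inst a))
  | pi_eta {Γ A B f} : Derivable (typ Γ f (pi A B)) →
      Derivable (eq Γ f (lam A (app f.wk (var 0))) (pi A B))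
  -- dependent pair types
  | sigma {Γ A B i} : Derivable (typ Γ A (univ i)) → Derivable (typ (A :: Γ) B (univ i)) →
      Derivable (typ Γ (sigma A B) (univ i))
  | sigma_congr {Γ A A' B B' i} : Derivable (eq Γ A A' (univ i)) →
      Derivable (eq (A :: Γ) B B' (univ i)) →
      Derivable (eq Γ (sigma A B) (sigma A' B') (univ i))
  | pair {Γ A B a b i} : Derivable (typ (A :: Γ) B (univ i)) → Derivable (typ Γ a A) →
      Derivable (typ Γ b (B.inst a)) → Derivable (typ Γ (pair a b) (sigma A B))
  | pair_congr {Γ A B a a' b b' i} : Derivable (typ (A :: Γ) B (univ i)) →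
      Derivable (eq Γ a a' A) → Derivable (eq Γ b b' (B.inst a)) →
      Derivable (eq Γ (pair a b) (pair a' b') (sigma A B))
  | fst {Γ A B p} : Derivable (typ Γ p (sigma A B)) → Derivable (typ Γ (fst p) A)
  | fst_congr {Γ A B p p'} : Derivable (eq Γ p p' (sigma A B)) →
      Derivable (eq Γ (fst p) (fst p') A)
  | snd {Γ A B p} : Derivable (typ Γ p (sigma A B)) →
      Derivable (typ Γ (snd p) (B.inst (fst p)))
  | snd_congr {Γ A B p p'} : Derivable (eq Γ p p' (sigma A B)) →
      Derivable (eq Γ (snd p) (snd p') (B.inst (fst p)))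
  | fst_beta {Γ A B a b i} : Derivable (typ (A :: Γ) B (univ i)) → Derivable (typ Γ a A) →
      Derivable (typ Γ b (B.inst a)) → Derivable (eq Γ (fst (pair a b)) a A)
  | snd_beta {Γ A B a b i} : Derivable (typ (A :: Γ) B (univ i)) → Derivable (typ Γ a A) →
      Derivable (typ Γ b (B.inst a)) → Derivable (eq Γ (snd (pair a b)) b (B.inst a))
  | sigma_eta {Γ A B p} : Derivable (typ Γ p (sigma A B)) →
      Derivable (eq Γ p (pair (fst p) (snd p)) (sigma A B))
  -- constants, and the computation rules of the eliminators
  | const {Γ} (c : Const) (i j : ℕ) : Derivable (ctx Γ) →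
      Derivable (typ Γ (const c) (c.type i j).close)
  | unit_beta {Γ C c j} :
      Derivable (typ Γ C (arr (const .unit) (univ j))) →
      Derivable (typ Γ c (app C (const .star))) →
      Derivable (eq Γ (capp .unitInd [C, c, const .star]) c (app C (const .star)))
  | sum_beta_inl {Γ A B C f g a i j} :
      Derivable (typ Γ A (univ i)) → Derivable (typ Γ B (univ i)) →
      Derivable (typ Γ C (arr (capp .sum [A, B]) (univ j))) →
      Derivable (typ Γ f (pi A (app C.wk (capp .inl [A.wk, B.wk, var 0])))) →
      Derivable (typ Γ g (pi B (app C.wk (capp .inr [A.wk, B.wk, var 0])))) →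
      Derivable (typ Γ a A) →
      Derivable (eq Γ (capp .sumInd [A, B, C, f, g, capp .inl [A, B, a]]) (app f a)
        (app C (capp .inl [A, B, a])))
  | sum_beta_inr {Γ A B C f g b i j} :
      Derivable (typ Γ A (univ i)) → Derivable (typ Γ B (univ i)) →
      Derivable (typ Γ C (arr (capp .sum [A, B]) (univ j))) →
      Derivable (typ Γ f (pi A (app C.wk (capp .inl [A.wk, B.wk, var 0])))) →
      Derivable (typ Γ g (pi B (app C.wk (capp .inr [A.wk, B.wk, var 0])))) →
      Derivable (typ Γ b B) →
      Derivable (eq Γ (capp .sumInd [A, B, C, f, g, capp .inr [A, B, b]]) (app g b)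
        (app C (capp .inr [A, B, b])))
  | nat_beta_zero {Γ C z s j} :
      Derivable (typ Γ C (arr (const .nat) (univ j))) →
      Derivable (typ Γ z (app C (const .zero))) →
      Derivable (typ Γ s (pi (const .nat)
        (arr (app C.wk (var 0)) (app C.wk (capp .succ [var 0]))))) →
      Derivable (eq Γ (capp .natInd [C, z, s, const .zero]) z (app C (const .zero)))
  | nat_beta_succ {Γ C z s n j} :
      Derivable (typ Γ C (arr (const .nat) (univ j))) →
      Derivable (typ Γ z (app C (const .zero))) →
      Derivable (typ Γ s (pi (const .nat)
        (arr (app C.wk (var 0)) (app C.wk (capp .succ [var 0]))))) →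
      Derivable (typ Γ n (const .nat)) →
      Derivable (eq Γ (capp .natInd [C, z, s, capp .succ [n]])
        (app (app s n) (capp .natInd [C, z, s, n])) (app C (capp .succ [n])))
  | id_beta {Γ A C c a i j} :
      Derivable (typ Γ A (univ i)) →
      Derivable (typ Γ C (pi A (pi A.wk (pi (capp .id [A.wk.wk, var 1, var 0]) (univ j))))) →
      Derivable (typ Γ c (pi A
        (app (app (app C.wk (var 0)) (var 0)) (capp .refl [A.wk, var 0])))) →
      Derivable (typ Γ a A) →
      Derivable (eq Γ (capp .J [A, C, c, a, a, capp .refl [A, a]]) (app c a)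
        (app (app (app C a) a) (capp .refl [A, a])))
  | circle_beta {Γ C b l j} :
      Derivable (typ Γ C (arr (const .circle) (univ j))) →
      Derivable (typ Γ b (app C (const .base))) →
      Derivable (typ Γ l (circleMethod C b)) →
      Derivable (eq Γ (capp .circleInd [C, b, l, const .base]) b (app C (const .base)))

/-! ## Wild categories with families -/

/-- The type of wild CwF's, an iterated `Σ`-type with 26 components. The levels `a b c d` are those
of the universes in which contexts, substitutions, types and terms live. All implicit arguments are
written out: `Γ Θ Δ : Con` come first, then the arguments that are displayed in the usual notation.
A path over `p` is a path out of the transport along `p`. -/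
def wildCwF (a b c d : ℕ) : Exp :=
  -- a semicategory of contexts and substitutions
  Sig (U a) fun Con =>
  Sig (Con ⟶ₑ Con ⟶ₑ U b) fun Sub =>
  let sub (Γ Δ : Exp) : Exp := Sub ⬝ₑ Γ ⬝ₑ Δ
  Sig (Pi Con fun Γ => Pi Con fun Θ => Pi Con fun Δ => sub Θ Δ ⟶ₑ sub Γ Θ ⟶ₑ sub Γ Δ) fun comp =>
  let cmp (Γ Θ Δ σ δ : Exp) : Exp := comp ⬝ₑ Γ ⬝ₑ Θ ⬝ₑ Δ ⬝ₑ σ ⬝ₑ δ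
  Sig (Pi Con fun Ξ => Pi Con fun Γ => Pi Con fun Θ => Pi Con fun Δ =>
    Pi (sub Θ Δ) fun σ => Pi (sub Γ Θ) fun δ => Pi (sub Ξ Γ) fun ν =>
      Id (sub Ξ Δ) (cmp Ξ Γ Δ (cmp Γ Θ Δ σ δ) ν) (cmp Ξ Θ Δ σ (cmp Ξ Γ Θ δ ν))) fun _assoc =>
  -- identity substitutions
  Sig (Pi Con fun Γ => sub Γ Γ) fun ident =>
  Sig (Pi Con fun Γ => Pi Con fun Δ => Pi (sub Γ Δ) fun σ =>
    Id (sub Γ Δ) (cmp Γ Δ Δ (ident ⬝ₑ Δ) σ) σ) fun _idl =>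
  Sig (Pi Con fun Γ => Pi Con fun Δ => Pi (sub Γ Δ) fun σ =>
    Id (sub Γ Δ) (cmp Γ Γ Δ σ (ident ⬝ₑ Γ)) σ) fun _idr =>
  -- the empty context
  Sig Con fun emp =>
  Sig (Pi Con fun Γ => sub Γ emp) fun eps =>
  Sig (Pi Con fun Γ => Pi (sub Γ emp) fun σ => Id (sub Γ emp) σ (eps ⬝ₑ Γ)) fun _empEta =>
  -- a presheaf of types
  Sig (Con ⟶ₑ U c) fun Ty =>
  Sig (Pi Con fun Γ => Pi Con fun Δ => Ty ⬝ₑ Δ ⟶ₑ sub Γ Δ ⟶ₑ Ty ⬝ₑ Γ) fun tySub =>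
  let tsub (Γ Δ A σ : Exp) : Exp := tySub ⬝ₑ Γ ⬝ₑ Δ ⬝ₑ A ⬝ₑ σ
  Sig (Pi Con fun Γ => Pi (Ty ⬝ₑ Γ) fun A =>
    Id (Ty ⬝ₑ Γ) (tsub Γ Γ A (ident ⬝ₑ Γ)) A) fun tyId =>
  Sig (Pi Con fun Γ => Pi Con fun Θ => Pi Con fun Δ =>
    Pi (Ty ⬝ₑ Δ) fun A => Pi (sub Θ Δ) fun σ => Pi (sub Γ Θ) fun δ =>
      Id (Ty ⬝ₑ Γ) (tsub Γ Δ A (cmp Γ Θ Δ σ δ)) (tsub Γ Θ (tsub Θ Δ A σ) δ)) fun tyComp =>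
  -- a presheaf of terms over the category of elements
  Sig (Pi Con fun Γ => Ty ⬝ₑ Γ ⟶ₑ U d) fun Tm =>
  let tm (Γ A : Exp) : Exp := Tm ⬝ₑ Γ ⬝ₑ A
  Sig (Pi Con fun Γ => Pi Con fun Δ => Pi (Ty ⬝ₑ Δ) fun A =>
    tm Δ A ⟶ₑ Pi (sub Γ Δ) fun σ => tm Γ (tsub Γ Δ A σ)) fun tmSub =>
  let msub (Γ Δ A t σ : Exp) : Exp := tmSub ⬝ₑ Γ ⬝ₑ Δ ⬝ₑ A ⬝ₑ t ⬝ₑ σ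
  Sig (Pi Con fun Γ => Pi (Ty ⬝ₑ Γ) fun A => Pi (tm Γ A) fun t =>
    Id (tm Γ A)
      (transport (Ty ⬝ₑ Γ) (fun X => tm Γ X) (tsub Γ Γ A (ident ⬝ₑ Γ)) A (tyId ⬝ₑ Γ ⬝ₑ A)
        (msub Γ Γ A t (ident ⬝ₑ Γ)))
      t) fun _tmId =>
  Sig (Pi Con fun Γ => Pi Con fun Θ => Pi Con fun Δ =>
    Pi (Ty ⬝ₑ Δ) fun A => Pi (tm Δ A) fun t => Pi (sub Θ Δ) fun σ => Pi (sub Γ Θ) fun δ =>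
      Id (tm Γ (tsub Γ Θ (tsub Θ Δ A σ) δ))
        (transport (Ty ⬝ₑ Γ) (fun X => tm Γ X)
          (tsub Γ Δ A (cmp Γ Θ Δ σ δ)) (tsub Γ Θ (tsub Θ Δ A σ) δ)
          (tyComp ⬝ₑ Γ ⬝ₑ Θ ⬝ₑ Δ ⬝ₑ A ⬝ₑ σ ⬝ₑ δ)
          (msub Γ Δ A t (cmp Γ Θ Δ σ δ)))
        (msub Γ Θ (tsub Θ Δ A σ) (msub Θ Δ A t σ) δ)) fun _tmComp =>
  -- context extension
  Sig (Pi Con fun Γ => Ty ⬝ₑ Γ ⟶ₑ Con) fun ext =>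
  Sig (Pi Con fun Γ => Pi (Ty ⬝ₑ Γ) fun A => sub (ext ⬝ₑ Γ ⬝ₑ A) Γ) fun p =>
  Sig (Pi Con fun Γ => Pi (Ty ⬝ₑ Γ) fun A =>
    tm (ext ⬝ₑ Γ ⬝ₑ A) (tsub (ext ⬝ₑ Γ ⬝ₑ A) Γ A (p ⬝ₑ Γ ⬝ₑ A))) fun q =>
  Sig (Pi Con fun Γ => Pi Con fun Δ => Pi (Ty ⬝ₑ Δ) fun A => Pi (sub Γ Δ) fun σ =>
    tm Γ (tsub Γ Δ A σ) ⟶ₑ sub Γ (ext ⬝ₑ Δ ⬝ₑ A)) fun pairing =>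
  let pr (Γ Δ A σ t : Exp) : Exp := pairing ⬝ₑ Γ ⬝ₑ Δ ⬝ₑ A ⬝ₑ σ ⬝ₑ t
  Sig (Pi Con fun Γ => Pi Con fun Δ => Pi (Ty ⬝ₑ Δ) fun A =>
    Pi (sub Γ Δ) fun σ => Pi (tm Γ (tsub Γ Δ A σ)) fun t =>
      Id (sub Γ Δ) (cmp Γ (ext ⬝ₑ Δ ⬝ₑ A) Δ (p ⬝ₑ Δ ⬝ₑ A) (pr Γ Δ A σ t)) σ) fun extBeta₁ =>
  Sig (Pi Con fun Γ => Pi Con fun Δ => Pi (Ty ⬝ₑ Δ) fun A =>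
    Pi (sub Γ Δ) fun σ => Pi (tm Γ (tsub Γ Δ A σ)) fun t =>
      -- the path over `A[p][σ, t] = A[p ∘ (σ, t)] = A[σ]`
      let E := ext ⬝ₑ Δ ⬝ₑ A
      let pA := p ⬝ₑ Δ ⬝ₑ A
      let qA := q ⬝ₑ Δ ⬝ₑ A
      let s := pr Γ Δ A σ t
      let A₁ := tsub Γ E (tsub E Δ A pA) s
      let A₂ := tsub Γ Δ A (cmp Γ E Δ pA s)
      Id (tm Γ (tsub Γ Δ A σ))
        (transport (sub Γ Δ) (fun τ => tm Γ (tsub Γ Δ A τ)) (cmp Γ E Δ pA s) σ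
          (extBeta₁ ⬝ₑ Γ ⬝ₑ Δ ⬝ₑ A ⬝ₑ σ ⬝ₑ t)
          (transport (Ty ⬝ₑ Γ) (fun X => tm Γ X) A₁ A₂
            (inv (Ty ⬝ₑ Γ) A₂ A₁ (tyComp ⬝ₑ Γ ⬝ₑ E ⬝ₑ Δ ⬝ₑ A ⬝ₑ pA ⬝ₑ s))
            (msub Γ E (tsub E Δ A pA) qA s)))
        t) fun _extBeta₂ =>
  Sig (Pi Con fun Γ => Pi (Ty ⬝ₑ Γ) fun A =>
    let E := ext ⬝ₑ Γ ⬝ₑ A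
    Id (sub E E) (pr E Γ A (p ⬝ₑ Γ ⬝ₑ A) (q ⬝ₑ Γ ⬝ₑ A)) (ident ⬝ₑ E)) fun _extEta =>
  Pi Con fun Γ => Pi Con fun Θ => Pi Con fun Δ => Pi (Ty ⬝ₑ Δ) fun A =>
    Pi (sub Θ Δ) fun σ => Pi (tm Θ (tsub Θ Δ A σ)) fun t => Pi (sub Γ Θ) fun ν =>
      Id (sub Γ (ext ⬝ₑ Δ ⬝ₑ A))
        (cmp Γ Θ (ext ⬝ₑ Δ ⬝ₑ A) (pr Θ Δ A σ t) ν)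
        (pr Γ Δ A (cmp Γ Θ Δ σ ν)
          (transport (Ty ⬝ₑ Γ) (fun X => tm Γ X)
            (tsub Γ Θ (tsub Θ Δ A σ) ν) (tsub Γ Δ A (cmp Γ Θ Δ σ ν))
            (inv (Ty ⬝ₑ Γ) (tsub Γ Δ A (cmp Γ Θ Δ σ ν)) (tsub Γ Θ (tsub Θ Δ A σ) ν)
              (tyComp ⬝ₑ Γ ⬝ₑ Θ ⬝ₑ Δ ⬝ₑ A ⬝ₑ σ ⬝ₑ ν))
            (msub Γ Θ (tsub Θ Δ A σ) t ν)))

/-- The component of the tuple `M` after the first `n` ones (unless it is the last one). -/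
def component (M : Exp) : ℕ → Exp
  | 0 => fst M
  | n + 1 => component (snd M) n

namespace WildCwF

/-- The type of contexts of the wild CwF `M`. -/
def Con (M : Exp) : Exp := component M 0

/-- `Sub Γ Δ`. -/
def Sub (M Γ Δ : Exp) : Exp := component M 1 ⬝ₑ Γ ⬝ₑ Δ

/-- `σ ∘ δ`, for `σ : Sub Θ Δ` and `δ : Sub Γ Θ`. -/
def comp (M Γ Θ Δ σ δ : Exp) : Exp := component M 2 ⬝ₑ Γ ⬝ₑ Θ ⬝ₑ Δ ⬝ₑ σ ⬝ₑ δ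

/-- `id(Γ) : Sub Γ Γ`. -/
def ident (M Γ : Exp) : Exp := component M 4 ⬝ₑ Γ

/-- `idl_σ : id(Δ) ∘ σ = σ`, for `σ : Sub Γ Δ`. -/
def idl (M Γ Δ σ : Exp) : Exp := component M 5 ⬝ₑ Γ ⬝ₑ Δ ⬝ₑ σ

/-- `idr_σ : σ ∘ id(Γ) = σ`, for `σ : Sub Γ Δ`. -/
def idr (M Γ Δ σ : Exp) : Exp := component M 6 ⬝ₑ Γ ⬝ₑ Δ ⬝ₑ σ

/-- The type `idl_{id(Γ)} = idr_{id(Γ)}`, an identity type of `id(Γ) ∘ id(Γ) = id(Γ)`. -/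
def idlEqIdr (M Γ : Exp) : Exp :=
  Id (Id (Sub M Γ Γ) (comp M Γ Γ Γ (ident M Γ) (ident M Γ)) (ident M Γ))
    (idl M Γ Γ (ident M Γ)) (idr M Γ Γ (ident M Γ))

end WildCwF

/-- The negation of a type. -/
def Neg (A : Exp) : Exp := A ⟶ₑ cst .empty

/-- The term `a` is a closed element of the closed type `A`. -/
def Closed (a : Tm) (A : Exp) : Prop := Derivable (.typ [] a A.close)

end HoTT

/-! The model is the standard model of types and functions, changed in a single law. A context is a
type with a chosen loop `x = x` at every element. Substitutions are arbitrary functions between the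
underlying types; types and terms are families and sections over the underlying type. By β and η
both `id ∘ σ` and `σ ∘ id` are judgmentally `σ`. So `idl` can be `refl`, while `idr` can be any
family of paths `σ = σ`; the one chosen comes, by function extensionality, from the loops of the
codomain. No other component depends on `idl` or `idr`, so nothing obstructs this choice. If `idl =
idr` held at `id(Γ)`, applying `happly` and evaluating at a point would make every chosen loop of
`Γ` trivial.

It remains to find a context with a nontrivial loop. On the circle, `loop` at the base point extends
to a section of the family `x = x`, because `loop` commutes with itself. That `loop` is not `refl`
follows from univalence, by the family with fibre the booleans and monodromy negation. The
assumption `q : refl = loop` already helps to define this family: its path part is the negation path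
transported along `q`. Path induction on `q` then turns the computation rule for `loop` into `refl =
negPath`, hence `tt = ff`, hence an element of the empty type.

The statement asks for derivations in a formal system, and these are far too large to write by hand.
They are obtained by reflection: a type checker for raw terms is defined, proved sound for
`Derivable`, and evaluated on the three terms. Only soundness is proved; termination is ensured by a
bound on the recursion, and completeness is never needed.

The usual soundness proof for reduction rests on the injectivity of `Π` and `Σ` up to judgmental
equality, a deep property of the theory. It is avoided by working with annotated terms `Ann`, in
which abstractions, applications, pairs and projections record their types: a redex is contracted
only if the annotations on its two sides pass the test for conversion. Inversion (`Ok.inv`) then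
merely reads off the annotations. The argument is carried by stability under renaming and
substitution (`Derivable.renJudgment`, `Derivable.substJudgment`, `Ok.substAt`), by soundness of
reduction, conversion and inference (`Ann.whnf_sound`, `Ann.conv_sound`, `Ann.synth_sound`), and by
the evaluation `checkClosed_refutation`. The evaluation is done once, at the lowest levels;
`Derivable.lift` shifts the result to every `i`. -/

namespace HoTT

/-! ### The calculus of renamings and substitutions of raw terms. -/

namespace Tm

theorem upRen_id : upRen id = id := by
  funext n; cases n <;> rfl

theorem upRen_comp (ξ ρ : ℕ → ℕ) : upRen (ξ ∘ ρ) = upRen ξ ∘ upRen ρ := by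
  funext n; cases n <;> rfl

theorem rename_rename (t : Tm) (ρ ξ : ℕ → ℕ) : (t.rename ρ).rename ξ = t.rename (ξ ∘ ρ) := by
  induction t generalizing ρ ξ <;> simp_all [rename, upRen_comp]

theorem rename_id (t : Tm) : t.rename id = t := by
  induction t <;> simp_all [rename, upRen_id]

theorem upSub_comp_upRen (σ : ℕ → Tm) (ρ : ℕ → ℕ) :
    upSub (σ ∘ ρ) = upSub σ ∘ upRen ρ := by
  funext n; cases n <;> rfl

theorem subst_rename (t : Tm) (ρ : ℕ → ℕ) (σ : ℕ → Tm) :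
    (t.rename ρ).subst σ = t.subst (σ ∘ ρ) := by
  induction t generalizing ρ σ <;> simp_all [rename, subst, upSub_comp_upRen]

theorem wk_rename (t : Tm) (ρ : ℕ → ℕ) : t.wk.rename (upRen ρ) = (t.rename ρ).wk := by
  simp only [wk, rename_rename]; rfl

theorem upSub_rename (σ : ℕ → Tm) (ρ : ℕ → ℕ) :
    upSub (fun n => (σ n).rename ρ) = fun n => (upSub σ n).rename (upRen ρ) := by
  funext n
  cases n with
  | zero => rfl
  | succ n => simp only [upSub, wk_rename]

theorem rename_subst (t : Tm) (σ : ℕ → Tm) (ρ : ℕ → ℕ) :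
    (t.subst σ).rename ρ = t.subst (fun n => (σ n).rename ρ) := by
  induction t generalizing ρ σ <;> simp_all [rename, subst, upSub_rename]

theorem wk_subst (t : Tm) (σ : ℕ → Tm) : t.wk.subst (upSub σ) = (t.subst σ).wk := by
  simp only [wk, subst_rename, rename_subst]; rfl

theorem upSub_subst (σ τ : ℕ → Tm) :
    upSub (fun n => (σ n).subst τ) = fun n => (upSub σ n).subst (upSub τ) := by
  funext n
  cases n with
  | zero => rfl
  | succ n => simp only [upSub, wk_subst]

theorem subst_subst (t : Tm) (σ τ : ℕ → Tm) :
    (t.subst σ).subst τ = t.subst (fun n => (σ n).subst τ) := by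
  induction t generalizing σ τ <;> simp_all [subst, upSub_subst]

theorem upSub_var : upSub var = var := by
  funext n; cases n <;> rfl

theorem subst_var (t : Tm) : t.subst var = t := by
  induction t <;> simp_all [subst, upSub_var]

@[simp] theorem wk_inst (t a : Tm) : t.wk.inst a = t := by
  rw [inst, wk, subst_rename, ← subst_var t, subst_subst]; rfl

theorem wk_subst_single (t a : Tm) : t.wk.subst (single a) = t := wk_inst t a

theorem inst_rename (B a : Tm) (ρ : ℕ → ℕ) :
    (B.inst a).rename ρ = (B.rename (upRen ρ)).inst (a.rename ρ) := by
  simp only [inst, subst_rename, rename_subst]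
  congr 1; funext n; cases n <;> rfl

theorem inst_subst (B a : Tm) (σ : ℕ → Tm) :
    (B.inst a).subst σ = (B.subst (upSub σ)).inst (a.subst σ) := by
  simp only [inst, subst_subst]
  congr 1; funext n; cases n with
  | zero => rfl
  | succ n => exact (wk_inst (σ n) _).symm

-- This identifies the type of the body in an η-expansion: the codomain is weakened under its binder
-- and then instantiated at the new variable.
@[simp] theorem rename_upRen_succ_inst (B : Tm) : (B.rename (upRen Nat.succ)).inst (var 0) = B := by
  rw [inst, subst_rename]
  conv_rhs => rw [← subst_var B]
  congr 1; funext n; cases n <;> rfl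

theorem arr_rename (A B : Tm) (ρ : ℕ → ℕ) : (arr A B).rename ρ = arr (A.rename ρ) (B.rename ρ) := by
  simp only [arr, rename, wk_rename]

theorem arr_subst (A B : Tm) (σ : ℕ → Tm) : (arr A B).subst σ = arr (A.subst σ) (B.subst σ) := by
  simp only [arr, subst, wk_subst]

theorem circleMethod_rename (C b : Tm) (ρ : ℕ → ℕ) :
    (circleMethod C b).rename ρ = circleMethod (C.rename ρ) (b.rename ρ) := by
  simp [circleMethod, capp, rename, arr_rename, wk_rename, upRen]

theorem circleMethod_subst (C b : Tm) (σ : ℕ → Tm) :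
    (circleMethod C b).subst σ = circleMethod (C.subst σ) (b.subst σ) := by
  have h0 (τ : ℕ → Tm) : upSub τ 0 = var 0 := rfl
  have h1 : upSub (upSub (upSub σ)) 1 = var 1 := rfl
  have h2 : upSub (upSub (upSub σ)) 2 = var 2 := rfl
  have h3 : upSub (upSub σ) 1 = var 1 := rfl
  simp [circleMethod, capp, subst, arr_subst, wk_subst, h0, h1, h2, h3]

end Tm

theorem Const.type_rename (c : Const) (i j : ℕ) (ρ : ℕ → ℕ) :
    (c.type i j).close.rename ρ = (c.type i j).close := by
  cases c <;> rfl

theorem Const.type_subst (c : Const) (i j : ℕ) (σ : ℕ → Tm) :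
    (c.type i j).close.subst σ = (c.type i j).close := by
  cases c <;> rfl

end HoTT

/-! ### Stability of derivable judgments under renaming and substitution. -/

namespace HoTT

open Tm

/-- `ρ` is a renaming from the context `Γ` to the context `Δ`. -/
def RenOk (ρ : ℕ → ℕ) (Γ Δ : Ctx) : Prop :=
  ∀ n A, Γ[n]? = some A → ∃ A', Δ[ρ n]? = some A' ∧
    A'.rename (· + (ρ n + 1)) = (A.rename (· + (n + 1))).rename ρ

theorem RenOk.up {ρ : ℕ → ℕ} {Γ Δ : Ctx} (h : RenOk ρ Γ Δ) (A : Tm) :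
    RenOk (upRen ρ) (A :: Γ) (A.rename ρ :: Δ) := by
  rintro (_ | n) B hB
  · obtain rfl : A = B := by simpa using hB
    exact ⟨_, rfl, by simp only [rename_rename]; rfl⟩
  · obtain ⟨B', h1, h2⟩ := h n B (by simpa using hB)
    refine ⟨B', by simpa [upRen] using h1, ?_⟩
    have := congrArg wk h2
    simp only [wk, rename_rename] at this ⊢
    exact this

theorem RenOk.succ (A : Tm) (Γ : Ctx) : RenOk Nat.succ Γ (A :: Γ) := fun n B hB =>
  ⟨B, by simpa using hB, by simp only [rename_rename]; rfl⟩

/-- The types in a context are stable under renaming. -/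
def RenCtx : Ctx → Prop
  | [] => True
  | A :: Γ => RenCtx Γ ∧ ∃ i, ∀ Δ ρ, Derivable (.ctx Δ) → RenOk ρ Γ Δ →
      Derivable (.typ Δ (A.rename ρ) (.univ i))

/-- A judgment is stable under renaming. -/
def RenJudgment : Judgment → Prop
  | .ctx Γ => RenCtx Γ
  | .typ Γ a A => RenCtx Γ ∧ ∀ Δ ρ, Derivable (.ctx Δ) → RenOk ρ Γ Δ →
      Derivable (.typ Δ (a.rename ρ) (A.rename ρ))
  | .eq Γ a b A => RenCtx Γ ∧ ∀ Δ ρ, Derivable (.ctx Δ) → RenOk ρ Γ Δ →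
      Derivable (.eq Δ (a.rename ρ) (b.rename ρ) (A.rename ρ))

theorem RenCtx.up {A : Tm} {Γ Δ : Ctx} {ρ : ℕ → ℕ} (h : RenCtx (A :: Γ))
    (hΔ : Derivable (.ctx Δ)) (hρ : RenOk ρ Γ Δ) :
    Derivable (.ctx (A.rename ρ :: Δ)) ∧ RenOk (upRen ρ) (A :: Γ) (A.rename ρ :: Δ) :=
  let ⟨_, _, h⟩ := h
  ⟨.ctx_cons (h Δ ρ hΔ hρ), hρ.up A⟩

/-- Induction on the derivation. Below a binder, the extended target context must again be
well-formed, but `lam` has no premise about its domain. The induction hypothesis therefore also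
carries the stability of all types in the context, and `RenCtx.up` extracts what is needed. -/
theorem Derivable.renJudgment {J : Judgment} (h : Derivable J) : RenJudgment J := by
  induction h with
  | ctx_nil => trivial
  | ctx_cons _ ih => exact ⟨ih.1, _, ih.2⟩
  | @var Γ n A _ hn ih =>
    refine ⟨ih, fun Δ ρ hΔ hρ => ?_⟩
    obtain ⟨A', h1, h2⟩ := hρ n A hn
    rw [← h2]
    exact .var hΔ h1
  | eq_refl _ ih => exact ⟨ih.1, fun Δ ρ hΔ hρ => .eq_refl (ih.2 Δ ρ hΔ hρ)⟩
  | eq_symm _ ih => exact ⟨ih.1, fun Δ ρ hΔ hρ => .eq_symm (ih.2 Δ ρ hΔ hρ)⟩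
  | eq_trans _ _ ih ih' =>
    exact ⟨ih.1, fun Δ ρ hΔ hρ => .eq_trans (ih.2 Δ ρ hΔ hρ) (ih'.2 Δ ρ hΔ hρ)⟩
  | conv _ _ ih ih' =>
    exact ⟨ih.1, fun Δ ρ hΔ hρ => .conv (ih.2 Δ ρ hΔ hρ) (ih'.2 Δ ρ hΔ hρ)⟩
  | eq_conv _ _ ih ih' =>
    exact ⟨ih.1, fun Δ ρ hΔ hρ => .eq_conv (ih.2 Δ ρ hΔ hρ) (ih'.2 Δ ρ hΔ hρ)⟩
  | univ _ ih => exact ⟨ih, fun Δ ρ hΔ hρ => .univ hΔ⟩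
  | cumul _ ih => exact ⟨ih.1, fun Δ ρ hΔ hρ => .cumul (ih.2 Δ ρ hΔ hρ)⟩
  | eq_cumul _ ih => exact ⟨ih.1, fun Δ ρ hΔ hρ => .eq_cumul (ih.2 Δ ρ hΔ hρ)⟩
  | pi _ _ ih ih' =>
    refine ⟨ih.1, fun Δ ρ hΔ hρ => ?_⟩
    obtain ⟨h1, h2⟩ := ih'.1.up hΔ hρ
    exact .pi (ih.2 Δ ρ hΔ hρ) (ih'.2 _ _ h1 h2)
  | pi_congr _ _ ih ih' =>
    refine ⟨ih.1, fun Δ ρ hΔ hρ => ?_⟩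
    obtain ⟨h1, h2⟩ := ih'.1.up hΔ hρ
    exact .pi_congr (ih.2 Δ ρ hΔ hρ) (ih'.2 _ _ h1 h2)
  | lam _ ih =>
    refine ⟨ih.1.1, fun Δ ρ hΔ hρ => ?_⟩
    obtain ⟨h1, h2⟩ := ih.1.up hΔ hρ
    exact .lam (ih.2 _ _ h1 h2)
  | lam_congr _ _ ih ih' =>
    refine ⟨ih.1, fun Δ ρ hΔ hρ => ?_⟩
    obtain ⟨h1, h2⟩ := ih'.1.up hΔ hρ
    exact .lam_congr (ih.2 Δ ρ hΔ hρ) (ih'.2 _ _ h1 h2)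
  | app _ _ ih ih' =>
    refine ⟨ih.1, fun Δ ρ hΔ hρ => ?_⟩
    rw [inst_rename]
    exact .app (ih.2 Δ ρ hΔ hρ) (ih'.2 Δ ρ hΔ hρ)
  | app_congr _ _ ih ih' =>
    refine ⟨ih.1, fun Δ ρ hΔ hρ => ?_⟩
    rw [inst_rename]
    exact .app_congr (ih.2 Δ ρ hΔ hρ) (ih'.2 Δ ρ hΔ hρ)
  | pi_beta _ _ ih ih' =>
    refine ⟨ih'.1, fun Δ ρ hΔ hρ => ?_⟩
    obtain ⟨h1, h2⟩ := ih.1.up hΔ hρ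
    rw [inst_rename, inst_rename]
    exact .pi_beta (ih.2 _ _ h1 h2) (ih'.2 Δ ρ hΔ hρ)
  | pi_eta _ ih =>
    refine ⟨ih.1, fun Δ ρ hΔ hρ => ?_⟩
    simp only [rename, wk_rename]
    exact .pi_eta (ih.2 Δ ρ hΔ hρ)
  | sigma _ _ ih ih' =>
    refine ⟨ih.1, fun Δ ρ hΔ hρ => ?_⟩
    obtain ⟨h1, h2⟩ := ih'.1.up hΔ hρ
    exact .sigma (ih.2 Δ ρ hΔ hρ) (ih'.2 _ _ h1 h2)
  | sigma_congr _ _ ih ih' =>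
    refine ⟨ih.1, fun Δ ρ hΔ hρ => ?_⟩
    obtain ⟨h1, h2⟩ := ih'.1.up hΔ hρ
    exact .sigma_congr (ih.2 Δ ρ hΔ hρ) (ih'.2 _ _ h1 h2)
  | pair _ _ _ ih ih' ih'' =>
    refine ⟨ih'.1, fun Δ ρ hΔ hρ => ?_⟩
    obtain ⟨h1, h2⟩ := ih.1.up hΔ hρ
    exact .pair (ih.2 _ _ h1 h2) (ih'.2 Δ ρ hΔ hρ)
      (by simpa only [inst_rename] using ih''.2 Δ ρ hΔ hρ)
  | pair_congr _ _ _ ih ih' ih'' =>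
    refine ⟨ih'.1, fun Δ ρ hΔ hρ => ?_⟩
    obtain ⟨h1, h2⟩ := ih.1.up hΔ hρ
    exact .pair_congr (ih.2 _ _ h1 h2) (ih'.2 Δ ρ hΔ hρ)
      (by simpa only [inst_rename] using ih''.2 Δ ρ hΔ hρ)
  | fst _ ih => exact ⟨ih.1, fun Δ ρ hΔ hρ => .fst (ih.2 Δ ρ hΔ hρ)⟩
  | fst_congr _ ih => exact ⟨ih.1, fun Δ ρ hΔ hρ => .fst_congr (ih.2 Δ ρ hΔ hρ)⟩
  | snd _ ih =>
    refine ⟨ih.1, fun Δ ρ hΔ hρ => ?_⟩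
    rw [inst_rename]
    exact .snd (ih.2 Δ ρ hΔ hρ)
  | snd_congr _ ih =>
    refine ⟨ih.1, fun Δ ρ hΔ hρ => ?_⟩
    rw [inst_rename]
    exact .snd_congr (ih.2 Δ ρ hΔ hρ)
  | fst_beta _ _ _ ih ih' ih'' =>
    refine ⟨ih'.1, fun Δ ρ hΔ hρ => ?_⟩
    obtain ⟨h1, h2⟩ := ih.1.up hΔ hρ
    exact .fst_beta (ih.2 _ _ h1 h2) (ih'.2 Δ ρ hΔ hρ)
      (by simpa only [inst_rename] using ih''.2 Δ ρ hΔ hρ)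
  | snd_beta _ _ _ ih ih' ih'' =>
    refine ⟨ih'.1, fun Δ ρ hΔ hρ => ?_⟩
    obtain ⟨h1, h2⟩ := ih.1.up hΔ hρ
    rw [inst_rename]
    exact .snd_beta (ih.2 _ _ h1 h2) (ih'.2 Δ ρ hΔ hρ)
      (by simpa only [inst_rename] using ih''.2 Δ ρ hΔ hρ)
  | sigma_eta _ ih => exact ⟨ih.1, fun Δ ρ hΔ hρ => .sigma_eta (ih.2 Δ ρ hΔ hρ)⟩
  | const c i j _ ih =>
    refine ⟨ih, fun Δ ρ hΔ hρ => ?_⟩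
    rw [Const.type_rename]
    exact .const c i j hΔ
  | unit_beta _ _ ih ih' =>
    exact ⟨ih.1, fun Δ ρ hΔ hρ => .unit_beta
      (by simpa only [arr_rename, rename, capp, List.foldl] using ih.2 Δ ρ hΔ hρ) (ih'.2 Δ ρ hΔ hρ)⟩
  | sum_beta_inl _ _ _ _ _ _ ihA ihB ihC ihf ihg iha =>
    refine ⟨ihA.1, fun Δ ρ hΔ hρ => .sum_beta_inl (ihA.2 Δ ρ hΔ hρ) (ihB.2 Δ ρ hΔ hρ)
      (by simpa only [arr_rename, rename, capp, List.foldl] using ihC.2 Δ ρ hΔ hρ) ?_ ?_ (iha.2 Δ ρ hΔ hρ)⟩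
    · simpa only [rename, capp, List.foldl, wk_rename, upRen] using ihf.2 Δ ρ hΔ hρ
    · simpa only [rename, capp, List.foldl, wk_rename, upRen] using ihg.2 Δ ρ hΔ hρ
  | sum_beta_inr _ _ _ _ _ _ ihA ihB ihC ihf ihg iha =>
    refine ⟨ihA.1, fun Δ ρ hΔ hρ => .sum_beta_inr (ihA.2 Δ ρ hΔ hρ) (ihB.2 Δ ρ hΔ hρ)
      (by simpa only [arr_rename, rename, capp, List.foldl] using ihC.2 Δ ρ hΔ hρ) ?_ ?_ (iha.2 Δ ρ hΔ hρ)⟩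
    · simpa only [rename, capp, List.foldl, wk_rename, upRen] using ihf.2 Δ ρ hΔ hρ
    · simpa only [rename, capp, List.foldl, wk_rename, upRen] using ihg.2 Δ ρ hΔ hρ
  | nat_beta_zero _ _ _ ihC ihz ihs =>
    refine ⟨ihC.1, fun Δ ρ hΔ hρ => .nat_beta_zero
      (by simpa only [arr_rename, rename, capp, List.foldl] using ihC.2 Δ ρ hΔ hρ) (ihz.2 Δ ρ hΔ hρ) ?_⟩
    simpa only [rename, capp, List.foldl, arr_rename, wk_rename, upRen] using ihs.2 Δ ρ hΔ hρ
  | nat_beta_succ _ _ _ _ ihC ihz ihs ihn =>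
    refine ⟨ihC.1, fun Δ ρ hΔ hρ => .nat_beta_succ
      (by simpa only [arr_rename, rename, capp, List.foldl] using ihC.2 Δ ρ hΔ hρ) (ihz.2 Δ ρ hΔ hρ) ?_ (ihn.2 Δ ρ hΔ hρ)⟩
    simpa only [rename, capp, List.foldl, arr_rename, wk_rename, upRen] using ihs.2 Δ ρ hΔ hρ
  | @id_beta _ _ _ _ _ _ j _ _ _ _ ihA ihC ihc iha =>
    refine ⟨ihA.1, fun Δ ρ hΔ hρ => .id_beta (j := j) (ihA.2 Δ ρ hΔ hρ) ?_ ?_ (iha.2 Δ ρ hΔ hρ)⟩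
    · simpa only [rename, capp, List.foldl, wk_rename, upRen] using ihC.2 Δ ρ hΔ hρ
    · simpa only [rename, capp, List.foldl, wk_rename, upRen] using ihc.2 Δ ρ hΔ hρ
  | circle_beta _ _ _ ihC ihb ihl =>
    exact ⟨ihC.1, fun Δ ρ hΔ hρ => .circle_beta
      (by simpa only [arr_rename, rename, capp, List.foldl] using ihC.2 Δ ρ hΔ hρ) (ihb.2 Δ ρ hΔ hρ)
      (by simpa only [circleMethod_rename] using ihl.2 Δ ρ hΔ hρ)⟩

theorem Derivable.rename {Γ Δ : Ctx} {a A : Tm} {ρ : ℕ → ℕ} (h : Derivable (.typ Γ a A))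
    (hΔ : Derivable (.ctx Δ)) (hρ : RenOk ρ Γ Δ) :
    Derivable (.typ Δ (a.rename ρ) (A.rename ρ)) :=
  h.renJudgment.2 Δ ρ hΔ hρ

theorem Derivable.rename_eq {Γ Δ : Ctx} {a b A : Tm} {ρ : ℕ → ℕ} (h : Derivable (.eq Γ a b A))
    (hΔ : Derivable (.ctx Δ)) (hρ : RenOk ρ Γ Δ) :
    Derivable (.eq Δ (a.rename ρ) (b.rename ρ) (A.rename ρ)) :=
  h.renJudgment.2 Δ ρ hΔ hρ

theorem Derivable.wk {Γ : Ctx} {a A B : Tm} (h : Derivable (.typ Γ a A))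
    (hB : Derivable (.ctx (B :: Γ))) : Derivable (.typ (B :: Γ) a.wk A.wk) :=
  h.rename hB (.succ B Γ)

/-- `σ` is a substitution from the context `Γ` to the context `Δ`. -/
def SubstOk (σ : ℕ → Tm) (Γ Δ : Ctx) : Prop :=
  ∀ n A, Γ[n]? = some A → Derivable (.typ Δ (σ n) ((A.rename (· + (n + 1))).subst σ))

theorem SubstOk.up {σ : ℕ → Tm} {Γ Δ : Ctx} {A : Tm} (h : SubstOk σ Γ Δ)
    (hA : Derivable (.ctx (A.subst σ :: Δ))) :
    SubstOk (upSub σ) (A :: Γ) (A.subst σ :: Δ) := by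
  rintro (_ | n) B hB
  · obtain rfl : A = B := by simpa using hB
    have : Derivable (.typ (A.subst σ :: Δ) (.var 0) (A.subst σ).wk) := .var hA rfl
    rw [← wk_subst] at this
    exact this
  · have := (h n B (by simpa using hB)).wk hA
    rw [← wk_subst, Tm.wk, Tm.wk, rename_rename] at this
    exact this

/-- The types in a context are stable under substitution. -/
def SubstCtx : Ctx → Prop
  | [] => True
  | A :: Γ => SubstCtx Γ ∧ ∃ i, ∀ Δ σ, Derivable (.ctx Δ) → SubstOk σ Γ Δ →
      Derivable (.typ Δ (A.subst σ) (.univ i))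

/-- A judgment is stable under substitution. -/
def SubstJudgment : Judgment → Prop
  | .ctx Γ => SubstCtx Γ
  | .typ Γ a A => SubstCtx Γ ∧ ∀ Δ σ, Derivable (.ctx Δ) → SubstOk σ Γ Δ →
      Derivable (.typ Δ (a.subst σ) (A.subst σ))
  | .eq Γ a b A => SubstCtx Γ ∧ ∀ Δ σ, Derivable (.ctx Δ) → SubstOk σ Γ Δ →
      Derivable (.eq Δ (a.subst σ) (b.subst σ) (A.subst σ))

theorem SubstCtx.up {A : Tm} {Γ Δ : Ctx} {σ : ℕ → Tm} (h : SubstCtx (A :: Γ))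
    (hΔ : Derivable (.ctx Δ)) (hσ : SubstOk σ Γ Δ) :
    Derivable (.ctx (A.subst σ :: Δ)) ∧ SubstOk (upSub σ) (A :: Γ) (A.subst σ :: Δ) :=
  let ⟨_, _, h⟩ := h
  have h := Derivable.ctx_cons (h Δ σ hΔ hσ)
  ⟨h, hσ.up h⟩

/-- The same induction as for renamings, with the variable rule given directly by `SubstOk`.
Renaming has to come first, because `SubstOk.up` weakens the substituted terms under a binder. -/
theorem Derivable.substJudgment {J : Judgment} (h : Derivable J) : SubstJudgment J := by
  induction h with
  | ctx_nil => trivial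
  | ctx_cons _ ih => exact ⟨ih.1, _, ih.2⟩
  | @var Γ n A _ hn ih => exact ⟨ih, fun Δ σ _ hσ => hσ n A hn⟩
  | eq_refl _ ih => exact ⟨ih.1, fun Δ σ hΔ hσ => .eq_refl (ih.2 Δ σ hΔ hσ)⟩
  | eq_symm _ ih => exact ⟨ih.1, fun Δ σ hΔ hσ => .eq_symm (ih.2 Δ σ hΔ hσ)⟩
  | eq_trans _ _ ih ih' =>
    exact ⟨ih.1, fun Δ σ hΔ hσ => .eq_trans (ih.2 Δ σ hΔ hσ) (ih'.2 Δ σ hΔ hσ)⟩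
  | conv _ _ ih ih' =>
    exact ⟨ih.1, fun Δ σ hΔ hσ => .conv (ih.2 Δ σ hΔ hσ) (ih'.2 Δ σ hΔ hσ)⟩
  | eq_conv _ _ ih ih' =>
    exact ⟨ih.1, fun Δ σ hΔ hσ => .eq_conv (ih.2 Δ σ hΔ hσ) (ih'.2 Δ σ hΔ hσ)⟩
  | univ _ ih => exact ⟨ih, fun Δ σ hΔ hσ => .univ hΔ⟩
  | cumul _ ih => exact ⟨ih.1, fun Δ σ hΔ hσ => .cumul (ih.2 Δ σ hΔ hσ)⟩
  | eq_cumul _ ih => exact ⟨ih.1, fun Δ σ hΔ hσ => .eq_cumul (ih.2 Δ σ hΔ hσ)⟩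
  | pi _ _ ih ih' =>
    refine ⟨ih.1, fun Δ σ hΔ hσ => ?_⟩
    obtain ⟨h1, h2⟩ := ih'.1.up hΔ hσ
    exact .pi (ih.2 Δ σ hΔ hσ) (ih'.2 _ _ h1 h2)
  | pi_congr _ _ ih ih' =>
    refine ⟨ih.1, fun Δ σ hΔ hσ => ?_⟩
    obtain ⟨h1, h2⟩ := ih'.1.up hΔ hσ
    exact .pi_congr (ih.2 Δ σ hΔ hσ) (ih'.2 _ _ h1 h2)
  | lam _ ih =>
    refine ⟨ih.1.1, fun Δ σ hΔ hσ => ?_⟩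
    obtain ⟨h1, h2⟩ := ih.1.up hΔ hσ
    exact .lam (ih.2 _ _ h1 h2)
  | lam_congr _ _ ih ih' =>
    refine ⟨ih.1, fun Δ σ hΔ hσ => ?_⟩
    obtain ⟨h1, h2⟩ := ih'.1.up hΔ hσ
    exact .lam_congr (ih.2 Δ σ hΔ hσ) (ih'.2 _ _ h1 h2)
  | app _ _ ih ih' =>
    refine ⟨ih.1, fun Δ σ hΔ hσ => ?_⟩
    rw [inst_subst]
    exact .app (ih.2 Δ σ hΔ hσ) (ih'.2 Δ σ hΔ hσ)
  | app_congr _ _ ih ih' =>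
    refine ⟨ih.1, fun Δ σ hΔ hσ => ?_⟩
    rw [inst_subst]
    exact .app_congr (ih.2 Δ σ hΔ hσ) (ih'.2 Δ σ hΔ hσ)
  | pi_beta _ _ ih ih' =>
    refine ⟨ih'.1, fun Δ σ hΔ hσ => ?_⟩
    obtain ⟨h1, h2⟩ := ih.1.up hΔ hσ
    rw [inst_subst, inst_subst]
    exact .pi_beta (ih.2 _ _ h1 h2) (ih'.2 Δ σ hΔ hσ)
  | pi_eta _ ih =>
    refine ⟨ih.1, fun Δ σ hΔ hσ => ?_⟩
    simp only [subst, wk_subst]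
    exact .pi_eta (ih.2 Δ σ hΔ hσ)
  | sigma _ _ ih ih' =>
    refine ⟨ih.1, fun Δ σ hΔ hσ => ?_⟩
    obtain ⟨h1, h2⟩ := ih'.1.up hΔ hσ
    exact .sigma (ih.2 Δ σ hΔ hσ) (ih'.2 _ _ h1 h2)
  | sigma_congr _ _ ih ih' =>
    refine ⟨ih.1, fun Δ σ hΔ hσ => ?_⟩
    obtain ⟨h1, h2⟩ := ih'.1.up hΔ hσ
    exact .sigma_congr (ih.2 Δ σ hΔ hσ) (ih'.2 _ _ h1 h2)
  | pair _ _ _ ih ih' ih'' =>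
    refine ⟨ih'.1, fun Δ σ hΔ hσ => ?_⟩
    obtain ⟨h1, h2⟩ := ih.1.up hΔ hσ
    exact .pair (ih.2 _ _ h1 h2) (ih'.2 Δ σ hΔ hσ)
      (by simpa only [inst_subst] using ih''.2 Δ σ hΔ hσ)
  | pair_congr _ _ _ ih ih' ih'' =>
    refine ⟨ih'.1, fun Δ σ hΔ hσ => ?_⟩
    obtain ⟨h1, h2⟩ := ih.1.up hΔ hσ
    exact .pair_congr (ih.2 _ _ h1 h2) (ih'.2 Δ σ hΔ hσ)
      (by simpa only [inst_subst] using ih''.2 Δ σ hΔ hσ)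
  | fst _ ih => exact ⟨ih.1, fun Δ σ hΔ hσ => .fst (ih.2 Δ σ hΔ hσ)⟩
  | fst_congr _ ih => exact ⟨ih.1, fun Δ σ hΔ hσ => .fst_congr (ih.2 Δ σ hΔ hσ)⟩
  | snd _ ih =>
    refine ⟨ih.1, fun Δ σ hΔ hσ => ?_⟩
    rw [inst_subst]
    exact .snd (ih.2 Δ σ hΔ hσ)
  | snd_congr _ ih =>
    refine ⟨ih.1, fun Δ σ hΔ hσ => ?_⟩
    rw [inst_subst]
    exact .snd_congr (ih.2 Δ σ hΔ hσ)
  | fst_beta _ _ _ ih ih' ih'' =>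
    refine ⟨ih'.1, fun Δ σ hΔ hσ => ?_⟩
    obtain ⟨h1, h2⟩ := ih.1.up hΔ hσ
    exact .fst_beta (ih.2 _ _ h1 h2) (ih'.2 Δ σ hΔ hσ)
      (by simpa only [inst_subst] using ih''.2 Δ σ hΔ hσ)
  | snd_beta _ _ _ ih ih' ih'' =>
    refine ⟨ih'.1, fun Δ σ hΔ hσ => ?_⟩
    obtain ⟨h1, h2⟩ := ih.1.up hΔ hσ
    rw [inst_subst]
    exact .snd_beta (ih.2 _ _ h1 h2) (ih'.2 Δ σ hΔ hσ)
      (by simpa only [inst_subst] using ih''.2 Δ σ hΔ hσ)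
  | sigma_eta _ ih => exact ⟨ih.1, fun Δ σ hΔ hσ => .sigma_eta (ih.2 Δ σ hΔ hσ)⟩
  | const c i j _ ih =>
    refine ⟨ih, fun Δ σ hΔ hσ => ?_⟩
    rw [Const.type_subst]
    exact .const c i j hΔ
  | unit_beta _ _ ih ih' =>
    exact ⟨ih.1, fun Δ σ hΔ hσ => .unit_beta
      (by simpa only [arr_subst, subst, capp, List.foldl] using ih.2 Δ σ hΔ hσ) (ih'.2 Δ σ hΔ hσ)⟩
  | sum_beta_inl _ _ _ _ _ _ ihA ihB ihC ihf ihg iha =>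
    refine ⟨ihA.1, fun Δ σ hΔ hσ => .sum_beta_inl (ihA.2 Δ σ hΔ hσ) (ihB.2 Δ σ hΔ hσ)
      (by simpa only [arr_subst, subst, capp, List.foldl] using ihC.2 Δ σ hΔ hσ) ?_ ?_ (iha.2 Δ σ hΔ hσ)⟩
    · simpa only [subst, capp, List.foldl, wk_subst, upSub] using ihf.2 Δ σ hΔ hσ
    · simpa only [subst, capp, List.foldl, wk_subst, upSub] using ihg.2 Δ σ hΔ hσ
  | sum_beta_inr _ _ _ _ _ _ ihA ihB ihC ihf ihg iha =>
    refine ⟨ihA.1, fun Δ σ hΔ hσ => .sum_beta_inr (ihA.2 Δ σ hΔ hσ) (ihB.2 Δ σ hΔ hσ)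
      (by simpa only [arr_subst, subst, capp, List.foldl] using ihC.2 Δ σ hΔ hσ) ?_ ?_ (iha.2 Δ σ hΔ hσ)⟩
    · simpa only [subst, capp, List.foldl, wk_subst, upSub] using ihf.2 Δ σ hΔ hσ
    · simpa only [subst, capp, List.foldl, wk_subst, upSub] using ihg.2 Δ σ hΔ hσ
  | nat_beta_zero _ _ _ ihC ihz ihs =>
    refine ⟨ihC.1, fun Δ σ hΔ hσ => .nat_beta_zero
      (by simpa only [arr_subst, subst, capp, List.foldl] using ihC.2 Δ σ hΔ hσ) (ihz.2 Δ σ hΔ hσ) ?_⟩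
    simpa only [subst, capp, List.foldl, arr_subst, wk_subst, upSub] using ihs.2 Δ σ hΔ hσ
  | nat_beta_succ _ _ _ _ ihC ihz ihs ihn =>
    refine ⟨ihC.1, fun Δ σ hΔ hσ => .nat_beta_succ
      (by simpa only [arr_subst, subst, capp, List.foldl] using ihC.2 Δ σ hΔ hσ) (ihz.2 Δ σ hΔ hσ) ?_ (ihn.2 Δ σ hΔ hσ)⟩
    simpa only [subst, capp, List.foldl, arr_subst, wk_subst, upSub] using ihs.2 Δ σ hΔ hσ
  | @id_beta _ _ _ _ _ _ j _ _ _ _ ihA ihC ihc iha =>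
    refine ⟨ihA.1, fun Δ σ hΔ hσ => .id_beta (j := j) (ihA.2 Δ σ hΔ hσ) ?_ ?_ (iha.2 Δ σ hΔ hσ)⟩
    · have h0 : (Tm.var 0).wk = Tm.var 1 := rfl
      simpa only [subst, capp, List.foldl, wk_subst, upSub, h0] using ihC.2 Δ σ hΔ hσ
    · simpa only [subst, capp, List.foldl, wk_subst, upSub] using ihc.2 Δ σ hΔ hσ
  | circle_beta _ _ _ ihC ihb ihl =>
    exact ⟨ihC.1, fun Δ σ hΔ hσ => .circle_beta
      (by simpa only [arr_subst, subst, capp, List.foldl] using ihC.2 Δ σ hΔ hσ) (ihb.2 Δ σ hΔ hσ)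
      (by simpa only [circleMethod_subst] using ihl.2 Δ σ hΔ hσ)⟩

theorem Derivable.subst {Γ Δ : Ctx} {a A : Tm} {σ : ℕ → Tm} (h : Derivable (.typ Γ a A))
    (hΔ : Derivable (.ctx Δ)) (hσ : SubstOk σ Γ Δ) :
    Derivable (.typ Δ (a.subst σ) (A.subst σ)) :=
  h.substJudgment.2 Δ σ hΔ hσ

theorem Derivable.subst_eq {Γ Δ : Ctx} {a b A : Tm} {σ : ℕ → Tm} (h : Derivable (.eq Γ a b A))
    (hΔ : Derivable (.ctx Δ)) (hσ : SubstOk σ Γ Δ) :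
    Derivable (.eq Δ (a.subst σ) (b.subst σ) (A.subst σ)) :=
  h.substJudgment.2 Δ σ hΔ hσ

/-- The context of a derivable judgment. -/
def Judgment.context : Judgment → Ctx
  | .ctx Γ | .typ Γ _ _ | .eq Γ _ _ _ => Γ

/-- Every type in the context is well-formed in the context before it. -/
def CtxTypes : Ctx → Prop
  | [] => True
  | A :: Γ => CtxTypes Γ ∧ ∃ i, Derivable (.typ Γ A (.univ i))

theorem CtxTypes.ctx : ∀ {Γ : Ctx}, CtxTypes Γ → Derivable (.ctx Γ)
  | [], _ => .ctx_nil
  | _ :: _, ⟨_, _, h⟩ => .ctx_cons h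

/-- Apart from the context rules and `lam`, every rule has a premise in the context of its
conclusion. The only premise of `lam` lives in an extended context, of which the wanted one is the
tail. -/
theorem Derivable.ctxTypes {J : Judgment} (h : Derivable J) : CtxTypes J.context := by
  induction h with
  | ctx_nil => trivial
  | ctx_cons h ih => exact ⟨ih, _, h⟩
  | lam _ ih => exact ih.1
  | _ => assumption

theorem Derivable.typ_ctx {Γ : Ctx} {a A : Tm} (h : Derivable (.typ Γ a A)) : Derivable (.ctx Γ) :=
  h.ctxTypes.ctx

theorem Derivable.eq_ctx {Γ : Ctx} {a b A : Tm} (h : Derivable (.eq Γ a b A)) :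
    Derivable (.ctx Γ) :=
  h.ctxTypes.ctx

theorem Derivable.cumul_le {Γ : Ctx} {A : Tm} {i j : ℕ} (h : Derivable (.typ Γ A (.univ i)))
    (hij : i ≤ j) : Derivable (.typ Γ A (.univ j)) := by
  induction hij with
  | refl => exact h
  | step _ ih => exact ih.cumul

theorem Derivable.eq_cumul_le {Γ : Ctx} {A B : Tm} {i j : ℕ} (h : Derivable (.eq Γ A B (.univ i)))
    (hij : i ≤ j) : Derivable (.eq Γ A B (.univ j)) := by
  induction hij with
  | refl => exact h
  | step _ ih => exact ih.eq_cumul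

theorem SubstOk.single {Γ : Ctx} {a A : Tm} (h : Derivable (.typ Γ a A)) :
    SubstOk (single a) (A :: Γ) Γ := by
  rintro (_ | n) B hB
  · obtain rfl : A = B := by simpa using hB
    change Derivable (.typ Γ a (A.wk.inst a))
    rwa [wk_inst]
  · have := Derivable.var h.typ_ctx (by simpa using hB : Γ[n]? = some B)
    rw [← wk_inst (B.rename _) a, Tm.wk, rename_rename] at this
    exact this

theorem Derivable.inst_eq {Γ : Ctx} {a A b c B : Tm} (h : Derivable (.eq (A :: Γ) b c B))
    (ha : Derivable (.typ Γ a A)) : Derivable (.eq Γ (b.inst a) (c.inst a) (B.inst a)) :=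
  h.subst_eq ha.typ_ctx (.single ha)

/-- Both sides are β-reducts of the abstraction of `B` applied to `a` and to `a'`, so congruence of
application suffices and no separate induction over `B` is needed. -/
theorem Derivable.inst_congr_type {Γ : Ctx} {a a' A B : Tm} {i j : ℕ}
    (hA : Derivable (.typ Γ A (.univ i))) (h : Derivable (.typ (A :: Γ) B (.univ j)))
    (ha : Derivable (.typ Γ a A)) (ha' : Derivable (.typ Γ a' A))
    (haa' : Derivable (.eq Γ a a' A)) :
    Derivable (.eq Γ (B.inst a) (B.inst a') (.univ j)) :=
  .eq_trans (.eq_symm (.pi_beta h ha)) (.eq_trans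
    (.app_congr (.lam_congr (.eq_refl hA) (.eq_refl h)) haa') (.pi_beta h ha'))

/-- Two contexts whose types are judgmentally equal. -/
theorem SubstOk.conv {Γ : Ctx} {A A' : Tm} {i : ℕ} (hA : Derivable (.typ Γ A (.univ i)))
    (h : Derivable (.eq Γ A A' (.univ i))) : SubstOk var (A' :: Γ) (A :: Γ) := by
  have hc : Derivable (.ctx (A :: Γ)) := .ctx_cons hA
  rintro (_ | n) B hB
  · obtain rfl : A' = B := by simpa using hB
    rw [subst_var]
    exact .conv (.var hc rfl) (h.rename_eq hc (.succ A Γ))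
  · rw [subst_var]
    exact .var hc (by simpa using hB)

end HoTT

namespace HoTT

open Tm

/-! ## Constants applied to arguments -/

namespace Tm

/-- The substitution that replaces variable `0` by `a` and the others according to `σ`. -/
def cons (a : Tm) (σ : ℕ → Tm) : ℕ → Tm
  | 0 => a
  | n + 1 => σ n

theorem subst_upSub_inst (B a : Tm) (σ : ℕ → Tm) :
    (B.subst (upSub σ)).inst a = B.subst (cons a σ) := by
  rw [inst, subst_subst]
  congr 1; funext n; cases n with
  | zero => rfl
  | succ n => exact wk_inst (σ n) a

end Tm

namespace Derivable

variable {Γ : Ctx} {A A' B B' C C' a a' b b' c c' f f' g g' l l' x x' y y' p p' : Tm} {i j : ℕ}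

theorem const_subst (h : Derivable (.ctx Γ)) (c : Const) (i j : ℕ) :
    Derivable (.typ Γ (.const c) ((c.type i j).close.subst Tm.var)) := by
  rw [Const.type_subst]; exact .const c i j h

/-- Arguments of a constant are collected in a substitution instead of being instantiated one at a
time. Starting from `const_subst`, the type of a constant applied to its arguments is then its
closed type under an explicit substitution, which evaluates to the expected type by computation
alone. All the rules for applied constants below arise in this way. -/
theorem app_subst {σ : ℕ → Tm} (hf : Derivable (.typ Γ f ((Tm.pi A B).subst σ)))
    (ha : Derivable (.typ Γ a (A.subst σ))) :
    Derivable (.typ Γ (.app f a) (B.subst (cons a σ))) := by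
  rw [← subst_upSub_inst]; exact .app hf ha

theorem app_subst_congr {σ : ℕ → Tm} (hf : Derivable (.eq Γ f f' ((Tm.pi A B).subst σ)))
    (ha : Derivable (.eq Γ a a' (A.subst σ))) :
    Derivable (.eq Γ (.app f a) (.app f' a') (B.subst (cons a σ))) := by
  rw [← subst_upSub_inst]; exact .app_congr hf ha

theorem const_congr (h : Derivable (.ctx Γ)) (c : Const) (i j : ℕ) :
    Derivable (.eq Γ (.const c) (.const c) ((c.type i j).close.subst Tm.var)) :=
  .eq_refl (const_subst h c i j)

theorem id_congr (hA : Derivable (.eq Γ A A' (.univ i))) (ha : Derivable (.eq Γ a a' A))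
    (hb : Derivable (.eq Γ b b' A)) :
    Derivable (.eq Γ (capp .id [A, a, b]) (capp .id [A', a', b']) (.univ i)) :=
  app_subst_congr (app_subst_congr (app_subst_congr (const_congr hA.eq_ctx .id i 0) hA) ha) hb

theorem refl_congr (hA : Derivable (.eq Γ A A' (.univ i))) (ha : Derivable (.eq Γ a a' A)) :
    Derivable (.eq Γ (capp .refl [A, a]) (capp .refl [A', a']) (capp .id [A, a, a])) :=
  app_subst_congr (app_subst_congr (const_congr hA.eq_ctx .refl i 0) hA) ha

/-- The type of the motive of path induction. -/
def motiveJ (A : Tm) (j : ℕ) : Tm :=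
  .pi A (.pi A.wk (.pi (capp .id [A.wk.wk, .var 1, .var 0]) (.univ j)))

/-- The type of the base case of path induction. -/
def methodJ (A C : Tm) : Tm :=
  .pi A (.app (.app (.app C.wk (.var 0)) (.var 0)) (capp .refl [A.wk, .var 0]))

theorem J_congr (hA : Derivable (.eq Γ A A' (.univ i)))
    (hC : Derivable (.eq Γ C C' (motiveJ A j))) (hc : Derivable (.eq Γ c c' (methodJ A C)))
    (hx : Derivable (.eq Γ x x' A)) (hy : Derivable (.eq Γ y y' A))
    (hp : Derivable (.eq Γ p p' (capp .id [A, x, y]))) :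
    Derivable (.eq Γ (capp .J [A, C, c, x, y, p]) (capp .J [A', C', c', x', y', p'])
      (.app (.app (.app C x) y) p)) :=
  app_subst_congr (app_subst_congr (app_subst_congr (app_subst_congr (app_subst_congr
    (app_subst_congr (const_congr hA.eq_ctx .J i j) hA) hC) hc) hx) hy) hp

theorem sum_congr (hA : Derivable (.eq Γ A A' (.univ i))) (hB : Derivable (.eq Γ B B' (.univ i))) :
    Derivable (.eq Γ (capp .sum [A, B]) (capp .sum [A', B']) (.univ i)) :=
  app_subst_congr (app_subst_congr (const_congr hA.eq_ctx .sum i 0) hA) hB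

theorem inl_congr (hA : Derivable (.eq Γ A A' (.univ i))) (hB : Derivable (.eq Γ B B' (.univ i)))
    (ha : Derivable (.eq Γ a a' A)) :
    Derivable (.eq Γ (capp .inl [A, B, a]) (capp .inl [A', B', a']) (capp .sum [A, B])) :=
  app_subst_congr (app_subst_congr (app_subst_congr (const_congr hA.eq_ctx .inl i 0) hA) hB) ha

theorem inr_congr (hA : Derivable (.eq Γ A A' (.univ i))) (hB : Derivable (.eq Γ B B' (.univ i)))
    (hb : Derivable (.eq Γ b b' B)) :
    Derivable (.eq Γ (capp .inr [A, B, b]) (capp .inr [A', B', b']) (capp .sum [A, B])) :=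
  app_subst_congr (app_subst_congr (app_subst_congr (const_congr hA.eq_ctx .inr i 0) hA) hB) hb

/-- The type of the method for the left summand. -/
def methodInl (A B C : Tm) : Tm := .pi A (.app C.wk (capp .inl [A.wk, B.wk, .var 0]))

/-- The type of the method for the right summand. -/
def methodInr (A B C : Tm) : Tm := .pi B (.app C.wk (capp .inr [A.wk, B.wk, .var 0]))

theorem sumInd_congr (hA : Derivable (.eq Γ A A' (.univ i)))
    (hB : Derivable (.eq Γ B B' (.univ i)))
    (hC : Derivable (.eq Γ C C' (arr (capp .sum [A, B]) (.univ j))))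
    (hf : Derivable (.eq Γ f f' (methodInl A B C))) (hg : Derivable (.eq Γ g g' (methodInr A B C)))
    (hx : Derivable (.eq Γ x x' (capp .sum [A, B]))) :
    Derivable (.eq Γ (capp .sumInd [A, B, C, f, g, x]) (capp .sumInd [A', B', C', f', g', x'])
      (.app C x)) :=
  app_subst_congr (app_subst_congr (app_subst_congr (app_subst_congr (app_subst_congr
    (app_subst_congr (const_congr hA.eq_ctx .sumInd i j) hA) hB) hC) hf) hg) hx

theorem typ_id (hA : Derivable (.typ Γ A (.univ i))) (ha : Derivable (.typ Γ a A))
    (hb : Derivable (.typ Γ b A)) : Derivable (.typ Γ (capp .id [A, a, b]) (.univ i)) :=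
  app_subst (app_subst (app_subst (const_subst hA.typ_ctx .id i 0) hA) ha) hb

theorem typ_refl (hA : Derivable (.typ Γ A (.univ i))) (ha : Derivable (.typ Γ a A)) :
    Derivable (.typ Γ (capp .refl [A, a]) (capp .id [A, a, a])) :=
  app_subst (app_subst (const_subst hA.typ_ctx .refl i 0) hA) ha

theorem typ_J (hA : Derivable (.typ Γ A (.univ i))) (hC : Derivable (.typ Γ C (motiveJ A j)))
    (hc : Derivable (.typ Γ c (methodJ A C))) (hx : Derivable (.typ Γ x A))
    (hy : Derivable (.typ Γ y A)) (hp : Derivable (.typ Γ p (capp .id [A, x, y]))) :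
    Derivable (.typ Γ (capp .J [A, C, c, x, y, p]) (.app (.app (.app C x) y) p)) :=
  app_subst (app_subst (app_subst (app_subst (app_subst
    (app_subst (const_subst hA.typ_ctx .J i j) hA) hC) hc) hx) hy) hp

theorem typ_sum (hA : Derivable (.typ Γ A (.univ i))) (hB : Derivable (.typ Γ B (.univ i))) :
    Derivable (.typ Γ (capp .sum [A, B]) (.univ i)) :=
  app_subst (app_subst (const_subst hA.typ_ctx .sum i 0) hA) hB

theorem typ_inl (hA : Derivable (.typ Γ A (.univ i))) (hB : Derivable (.typ Γ B (.univ i)))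
    (ha : Derivable (.typ Γ a A)) :
    Derivable (.typ Γ (capp .inl [A, B, a]) (capp .sum [A, B])) :=
  app_subst (app_subst (app_subst (const_subst hA.typ_ctx .inl i 0) hA) hB) ha

theorem typ_inr (hA : Derivable (.typ Γ A (.univ i))) (hB : Derivable (.typ Γ B (.univ i)))
    (hb : Derivable (.typ Γ b B)) :
    Derivable (.typ Γ (capp .inr [A, B, b]) (capp .sum [A, B])) :=
  app_subst (app_subst (app_subst (const_subst hA.typ_ctx .inr i 0) hA) hB) hb

theorem typ_sumInd (hA : Derivable (.typ Γ A (.univ i))) (hB : Derivable (.typ Γ B (.univ i)))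
    (hC : Derivable (.typ Γ C (arr (capp .sum [A, B]) (.univ j))))
    (hf : Derivable (.typ Γ f (methodInl A B C))) (hg : Derivable (.typ Γ g (methodInr A B C)))
    (hx : Derivable (.typ Γ x (capp .sum [A, B]))) :
    Derivable (.typ Γ (capp .sumInd [A, B, C, f, g, x]) (.app C x)) :=
  app_subst (app_subst (app_subst (app_subst (app_subst
    (app_subst (const_subst hA.typ_ctx .sumInd i j) hA) hB) hC) hf) hg) hx

theorem typ_circleInd (hC : Derivable (.typ Γ C (arr (.const .circle) (.univ j))))
    (hb : Derivable (.typ Γ b (.app C (.const .base))))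
    (hl : Derivable (.typ Γ l (circleMethod C b))) :
    Derivable (.typ Γ (capp .circleInd [C, b, l])
      (.pi (.const .circle) (.app C.wk (.var 0)))) :=
  app_subst (app_subst (app_subst (const_subst hC.typ_ctx .circleInd 0 j) hC) hb) hl

end Derivable
end HoTT

namespace HoTT

open Tm

/-! ## Annotated terms -/

/-- Terms in which variables, abstractions, applications, pairs and projections carry their types,
and in which the constants that are eliminated are applied to all their parameters. -/
inductive Ann where
  | var (n : ℕ) (X : Ann)
  | univ (i : ℕ)
  | pi (A B : Ann)
  | lam (A B b : Ann)
  | app (A B f a : Ann)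
  | sigma (A B : Ann)
  | pair (A B a b : Ann)
  | fst (A B p : Ann)
  | snd (A B p : Ann)
  | const (c : Const)
  | id (A a b : Ann)
  | refl (A a : Ann)
  | J (j : ℕ) (A C c x y p : Ann)
  | sum (A B : Ann)
  | inl (A B a : Ann)
  | inr (A B b : Ann)
  | sumInd (j : ℕ) (A B C f g x : Ann)
  | circleInd (j : ℕ) (C b l : Ann)

namespace Ann

/-- The raw term without the annotations. -/
def erase : Ann → Tm
  | var n _ => .var n
  | univ i => .univ i
  | pi A B => .pi A.erase B.erase
  | lam A _ b => .lam A.erase b.erase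
  | app _ _ f a => .app f.erase a.erase
  | sigma A B => .sigma A.erase B.erase
  | pair _ _ a b => .pair a.erase b.erase
  | fst _ _ p => .fst p.erase
  | snd _ _ p => .snd p.erase
  | const c => .const c
  | id A a b => .app (.app (.app (.const .id) A.erase) a.erase) b.erase
  | refl A a => .app (.app (.const .refl) A.erase) a.erase
  | J _ A C c x y p => .app (.app (.app (.app (.app (.app (.const .J) A.erase) C.erase) c.erase)
      x.erase) y.erase) p.erase
  | sum A B => .app (.app (.const .sum) A.erase) B.erase
  | inl A B a => .app (.app (.app (.const .inl) A.erase) B.erase) a.erase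
  | inr A B b => .app (.app (.app (.const .inr) A.erase) B.erase) b.erase
  | sumInd _ A B C f g x => .app (.app (.app (.app (.app (.app (.const .sumInd) A.erase) B.erase)
      C.erase) f.erase) g.erase) x.erase
  | circleInd _ C b l => .app (.app (.app (.const .circleInd) C.erase) b.erase) l.erase

/-- Adds `k` to the variables that are not among the first `d`. -/
def shift (k d : ℕ) : Ann → Ann
  | var n X => var (bif Nat.blt n d then n else n + k) (X.shift k d)
  | univ i => univ i
  | pi A B => pi (A.shift k d) (B.shift k (d + 1))
  | lam A B b => lam (A.shift k d) (B.shift k (d + 1)) (b.shift k (d + 1))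
  | app A B f a => app (A.shift k d) (B.shift k (d + 1)) (f.shift k d) (a.shift k d)
  | sigma A B => sigma (A.shift k d) (B.shift k (d + 1))
  | pair A B a b => pair (A.shift k d) (B.shift k (d + 1)) (a.shift k d) (b.shift k d)
  | fst A B p => fst (A.shift k d) (B.shift k (d + 1)) (p.shift k d)
  | snd A B p => snd (A.shift k d) (B.shift k (d + 1)) (p.shift k d)
  | const c => const c
  | id A a b => id (A.shift k d) (a.shift k d) (b.shift k d)
  | refl A a => refl (A.shift k d) (a.shift k d)
  | J j A C c x y p => J j (A.shift k d) (C.shift k d) (c.shift k d) (x.shift k d) (y.shift k d)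
      (p.shift k d)
  | sum A B => sum (A.shift k d) (B.shift k d)
  | inl A B a => inl (A.shift k d) (B.shift k d) (a.shift k d)
  | inr A B b => inr (A.shift k d) (B.shift k d) (b.shift k d)
  | sumInd j A B C f g x => sumInd j (A.shift k d) (B.shift k d) (C.shift k d) (f.shift k d)
      (g.shift k d) (x.shift k d)
  | circleInd j C b l => circleInd j (C.shift k d) (b.shift k d) (l.shift k d)

/-- Replaces the variable `d` by `s`, which lives in the scope of the variables beyond `d`. -/
def substAt : Ann → Ann → ℕ → Ann
  | var n X, s, d => bif Nat.blt n d then var n (X.substAt s d) else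
      bif Nat.beq n d then s.shift d 0 else var (n - 1) (X.substAt s d)
  | univ i, _, _ => univ i
  | pi A B, s, d => pi (A.substAt s d) (B.substAt s (d + 1))
  | lam A B b, s, d => lam (A.substAt s d) (B.substAt s (d + 1)) (b.substAt s (d + 1))
  | app A B f a, s, d => app (A.substAt s d) (B.substAt s (d + 1)) (f.substAt s d) (a.substAt s d)
  | sigma A B, s, d => sigma (A.substAt s d) (B.substAt s (d + 1))
  | pair A B a b, s, d => pair (A.substAt s d) (B.substAt s (d + 1)) (a.substAt s d) (b.substAt s d)
  | fst A B p, s, d => fst (A.substAt s d) (B.substAt s (d + 1)) (p.substAt s d)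
  | snd A B p, s, d => snd (A.substAt s d) (B.substAt s (d + 1)) (p.substAt s d)
  | const c, _, _ => const c
  | id A a b, s, d => id (A.substAt s d) (a.substAt s d) (b.substAt s d)
  | refl A a, s, d => refl (A.substAt s d) (a.substAt s d)
  | J j A C c x y p, s, d => J j (A.substAt s d) (C.substAt s d) (c.substAt s d) (x.substAt s d)
      (y.substAt s d) (p.substAt s d)
  | sum A B, s, d => sum (A.substAt s d) (B.substAt s d)
  | inl A B a, s, d => inl (A.substAt s d) (B.substAt s d) (a.substAt s d)
  | inr A B b, s, d => inr (A.substAt s d) (B.substAt s d) (b.substAt s d)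
  | sumInd j A B C f g x, s, d => sumInd j (A.substAt s d) (B.substAt s d) (C.substAt s d)
      (f.substAt s d) (g.substAt s d) (x.substAt s d)
  | circleInd j C b l, s, d => circleInd j (C.substAt s d) (b.substAt s d) (l.substAt s d)

/-- The function `shift`, defined directly by the recursor: this is cheaper to evaluate. -/
noncomputable def fastShift (k : ℕ) (t : Ann) : ℕ → Ann :=
  rec (motive := fun _ => ℕ → Ann)
    (fun n _ X d => var (Bool.rec (Nat.add n k) n (Nat.blt n d)) (X d))
    (fun i _ => univ i)
    (fun _ _ A B d => pi (A d) (B (.succ d)))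
    (fun _ _ _ A B b d => lam (A d) (B (.succ d)) (b (.succ d)))
    (fun _ _ _ _ A B f a d => app (A d) (B (.succ d)) (f d) (a d))
    (fun _ _ A B d => sigma (A d) (B (.succ d)))
    (fun _ _ _ _ A B a b d => pair (A d) (B (.succ d)) (a d) (b d))
    (fun _ _ _ A B p d => fst (A d) (B (.succ d)) (p d))
    (fun _ _ _ A B p d => snd (A d) (B (.succ d)) (p d))
    (fun c _ => const c)
    (fun _ _ _ A a b d => id (A d) (a d) (b d))
    (fun _ _ A a d => refl (A d) (a d))
    (fun j _ _ _ _ _ _ A C c x y p d => J j (A d) (C d) (c d) (x d) (y d) (p d))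
    (fun _ _ A B d => sum (A d) (B d))
    (fun _ _ _ A B a d => inl (A d) (B d) (a d))
    (fun _ _ _ A B b d => inr (A d) (B d) (b d))
    (fun j _ _ _ _ _ _ A B C f g x d => sumInd j (A d) (B d) (C d) (f d) (g d) (x d))
    (fun j _ _ _ C b l d => circleInd j (C d) (b d) (l d)) t

theorem fastShift_eq (k : ℕ) (t : Ann) (d : ℕ) : t.fastShift k d = t.shift k d := by
  induction t generalizing d with
  | var n X ih =>
    rw [shift, ← ih]
    change var (Bool.rec (Nat.add n k) n (Nat.blt n d)) _ = _
    cases Nat.blt n d <;> rfl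
  | _ => simp only [shift]; simp_all only [fastShift]

theorem shift_zero (t : Ann) : ∀ d, t.shift 0 d = t := by
  induction t <;> intro d <;> simp_all [shift]

/-- The function `substAt`, defined directly by the recursor: this is cheaper to evaluate. -/
noncomputable def fastSubst (s : Ann) (t : Ann) : ℕ → Ann :=
  rec (motive := fun _ => ℕ → Ann)
    -- At depth `0` the term `s` is returned as it is, which avoids a traversal that shifts by `0`.
    (fun n _ X d => Bool.rec (Bool.rec (var (Nat.pred n) (X d))
      (Nat.rec s (fun d _ => s.fastShift (.succ d) 0) d) (Nat.beq n d)) (var n (X d)) (Nat.blt n d))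
    (fun i _ => univ i)
    (fun _ _ A B d => pi (A d) (B (.succ d)))
    (fun _ _ _ A B b d => lam (A d) (B (.succ d)) (b (.succ d)))
    (fun _ _ _ _ A B f a d => app (A d) (B (.succ d)) (f d) (a d))
    (fun _ _ A B d => sigma (A d) (B (.succ d)))
    (fun _ _ _ _ A B a b d => pair (A d) (B (.succ d)) (a d) (b d))
    (fun _ _ _ A B p d => fst (A d) (B (.succ d)) (p d))
    (fun _ _ _ A B p d => snd (A d) (B (.succ d)) (p d))
    (fun c _ => const c)
    (fun _ _ _ A a b d => id (A d) (a d) (b d))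
    (fun _ _ A a d => refl (A d) (a d))
    (fun j _ _ _ _ _ _ A C c x y p d => J j (A d) (C d) (c d) (x d) (y d) (p d))
    (fun _ _ A B d => sum (A d) (B d))
    (fun _ _ _ A B a d => inl (A d) (B d) (a d))
    (fun _ _ _ A B b d => inr (A d) (B d) (b d))
    (fun j _ _ _ _ _ _ A B C f g x d => sumInd j (A d) (B d) (C d) (f d) (g d) (x d))
    (fun j _ _ _ C b l d => circleInd j (C d) (b d) (l d)) t

theorem fastSubst_eq (s t : Ann) (d : ℕ) : fastSubst s t d = t.substAt s d := by
  induction t generalizing d with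
  | var n X ih =>
    rw [substAt, ← ih]
    change (Bool.rec (Bool.rec _ _ (Nat.beq n d)) _ (Nat.blt n d) : Ann) = _
    have e : Nat.rec s (fun d _ => s.fastShift (.succ d) 0) d = s.shift d 0 := by
      cases d with
      | zero => exact (s.shift_zero 0).symm
      | succ d => exact s.fastShift_eq _ _
    rw [e]
    cases Nat.blt n d <;> cases Nat.beq n d <;> rfl
  | _ => simp only [substAt]; simp_all only [fastSubst]

/-- Weakening by one variable. -/
noncomputable def wk (t : Ann) : Ann := t.fastShift 1 0

theorem wk_eq (t : Ann) : t.wk = t.shift 1 0 := t.fastShift_eq 1 0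

/-- `b.inst a` is `b[a/x]`, for the variable `x` with index `0`. -/
noncomputable def inst (b a : Ann) : Ann := fastSubst a b 0

theorem inst_eq (b a : Ann) : b.inst a = b.substAt a 0 := fastSubst_eq a b 0

theorem blt_eq_decide (m n : ℕ) : Nat.blt m n = decide (m < n) := by
  rw [Bool.eq_iff_iff, Nat.blt_eq, decide_eq_true_iff]

theorem beq_eq_decide (m n : ℕ) : Nat.beq m n = decide (m = n) := by
  rw [Bool.eq_iff_iff, Nat.beq_eq, decide_eq_true_iff]

/-- The renaming that underlies `shift`. -/
def shiftRen (k d n : ℕ) : ℕ := bif Nat.blt n d then n else n + k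

theorem upRen_shiftRen (k d : ℕ) : upRen (shiftRen k d) = shiftRen k (d + 1) := by
  funext n
  cases n with
  | zero => simp [upRen, shiftRen, blt_eq_decide]
  | succ n =>
    by_cases h : n < d <;> simp [upRen, shiftRen, h, blt_eq_decide]
    omega

theorem erase_shift (t : Ann) (k d : ℕ) : (t.shift k d).erase = t.erase.rename (shiftRen k d) := by
  induction t generalizing d <;> simp_all [shift, erase, rename, upRen_shiftRen]
  rfl

/-- The substitution that underlies `substAt`. -/
def substFun (s : Tm) (d n : ℕ) : Tm :=
  bif Nat.blt n d then .var n else bif Nat.beq n d then s.rename (· + d) else .var (n - 1)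

theorem upSub_substFun (s : Tm) (d : ℕ) : upSub (substFun s d) = substFun s (d + 1) := by
  funext n
  cases n with
  | zero => simp [upSub, substFun, blt_eq_decide]
  | succ n =>
    rcases lt_trichotomy n d with h | rfl | h
    · simp [upSub, substFun, h, blt_eq_decide, Tm.wk, rename]
    · simp [upSub, substFun, blt_eq_decide, Tm.wk, rename_rename]; rfl
    · have h1 : ¬ n < d := by omega
      have h2 : n ≠ d := by omega
      have h3 : n - 1 + 1 = n := by omega
      simp [upSub, substFun, h1, h2, h3, blt_eq_decide, beq_eq_decide, Tm.wk, rename]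

theorem shiftRen_zero (k : ℕ) : shiftRen k 0 = (· + k) := by
  funext n; simp [shiftRen, blt_eq_decide]

theorem erase_substAt (t s : Ann) (d : ℕ) :
    (t.substAt s d).erase = t.erase.subst (substFun s.erase d) := by
  induction t generalizing d <;> simp_all only [substAt, erase, subst, upSub_substFun]
  rename_i n X _
  unfold substFun
  cases Nat.blt n d <;> cases Nat.beq n d <;>
    simp [erase, erase_shift, shiftRen_zero]

theorem substFun_zero (s : Tm) : substFun s 0 = single s := by
  funext n
  cases n with
  | zero => exact rename_id s
  | succ n => rfl

@[simp] theorem erase_inst (b a : Ann) : (b.inst a).erase = b.erase.inst a.erase := by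
  rw [inst_eq, erase_substAt, substFun_zero, Tm.inst]

@[simp] theorem erase_wk (t : Ann) : t.wk.erase = t.erase.wk := by
  rw [wk_eq, erase_shift, shiftRen_zero, Tm.wk]

theorem shift_shift (t : Ann) (k d : ℕ) : (t.shift k d).shift 1 d = t.shift (k + 1) d := by
  induction t generalizing d <;> simp_all [shift]
  rename_i n _ _
  by_cases h : n < d
  · simp [h, blt_eq_decide]
  · have : ¬ n + k < d := by omega
    simp [h, this, blt_eq_decide]; omega

end Ann

/-! ## Typing of annotated terms -/

/-- `S` and `T` are related by judgmental equality and cumulativity. -/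
inductive Sub (Γ : Ctx) : Tm → Tm → Prop where
  | refl (S : Tm) : Sub Γ S S
  | conv {S T U : Tm} {i : ℕ} : Sub Γ S T → Derivable (.eq Γ T U (.univ i)) → Sub Γ S U
  | cumul {S : Tm} {i : ℕ} : Sub Γ S (.univ i) → Sub Γ S (.univ (i + 1))

theorem Sub.eq {Γ : Ctx} {S T a b : Tm} (h : Sub Γ S T) (ha : Derivable (.eq Γ a b S)) :
    Derivable (.eq Γ a b T) := by
  induction h with
  | refl => exact ha
  | conv _ h ih => exact .eq_conv ih h
  | cumul _ ih => exact .eq_cumul ih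

theorem Sub.subst {Γ Δ : Ctx} {S T : Tm} {σ : ℕ → Tm} (h : Sub Γ S T)
    (hΔ : Derivable (.ctx Δ)) (hσ : SubstOk σ Γ Δ) : Sub Δ (S.subst σ) (T.subst σ) := by
  induction h with
  | refl => exact .refl _
  | conv _ h ih => exact .conv ih (h.subst_eq hΔ hσ)
  | cumul _ ih => exact .cumul ih

/-- The annotation of a variable need not be literally its type in the context. This lemma bridges
the two when a term of the latter type is substituted for the variable. -/
theorem Derivable.var_inv {Γ : Ctx} {n : ℕ} {T : Tm} (h : Derivable (.typ Γ (.var n) T)) :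
    ∃ A, Γ[n]? = some A ∧ Sub Γ (A.rename (· + (n + 1))) T := by
  generalize hJ : Judgment.typ Γ (.var n) T = J at h
  induction h generalizing T with
  | var _ hn => cases hJ; exact ⟨_, hn, .refl _⟩
  | conv _ h ih _ =>
    cases hJ
    obtain ⟨A, h1, h2⟩ := ih rfl
    exact ⟨A, h1, h2.conv h⟩
  | cumul _ ih =>
    cases hJ
    obtain ⟨A, h1, h2⟩ := ih rfl
    exact ⟨A, h1, h2.cumul⟩
  | _ => cases hJ

open Derivable (motiveJ methodJ methodInl methodInr)

/-- Typing of annotated terms: the term has the type, and all the annotations are correct. -/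
inductive Ok : Ctx → Ann → Tm → Prop where
  | var {Γ n X i} : Derivable (.typ Γ (.var n) X.erase) → Ok Γ X (.univ i) → Ok Γ (.var n X) X.erase
  | univ {Γ i} : Derivable (.ctx Γ) → Ok Γ (.univ i) (.univ (i + 1))
  | pi {Γ A B i} : Ok Γ A (.univ i) → Ok (A.erase :: Γ) B (.univ i) → Ok Γ (.pi A B) (.univ i)
  | lam {Γ A B b i j} : Ok Γ A (.univ i) → Ok (A.erase :: Γ) B (.univ j) →
      Ok (A.erase :: Γ) b B.erase → Ok Γ (.lam A B b) (.pi A.erase B.erase)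
  | app {Γ A B f a i j} : Ok Γ A (.univ i) → Ok (A.erase :: Γ) B (.univ j) →
      Ok Γ f (.pi A.erase B.erase) → Ok Γ a A.erase → Ok Γ (.app A B f a) (B.erase.inst a.erase)
  | sigma {Γ A B i} : Ok Γ A (.univ i) → Ok (A.erase :: Γ) B (.univ i) →
      Ok Γ (.sigma A B) (.univ i)
  | pair {Γ A B a b i j} : Ok Γ A (.univ i) → Ok (A.erase :: Γ) B (.univ j) →
      Ok Γ a A.erase → Ok Γ b (B.erase.inst a.erase) → Ok Γ (.pair A B a b) (.sigma A.erase B.erase)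
  | fst {Γ A B p i j} : Ok Γ A (.univ i) → Ok (A.erase :: Γ) B (.univ j) →
      Ok Γ p (.sigma A.erase B.erase) → Ok Γ (.fst A B p) A.erase
  | snd {Γ A B p i j} : Ok Γ A (.univ i) → Ok (A.erase :: Γ) B (.univ j) →
      Ok Γ p (.sigma A.erase B.erase) → Ok Γ (.snd A B p) (B.erase.inst (.fst p.erase))
  | const {Γ} (c : Const) (i j : ℕ) : Derivable (.ctx Γ) → Ok Γ (.const c) (c.type i j).close
  | id {Γ A a b i} : Ok Γ A (.univ i) → Ok Γ a A.erase → Ok Γ b A.erase →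
      Ok Γ (.id A a b) (.univ i)
  | refl {Γ A a i} : Ok Γ A (.univ i) → Ok Γ a A.erase →
      Ok Γ (.refl A a) (capp .id [A.erase, a.erase, a.erase])
  | J {Γ A C c x y p i j} : Ok Γ A (.univ i) → Ok Γ C (motiveJ A.erase j) →
      Ok Γ c (methodJ A.erase C.erase) → Ok Γ x A.erase → Ok Γ y A.erase →
      Ok Γ p (capp .id [A.erase, x.erase, y.erase]) →
      Ok Γ (.J j A C c x y p) (.app (.app (.app C.erase x.erase) y.erase) p.erase)
  | sum {Γ A B i} : Ok Γ A (.univ i) → Ok Γ B (.univ i) → Ok Γ (.sum A B) (.univ i)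
  | inl {Γ A B a i} : Ok Γ A (.univ i) → Ok Γ B (.univ i) → Ok Γ a A.erase →
      Ok Γ (.inl A B a) (capp .sum [A.erase, B.erase])
  | inr {Γ A B b i} : Ok Γ A (.univ i) → Ok Γ B (.univ i) → Ok Γ b B.erase →
      Ok Γ (.inr A B b) (capp .sum [A.erase, B.erase])
  | sumInd {Γ A B C f g x i j} : Ok Γ A (.univ i) → Ok Γ B (.univ i) →
      Ok Γ C (arr (capp .sum [A.erase, B.erase]) (.univ j)) →
      Ok Γ f (methodInl A.erase B.erase C.erase) → Ok Γ g (methodInr A.erase B.erase C.erase) →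
      Ok Γ x (capp .sum [A.erase, B.erase]) → Ok Γ (.sumInd j A B C f g x) (.app C.erase x.erase)
  | circleInd {Γ C b l j} : Ok Γ C (arr (.const .circle) (.univ j)) →
      Ok Γ b (.app C.erase (.const .base)) → Ok Γ l (circleMethod C.erase b.erase) →
      Ok Γ (.circleInd j C b l) (.pi (.const .circle) (.app C.erase.wk (.var 0)))
  | conv {Γ t T U i} : Ok Γ t T → Derivable (.eq Γ T U (.univ i)) → Ok Γ t U
  | cumul {Γ t i} : Ok Γ t (.univ i) → Ok Γ t (.univ (i + 1))

/-- The premises of the rule that introduces the annotated term, and the type in its conclusion. -/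
def Ok.Premises (Γ : Ctx) : Ann → Tm → Prop
  | .var n X, T => (∃ i, Ok Γ X (.univ i)) ∧ Derivable (.typ Γ (.var n) X.erase) ∧ T = X.erase
  | .univ i, T => T = .univ (i + 1)
  | .pi A B, T => ∃ i, Ok Γ A (.univ i) ∧ Ok (A.erase :: Γ) B (.univ i) ∧ T = .univ i
  | .lam A B b, T => (∃ i, Ok Γ A (.univ i)) ∧ (∃ j, Ok (A.erase :: Γ) B (.univ j)) ∧
      Ok (A.erase :: Γ) b B.erase ∧ T = .pi A.erase B.erase
  | .app A B f a, T => (∃ i, Ok Γ A (.univ i)) ∧ (∃ j, Ok (A.erase :: Γ) B (.univ j)) ∧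
      Ok Γ f (.pi A.erase B.erase) ∧ Ok Γ a A.erase ∧ T = B.erase.inst a.erase
  | .sigma A B, T => ∃ i, Ok Γ A (.univ i) ∧ Ok (A.erase :: Γ) B (.univ i) ∧ T = .univ i
  | .pair A B a b, T => (∃ i, Ok Γ A (.univ i)) ∧ (∃ j, Ok (A.erase :: Γ) B (.univ j)) ∧
      Ok Γ a A.erase ∧ Ok Γ b (B.erase.inst a.erase) ∧ T = .sigma A.erase B.erase
  | .fst A B p, T => (∃ i, Ok Γ A (.univ i)) ∧ (∃ j, Ok (A.erase :: Γ) B (.univ j)) ∧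
      Ok Γ p (.sigma A.erase B.erase) ∧ T = A.erase
  | .snd A B p, T => (∃ i, Ok Γ A (.univ i)) ∧ (∃ j, Ok (A.erase :: Γ) B (.univ j)) ∧
      Ok Γ p (.sigma A.erase B.erase) ∧ T = B.erase.inst (.fst p.erase)
  | .const _, _ => True
  | .id A a b, T => ∃ i, Ok Γ A (.univ i) ∧ Ok Γ a A.erase ∧ Ok Γ b A.erase ∧ T = .univ i
  | .refl A a, T => ∃ i, Ok Γ A (.univ i) ∧ Ok Γ a A.erase ∧
      T = capp .id [A.erase, a.erase, a.erase]
  | .J j A C c x y p, T => ∃ i, Ok Γ A (.univ i) ∧ Ok Γ C (motiveJ A.erase j) ∧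
      Ok Γ c (methodJ A.erase C.erase) ∧ Ok Γ x A.erase ∧ Ok Γ y A.erase ∧
      Ok Γ p (capp .id [A.erase, x.erase, y.erase]) ∧
      T = .app (.app (.app C.erase x.erase) y.erase) p.erase
  | .sum A B, T => ∃ i, Ok Γ A (.univ i) ∧ Ok Γ B (.univ i) ∧ T = .univ i
  | .inl A B a, T => ∃ i, Ok Γ A (.univ i) ∧ Ok Γ B (.univ i) ∧ Ok Γ a A.erase ∧
      T = capp .sum [A.erase, B.erase]
  | .inr A B b, T => ∃ i, Ok Γ A (.univ i) ∧ Ok Γ B (.univ i) ∧ Ok Γ b B.erase ∧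
      T = capp .sum [A.erase, B.erase]
  | .sumInd j A B C f g x, T => ∃ i, Ok Γ A (.univ i) ∧ Ok Γ B (.univ i) ∧
      Ok Γ C (arr (capp .sum [A.erase, B.erase]) (.univ j)) ∧
      Ok Γ f (methodInl A.erase B.erase C.erase) ∧ Ok Γ g (methodInr A.erase B.erase C.erase) ∧
      Ok Γ x (capp .sum [A.erase, B.erase]) ∧ T = .app C.erase x.erase
  | .circleInd j C b l, T => Ok Γ C (arr (.const .circle) (.univ j)) ∧
      Ok Γ b (.app C.erase (.const .base)) ∧ Ok Γ l (circleMethod C.erase b.erase) ∧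
      T = .pi (.const .circle) (.app C.erase.wk (.var 0))

namespace Ok

/-- An annotated term determines the last rule of its derivation, other than conversion and
cumulativity, and its annotations supply that rule's premises. This replaces inversion for raw
terms, which would have to recover the domain and codomain from a type known only up to judgmental
equality. -/
theorem inv {Γ : Ctx} {t : Ann} {T : Tm} (h : Ok Γ t T) : ∃ S, Premises Γ t S ∧ Sub Γ S T := by
  induction h with
  | conv _ h ih => obtain ⟨S, h1, h2⟩ := ih; exact ⟨S, h1, h2.conv h⟩
  | cumul _ ih => obtain ⟨S, h1, h2⟩ := ih; exact ⟨S, h1, h2.cumul⟩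
  | univ => exact ⟨_, rfl, .refl _⟩
  | const => exact ⟨_, trivial, .refl _⟩
  | _ => exact ⟨_, by simp only [Premises]; tauto, .refl _⟩

theorem sub {Γ : Ctx} {t : Ann} {S T : Tm} (ht : Ok Γ t S) (h : Sub Γ S T) : Ok Γ t T := by
  induction h with
  | refl => exact ht
  | conv _ h ih => exact .conv ih h
  | cumul _ ih => exact .cumul ih

theorem typ {Γ : Ctx} {t : Ann} {T : Tm} (h : Ok Γ t T) : Derivable (.typ Γ t.erase T) := by
  induction h with
  | var h => exact h
  | univ h => exact .univ h
  | pi _ _ ih ih' => exact .pi ih ih'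
  | lam _ _ _ _ _ ih => exact .lam ih
  | app _ _ _ _ _ _ ih ih' => exact .app ih ih'
  | sigma _ _ ih ih' => exact .sigma ih ih'
  | pair _ _ _ _ _ ihB iha ihb => exact .pair ihB iha ihb
  | fst _ _ _ _ _ ih => exact .fst ih
  | snd _ _ _ _ _ ih => exact .snd ih
  | const c i j h => exact .const c i j h
  | id _ _ _ ih1 ih2 ih3 => exact .typ_id ih1 ih2 ih3
  | refl _ _ ih1 ih2 => exact .typ_refl ih1 ih2
  | J _ _ _ _ _ _ ih1 ih2 ih3 ih4 ih5 ih6 => exact .typ_J ih1 ih2 ih3 ih4 ih5 ih6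
  | sum _ _ ih1 ih2 => exact .typ_sum ih1 ih2
  | inl _ _ _ ih1 ih2 ih3 => exact .typ_inl ih1 ih2 ih3
  | inr _ _ _ ih1 ih2 ih3 => exact .typ_inr ih1 ih2 ih3
  | sumInd _ _ _ _ _ _ ih1 ih2 ih3 ih4 ih5 ih6 => exact .typ_sumInd ih1 ih2 ih3 ih4 ih5 ih6
  | circleInd _ _ _ ih1 ih2 ih3 => exact .typ_circleInd ih1 ih2 ih3
  | conv _ h ih => exact .conv ih h
  | cumul _ ih => exact .cumul ih

theorem cumul_le {Γ : Ctx} {t : Ann} {i j : ℕ} (h : Ok Γ t (.univ i)) (hij : i ≤ j) :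
    Ok Γ t (.univ j) := by
  induction hij with
  | refl => exact h
  | step _ ih => exact ih.cumul

end Ok
end HoTT

/-! ### Stability of annotated typing under shifting, substitution and conversion of the context. -/

namespace HoTT

open Tm

namespace Derivable

theorem motiveJ_rename (A : Tm) (j : ℕ) (ρ : ℕ → ℕ) :
    (motiveJ A j).rename ρ = motiveJ (A.rename ρ) j := by
  simp [motiveJ, capp, Tm.rename, wk_rename, upRen]

theorem methodJ_rename (A C : Tm) (ρ : ℕ → ℕ) :
    (methodJ A C).rename ρ = methodJ (A.rename ρ) (C.rename ρ) := by
  simp [methodJ, capp, Tm.rename, wk_rename, upRen]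

theorem methodInl_rename (A B C : Tm) (ρ : ℕ → ℕ) :
    (methodInl A B C).rename ρ = methodInl (A.rename ρ) (B.rename ρ) (C.rename ρ) := by
  simp [methodInl, capp, Tm.rename, wk_rename, upRen]

theorem methodInr_rename (A B C : Tm) (ρ : ℕ → ℕ) :
    (methodInr A B C).rename ρ = methodInr (A.rename ρ) (B.rename ρ) (C.rename ρ) := by
  simp [methodInr, capp, Tm.rename, wk_rename, upRen]

theorem motiveJ_subst (A : Tm) (j : ℕ) (σ : ℕ → Tm) :
    (motiveJ A j).subst σ = motiveJ (A.subst σ) j := by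
  have h : (Tm.var 0).wk = Tm.var 1 := rfl
  simp [motiveJ, capp, Tm.subst, wk_subst, upSub, h]

theorem methodJ_subst (A C : Tm) (σ : ℕ → Tm) :
    (methodJ A C).subst σ = methodJ (A.subst σ) (C.subst σ) := by
  simp [methodJ, capp, Tm.subst, wk_subst, upSub]

theorem methodInl_subst (A B C : Tm) (σ : ℕ → Tm) :
    (methodInl A B C).subst σ = methodInl (A.subst σ) (B.subst σ) (C.subst σ) := by
  simp [methodInl, capp, Tm.subst, wk_subst, upSub]

theorem methodInr_subst (A B C : Tm) (σ : ℕ → Tm) :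
    (methodInr A B C).subst σ = methodInr (A.subst σ) (B.subst σ) (C.subst σ) := by
  simp [methodInr, capp, Tm.subst, wk_subst, upSub]

end Derivable

namespace Ok

open Ann Derivable

theorem up_shift {k d : ℕ} {Γ Δ : Ctx} {A : Ann} (hρ : RenOk (shiftRen k d) Γ Δ) :
    RenOk (shiftRen k (d + 1)) (A.erase :: Γ) ((A.shift k d).erase :: Δ) := by
  rw [← upRen_shiftRen, erase_shift]; exact hρ.up _

theorem shift {Γ : Ctx} {t : Ann} {T : Tm} (h : Ok Γ t T) {Δ : Ctx} (k : ℕ) {d : ℕ}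
    (hΔ : Derivable (.ctx Δ)) (hρ : RenOk (shiftRen k d) Γ Δ) :
    Ok Δ (t.shift k d) (T.rename (shiftRen k d)) := by
  induction h generalizing Δ d with
  | var h _ ih =>
    rw [← erase_shift]
    exact .var (by rw [erase_shift]; exact h.rename hΔ hρ) (ih hΔ hρ)
  | univ => exact .univ hΔ
  | pi _ _ ihA ihB =>
    have hA := ihA hΔ hρ
    exact .pi hA (ihB (.ctx_cons hA.typ) (up_shift hρ))
  | lam _ _ _ ihA ihB ihb =>
    have hA := ihA hΔ hρ
    have hc := Derivable.ctx_cons hA.typ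
    have := Ok.lam hA (ihB hc (up_shift hρ)) (by simpa only [← erase_shift] using ihb hc (up_shift hρ))
    simpa only [Ann.shift, Tm.rename, upRen_shiftRen, erase_shift] using this
  | app _ _ _ _ ihA ihB ihf iha =>
    have hA := ihA hΔ hρ
    have hc := Derivable.ctx_cons hA.typ
    have hf := ihf hΔ hρ
    have ha := iha hΔ hρ
    simp only [Tm.rename, upRen_shiftRen, ← erase_shift] at hf ha
    simp only [inst_rename, upRen_shiftRen, ← erase_shift]
    exact Ok.app hA (ihB hc (up_shift hρ)) hf ha
  | sigma _ _ ihA ihB =>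
    have hA := ihA hΔ hρ
    exact .sigma hA (ihB (.ctx_cons hA.typ) (up_shift hρ))
  | pair _ _ _ _ ihA ihB iha ihb =>
    have hA := ihA hΔ hρ
    have hc := Derivable.ctx_cons hA.typ
    have ha := iha hΔ hρ
    have hb := ihb hΔ hρ
    simp only [inst_rename, upRen_shiftRen, ← erase_shift] at ha hb
    simp only [Tm.rename, upRen_shiftRen, ← erase_shift]
    exact Ok.pair hA (ihB hc (up_shift hρ)) ha hb
  | fst _ _ _ ihA ihB ihp =>
    have hA := ihA hΔ hρ
    have hc := Derivable.ctx_cons hA.typ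
    have hp := ihp hΔ hρ
    simp only [Tm.rename, upRen_shiftRen, ← erase_shift] at hp
    simp only [← erase_shift]
    exact Ok.fst hA (ihB hc (up_shift hρ)) hp
  | snd _ _ _ ihA ihB ihp =>
    have hA := ihA hΔ hρ
    have hc := Derivable.ctx_cons hA.typ
    have hp := ihp hΔ hρ
    simp only [Tm.rename, upRen_shiftRen, ← erase_shift] at hp
    simp only [inst_rename, Tm.rename, upRen_shiftRen, ← erase_shift]
    exact Ok.snd hA (ihB hc (up_shift hρ)) hp
  | const c i j => rw [Const.type_rename]; exact .const c i j hΔ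
  | id _ _ _ ih1 ih2 ih3 =>
    have h2 := ih2 hΔ hρ
    have h3 := ih3 hΔ hρ
    rw [← erase_shift] at h2 h3
    exact .id (ih1 hΔ hρ) h2 h3
  | refl _ _ ih1 ih2 =>
    have h2 := ih2 hΔ hρ
    rw [← erase_shift] at h2
    have := Ok.refl (ih1 hΔ hρ) h2
    simp only [erase_shift] at this
    exact this
  | J _ _ _ _ _ _ ih1 ih2 ih3 ih4 ih5 ih6 =>
    have h2 := ih2 hΔ hρ
    have h3 := ih3 hΔ hρ
    have h4 := ih4 hΔ hρ
    have h5 := ih5 hΔ hρ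
    have h6 := ih6 hΔ hρ
    simp only [capp, List.foldl, Tm.rename, motiveJ_rename, methodJ_rename, ← erase_shift]
      at h2 h3 h4 h5 h6 ⊢
    exact .J (ih1 hΔ hρ) h2 h3 h4 h5 h6
  | sum _ _ ih1 ih2 => exact .sum (ih1 hΔ hρ) (ih2 hΔ hρ)
  | inl _ _ _ ih1 ih2 ih3 =>
    have h3 := ih3 hΔ hρ
    simp only [capp, List.foldl, Tm.rename, ← erase_shift] at h3 ⊢
    exact .inl (ih1 hΔ hρ) (ih2 hΔ hρ) h3
  | inr _ _ _ ih1 ih2 ih3 =>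
    have h3 := ih3 hΔ hρ
    simp only [capp, List.foldl, Tm.rename, ← erase_shift] at h3 ⊢
    exact .inr (ih1 hΔ hρ) (ih2 hΔ hρ) h3
  | sumInd _ _ _ _ _ _ ih1 ih2 ih3 ih4 ih5 ih6 =>
    have h3 := ih3 hΔ hρ
    have h4 := ih4 hΔ hρ
    have h5 := ih5 hΔ hρ
    have h6 := ih6 hΔ hρ
    simp only [capp, List.foldl, Tm.rename, arr_rename, methodInl_rename, methodInr_rename,
      ← erase_shift] at h3 h4 h5 h6 ⊢
    exact .sumInd (ih1 hΔ hρ) (ih2 hΔ hρ) h3 h4 h5 h6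
  | circleInd _ _ _ ih1 ih2 ih3 =>
    have h1 := ih1 hΔ hρ
    have h2 := ih2 hΔ hρ
    have h3 := ih3 hΔ hρ
    simp only [Tm.rename, arr_rename, circleMethod_rename, wk_rename, ← erase_shift] at h1 h2 h3 ⊢
    exact .circleInd h1 h2 h3
  | conv _ h ih => exact .conv (ih hΔ hρ) (h.rename_eq hΔ hρ)
  | cumul _ ih => exact .cumul (ih hΔ hρ)

theorem wk {Γ : Ctx} {t : Ann} {B T : Tm} (h : Ok Γ t T) (hB : Derivable (.ctx (B :: Γ))) :
    Ok (B :: Γ) t.wk T.wk := by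
  have := h.shift 1 (d := 0) hB (by rw [shiftRen_zero]; exact .succ B Γ)
  rwa [shiftRen_zero, ← Ann.wk_eq] at this

/-- Substituting `s` for the variable `d` is a substitution from `Γ` to `Δ`. -/
structure SubstAtOk (s : Ann) (d : ℕ) (Γ Δ : Ctx) : Prop where
  substOk : SubstOk (substFun s.erase d) Γ Δ
  ok : ∀ A, Γ[d]? = some A →
    Ok Δ (s.shift d 0) ((A.rename (· + (d + 1))).subst (substFun s.erase d))

theorem SubstAtOk.up {s A : Ann} {d i : ℕ} {Γ Δ : Ctx} (h : SubstAtOk s d Γ Δ)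
    (hA : Ok Δ (A.substAt s d) (.univ i)) :
    SubstAtOk s (d + 1) (A.erase :: Γ) ((A.substAt s d).erase :: Δ) := by
  have hc := Derivable.ctx_cons hA.typ
  constructor
  · rw [← upSub_substFun, erase_substAt]
    exact h.substOk.up (by rwa [erase_substAt] at hc)
  · intro B hB
    have := (h.ok B (by simpa using hB)).wk hc
    rw [← wk_subst, upSub_substFun, Ann.wk_eq, shift_shift, Tm.wk, rename_rename] at this
    exact this

theorem substAt {Γ : Ctx} {t : Ann} {T : Tm} (h : Ok Γ t T) {Δ : Ctx} {s : Ann} {d : ℕ}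
    (hΔ : Derivable (.ctx Δ)) (hσ : SubstAtOk s d Γ Δ) :
    Ok Δ (t.substAt s d) (T.subst (substFun s.erase d)) := by
  induction h generalizing Δ d with
  | @var Γ n X i h _ ih =>
    rw [Ann.substAt]
    have hX := ih hΔ hσ
    have h' := h.subst hΔ hσ.substOk
    obtain ⟨A, h1, h2⟩ := h.var_inv
    rw [← erase_substAt] at h' ⊢
    rcases lt_trichotomy n d with hd | rfl | hd
    · simp only [blt_eq_decide, hd, decide_true, cond_true, Tm.subst, substFun] at h' ⊢
      exact .var h' hX
    -- Here the variable itself is replaced. The term `s` has the type given by the context, and the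
    -- relation `h2` moves it to the annotated type.
    · simp only [blt_eq_decide, beq_eq_decide, lt_irrefl, decide_true, decide_false, cond_true,
        cond_false]
      rw [erase_substAt]
      exact (hσ.ok A h1).sub (h2.subst hΔ hσ.substOk)
    · have e1 : ¬ n < d := by omega
      have e2 : n ≠ d := by omega
      simp only [blt_eq_decide, beq_eq_decide, e1, e2, decide_false, cond_false, Tm.subst,
        substFun] at h' ⊢
      exact .var h' hX
  | univ => exact .univ hΔ
  | pi _ _ ihA ihB =>
    have hA := ihA hΔ hσ
    exact .pi hA (ihB (.ctx_cons hA.typ) (hσ.up hA))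
  | lam _ _ _ ihA ihB ihb =>
    have hA := ihA hΔ hσ
    have hc := Derivable.ctx_cons hA.typ
    have hσ' := hσ.up hA
    have := Ok.lam hA (ihB hc hσ') (by simpa only [← erase_substAt] using ihb hc hσ')
    simpa only [Ann.substAt, Tm.subst, upSub_substFun, erase_substAt] using this
  | app _ _ _ _ ihA ihB ihf iha =>
    have hA := ihA hΔ hσ
    have hc := Derivable.ctx_cons hA.typ
    have hσ' := hσ.up hA
    have hf := ihf hΔ hσ
    have ha := iha hΔ hσ
    simp only [Tm.subst, upSub_substFun, ← erase_substAt] at hf ha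
    simp only [inst_subst, upSub_substFun, ← erase_substAt]
    exact Ok.app hA (ihB hc hσ') hf ha
  | sigma _ _ ihA ihB =>
    have hA := ihA hΔ hσ
    exact .sigma hA (ihB (.ctx_cons hA.typ) (hσ.up hA))
  | pair _ _ _ _ ihA ihB iha ihb =>
    have hA := ihA hΔ hσ
    have hc := Derivable.ctx_cons hA.typ
    have hσ' := hσ.up hA
    have ha := iha hΔ hσ
    have hb := ihb hΔ hσ
    simp only [inst_subst, upSub_substFun, ← erase_substAt] at ha hb
    simp only [Tm.subst, upSub_substFun, ← erase_substAt]
    exact Ok.pair hA (ihB hc hσ') ha hb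
  | fst _ _ _ ihA ihB ihp =>
    have hA := ihA hΔ hσ
    have hc := Derivable.ctx_cons hA.typ
    have hσ' := hσ.up hA
    have hp := ihp hΔ hσ
    simp only [Tm.subst, upSub_substFun, ← erase_substAt] at hp
    simp only [← erase_substAt]
    exact Ok.fst hA (ihB hc hσ') hp
  | snd _ _ _ ihA ihB ihp =>
    have hA := ihA hΔ hσ
    have hc := Derivable.ctx_cons hA.typ
    have hσ' := hσ.up hA
    have hp := ihp hΔ hσ
    simp only [Tm.subst, upSub_substFun, ← erase_substAt] at hp
    simp only [inst_subst, Tm.subst, upSub_substFun, ← erase_substAt]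
    exact Ok.snd hA (ihB hc hσ') hp
  | const c i j => rw [Const.type_subst]; exact .const c i j hΔ
  | id _ _ _ ih1 ih2 ih3 =>
    have h2 := ih2 hΔ hσ
    have h3 := ih3 hΔ hσ
    rw [← erase_substAt] at h2 h3
    exact .id (ih1 hΔ hσ) h2 h3
  | refl _ _ ih1 ih2 =>
    have h2 := ih2 hΔ hσ
    simp only [capp, List.foldl, Tm.subst, ← erase_substAt] at h2 ⊢
    exact Ok.refl (ih1 hΔ hσ) h2
  | J _ _ _ _ _ _ ih1 ih2 ih3 ih4 ih5 ih6 =>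
    have h2 := ih2 hΔ hσ
    have h3 := ih3 hΔ hσ
    have h4 := ih4 hΔ hσ
    have h5 := ih5 hΔ hσ
    have h6 := ih6 hΔ hσ
    simp only [capp, List.foldl, Tm.subst, motiveJ_subst, methodJ_subst, ← erase_substAt]
      at h2 h3 h4 h5 h6 ⊢
    exact .J (ih1 hΔ hσ) h2 h3 h4 h5 h6
  | sum _ _ ih1 ih2 => exact .sum (ih1 hΔ hσ) (ih2 hΔ hσ)
  | inl _ _ _ ih1 ih2 ih3 =>
    have h3 := ih3 hΔ hσ
    simp only [capp, List.foldl, Tm.subst, ← erase_substAt] at h3 ⊢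
    exact .inl (ih1 hΔ hσ) (ih2 hΔ hσ) h3
  | inr _ _ _ ih1 ih2 ih3 =>
    have h3 := ih3 hΔ hσ
    simp only [capp, List.foldl, Tm.subst, ← erase_substAt] at h3 ⊢
    exact .inr (ih1 hΔ hσ) (ih2 hΔ hσ) h3
  | sumInd _ _ _ _ _ _ ih1 ih2 ih3 ih4 ih5 ih6 =>
    have h3 := ih3 hΔ hσ
    have h4 := ih4 hΔ hσ
    have h5 := ih5 hΔ hσ
    have h6 := ih6 hΔ hσ
    simp only [capp, List.foldl, Tm.subst, arr_subst, methodInl_subst, methodInr_subst,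
      ← erase_substAt] at h3 h4 h5 h6 ⊢
    exact .sumInd (ih1 hΔ hσ) (ih2 hΔ hσ) h3 h4 h5 h6
  | circleInd _ _ _ ih1 ih2 ih3 =>
    have h1 := ih1 hΔ hσ
    have h2 := ih2 hΔ hσ
    have h3 := ih3 hΔ hσ
    simp only [Tm.subst, arr_subst, circleMethod_subst, wk_subst, ← erase_substAt] at h1 h2 h3 ⊢
    exact .circleInd h1 h2 h3
  | conv _ h ih => exact .conv (ih hΔ hσ) (h.subst_eq hΔ hσ.substOk)
  | cumul _ ih => exact .cumul (ih hΔ hσ)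

theorem inst {Γ : Ctx} {t s : Ann} {T S : Tm} (h : Ok (S :: Γ) t T) (hs : Ok Γ s S) :
    Ok Γ (t.inst s) (T.inst s.erase) := by
  rw [Tm.inst, ← substFun_zero, Ann.inst_eq]
  refine h.substAt hs.typ.typ_ctx ⟨?_, ?_⟩
  · rw [substFun_zero]; exact .single hs.typ
  · intro A hA
    obtain rfl : S = A := by simpa using hA
    rw [Ann.shift_zero, substFun_zero]
    change Ok Γ s (S.wk.inst s.erase)
    rwa [wk_inst]

/-- A change of context along judgmentally equal types is the identity substitution. It leaves
annotated terms unchanged, so only the derivability premises have to be transported. -/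
theorem ctx_conv_aux {Γ : Ctx} {t : Ann} {T : Tm} (h : Ok Γ t T) {Δ : Ctx}
    (hΔ : Derivable (.ctx Δ)) (hσ : SubstOk Tm.var Γ Δ) : Ok Δ t T := by
  have up {Γ Δ : Ctx} {A : Ann} {i : ℕ} (hσ : SubstOk Tm.var Γ Δ) (hA : Ok Δ A (.univ i)) :
      SubstOk Tm.var (A.erase :: Γ) (A.erase :: Δ) := by
    have := hσ.up (A := A.erase) (by rw [subst_var]; exact .ctx_cons hA.typ)
    rwa [upSub_var, subst_var] at this
  induction h generalizing Δ with
  | var h _ ih => exact .var (by simpa only [subst_var] using h.subst hΔ hσ) (ih hΔ hσ)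
  | univ => exact .univ hΔ
  | pi _ _ ihA ihB =>
    have hA := ihA hΔ hσ
    exact .pi hA (ihB (.ctx_cons hA.typ) (up hσ hA))
  | lam _ _ _ ihA ihB ihb =>
    have hA := ihA hΔ hσ
    have hc := Derivable.ctx_cons hA.typ
    exact .lam hA (ihB hc (up hσ hA)) (ihb hc (up hσ hA))
  | app _ _ _ _ ihA ihB ihf iha =>
    have hA := ihA hΔ hσ
    exact .app hA (ihB (.ctx_cons hA.typ) (up hσ hA)) (ihf hΔ hσ) (iha hΔ hσ)
  | sigma _ _ ihA ihB =>
    have hA := ihA hΔ hσ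
    exact .sigma hA (ihB (.ctx_cons hA.typ) (up hσ hA))
  | pair _ _ _ _ ihA ihB iha ihb =>
    have hA := ihA hΔ hσ
    exact .pair hA (ihB (.ctx_cons hA.typ) (up hσ hA)) (iha hΔ hσ) (ihb hΔ hσ)
  | fst _ _ _ ihA ihB ihp =>
    have hA := ihA hΔ hσ
    exact .fst hA (ihB (.ctx_cons hA.typ) (up hσ hA)) (ihp hΔ hσ)
  | snd _ _ _ ihA ihB ihp =>
    have hA := ihA hΔ hσ
    exact .snd hA (ihB (.ctx_cons hA.typ) (up hσ hA)) (ihp hΔ hσ)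
  | const c i j => exact .const c i j hΔ
  | id _ _ _ ih1 ih2 ih3 => exact .id (ih1 hΔ hσ) (ih2 hΔ hσ) (ih3 hΔ hσ)
  | refl _ _ ih1 ih2 => exact .refl (ih1 hΔ hσ) (ih2 hΔ hσ)
  | J _ _ _ _ _ _ ih1 ih2 ih3 ih4 ih5 ih6 =>
    exact .J (ih1 hΔ hσ) (ih2 hΔ hσ) (ih3 hΔ hσ) (ih4 hΔ hσ) (ih5 hΔ hσ) (ih6 hΔ hσ)
  | sum _ _ ih1 ih2 => exact .sum (ih1 hΔ hσ) (ih2 hΔ hσ)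
  | inl _ _ _ ih1 ih2 ih3 => exact .inl (ih1 hΔ hσ) (ih2 hΔ hσ) (ih3 hΔ hσ)
  | inr _ _ _ ih1 ih2 ih3 => exact .inr (ih1 hΔ hσ) (ih2 hΔ hσ) (ih3 hΔ hσ)
  | sumInd _ _ _ _ _ _ ih1 ih2 ih3 ih4 ih5 ih6 =>
    exact .sumInd (ih1 hΔ hσ) (ih2 hΔ hσ) (ih3 hΔ hσ) (ih4 hΔ hσ) (ih5 hΔ hσ) (ih6 hΔ hσ)
  | circleInd _ _ _ ih1 ih2 ih3 => exact .circleInd (ih1 hΔ hσ) (ih2 hΔ hσ) (ih3 hΔ hσ)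
  | conv _ h ih =>
    exact .conv (ih hΔ hσ) (by simpa only [subst_var] using h.subst_eq hΔ hσ)
  | cumul _ ih => exact .cumul (ih hΔ hσ)

theorem ctx_conv {Γ : Ctx} {A A' T : Tm} {t : Ann} {i : ℕ} (hA : Derivable (.typ Γ A (.univ i)))
    (h : Derivable (.eq Γ A A' (.univ i))) (ht : Ok (A' :: Γ) t T) : Ok (A :: Γ) t T :=
  ht.ctx_conv_aux (.ctx_cons hA) (SubstOk.conv hA h)

end Ok
end HoTT

namespace HoTT

noncomputable section

open Tm

/-! ## Weak head reduction and conversion -/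

/-- A number for each constant. -/
def Const.code : Const → ℕ
  | .empty => 0 | .emptyInd => 1
  | .unit => 2 | .star => 3 | .unitInd => 4
  | .sum => 5 | .inl => 6 | .inr => 7 | .sumInd => 8
  | .nat => 9 | .zero => 10 | .succ => 11 | .natInd => 12
  | .id => 13 | .refl => 14 | .J => 15
  | .circle => 16 | .base => 17 | .loop => 18 | .circleInd => 19 | .circleLoop => 20
  | .funext => 21
  | .ua i => i + 22

theorem Const.code_injective : Function.Injective Const.code := by
  intro c d h
  cases c <;> cases d <;> (simp [code] at h ⊢; try omega)

/-- Syntactic equality of raw terms. -/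
def Tm.beq : Tm → Tm → Bool
  | .var m, .var n => Nat.beq m n
  | .univ i, .univ j => Nat.beq i j
  | .pi A B, .pi A' B' => A.beq A' && B.beq B'
  | .lam A b, .lam A' b' => A.beq A' && b.beq b'
  | .app f a, .app f' a' => f.beq f' && a.beq a'
  | .sigma A B, .sigma A' B' => A.beq A' && B.beq B'
  | .pair a b, .pair a' b' => a.beq a' && b.beq b'
  | .fst p, .fst p' => p.beq p'
  | .snd p, .snd p' => p.beq p'
  | .const c, .const d => Nat.beq c.code d.code
  | _, _ => false

theorem Tm.eq_of_beq {s t : Tm} (h : s.beq t = true) : s = t := by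
  induction s generalizing t <;> (cases t; all_goals simp_all [Tm.beq, Nat.beq_eq, Bool.and_eq_true])
  any_goals grind
  exact Const.code_injective h

namespace Ann

/-- Whether two annotated terms differ at most in their annotations. -/
def same (t : Ann) : Ann → Bool :=
  rec (motive := fun _ => Ann → Bool)
    (fun n _ _ u => match u with | var n' _ => Nat.beq n n' | _ => false)
    (fun i u => match u with | univ i' => Nat.beq i i' | _ => false)
    (fun _ _ A B u => match u with | pi A' B' => Bool.rec false (B B') (A A') | _ => false)
    (fun _ _ _ A _ b u => match u with | lam A' _ b' => Bool.rec false (b b') (A A') | _ => false)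
    (fun _ _ _ _ _ _ f a u => match u with
      | app _ _ f' a' => Bool.rec false (a a') (f f') | _ => false)
    (fun _ _ A B u => match u with | sigma A' B' => Bool.rec false (B B') (A A') | _ => false)
    (fun _ _ _ _ _ _ a b u => match u with
      | pair _ _ a' b' => Bool.rec false (b b') (a a') | _ => false)
    (fun _ _ _ _ _ p u => match u with | fst _ _ p' => p p' | _ => false)
    (fun _ _ _ _ _ p u => match u with | snd _ _ p' => p p' | _ => false)
    (fun c u => match u with | const c' => Nat.beq c.code c'.code | _ => false)
    (fun _ _ _ A a b u => match u with
      | id A' a' b' => Bool.rec false (Bool.rec false (b b') (a a')) (A A') | _ => false)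
    (fun _ _ A a u => match u with | refl A' a' => Bool.rec false (a a') (A A') | _ => false)
    (fun _ _ _ _ _ _ _ A C c x y p u => match u with
      | J _ A' C' c' x' y' p' => Bool.rec false (Bool.rec false (Bool.rec false (Bool.rec false
        (Bool.rec false (p p') (y y')) (x x')) (c c')) (C C')) (A A') | _ => false)
    (fun _ _ A B u => match u with | sum A' B' => Bool.rec false (B B') (A A') | _ => false)
    (fun _ _ _ A B a u => match u with
      | inl A' B' a' => Bool.rec false (Bool.rec false (a a') (B B')) (A A') | _ => false)
    (fun _ _ _ A B b u => match u with
      | inr A' B' b' => Bool.rec false (Bool.rec false (b b') (B B')) (A A') | _ => false)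
    (fun _ _ _ _ _ _ _ A B C f g x u => match u with
      | sumInd _ A' B' C' f' g' x' => Bool.rec false (Bool.rec false (Bool.rec false (Bool.rec false
        (Bool.rec false (x x') (g g')) (f f')) (C C')) (B B')) (A A') | _ => false)
    (fun _ _ _ _ C b l u => match u with
      | circleInd _ C' b' l' => Bool.rec false (Bool.rec false (l l') (b b')) (C C') | _ => false) t

theorem erase_eq_of_same {t u : Ann} (h : t.same u = true) : t.erase = u.erase := by
  have and_rec {b c : Bool} (h : (Bool.rec false c b : Bool) = true) : b = true ∧ c = true := by
    cases b with
    | false => cases h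
    | true => exact ⟨rfl, h⟩
  induction t generalizing u
  all_goals
    cases u
    all_goals try exact absurd h Bool.false_ne_true
  · exact congrArg Tm.var (Nat.eq_of_beq_eq_true h)
  · exact congrArg Tm.univ (Nat.eq_of_beq_eq_true h)
  · rename_i ih0 ih1 _ _
    obtain ⟨h0, h⟩ := and_rec h
    simp only [erase, ih0 h0, ih1 h]
  · rename_i ih0 _ ih2 _ _ _
    obtain ⟨h0, h⟩ := and_rec h
    simp only [erase, ih0 h0, ih2 h]
  · rename_i _ _ ih2 ih3 _ _ _ _
    obtain ⟨h0, h⟩ := and_rec h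
    simp only [erase, ih2 h0, ih3 h]
  · rename_i ih0 ih1 _ _
    obtain ⟨h0, h⟩ := and_rec h
    simp only [erase, ih0 h0, ih1 h]
  · rename_i _ _ ih2 ih3 _ _ _ _
    obtain ⟨h0, h⟩ := and_rec h
    simp only [erase, ih2 h0, ih3 h]
  · rename_i _ _ ih2 _ _ _
    simp only [erase, ih2 h]
  · rename_i _ _ ih2 _ _ _
    simp only [erase, ih2 h]
  · exact congrArg Tm.const (Const.code_injective (Nat.eq_of_beq_eq_true h))
  · rename_i ih0 ih1 ih2 _ _ _
    obtain ⟨h0, h⟩ := and_rec h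
    obtain ⟨h1, h⟩ := and_rec h
    simp only [erase, ih0 h0, ih1 h1, ih2 h]
  · rename_i ih0 ih1 _ _
    obtain ⟨h0, h⟩ := and_rec h
    simp only [erase, ih0 h0, ih1 h]
  · rename_i ih0 ih1 ih2 ih3 ih4 ih5 _ _ _ _ _ _ _
    obtain ⟨h0, h⟩ := and_rec h
    obtain ⟨h1, h⟩ := and_rec h
    obtain ⟨h2, h⟩ := and_rec h
    obtain ⟨h3, h⟩ := and_rec h
    obtain ⟨h4, h⟩ := and_rec h
    simp only [erase, ih0 h0, ih1 h1, ih2 h2, ih3 h3, ih4 h4, ih5 h]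
  · rename_i ih0 ih1 _ _
    obtain ⟨h0, h⟩ := and_rec h
    simp only [erase, ih0 h0, ih1 h]
  · rename_i ih0 ih1 ih2 _ _ _
    obtain ⟨h0, h⟩ := and_rec h
    obtain ⟨h1, h⟩ := and_rec h
    simp only [erase, ih0 h0, ih1 h1, ih2 h]
  · rename_i ih0 ih1 ih2 _ _ _
    obtain ⟨h0, h⟩ := and_rec h
    obtain ⟨h1, h⟩ := and_rec h
    simp only [erase, ih0 h0, ih1 h1, ih2 h]
  · rename_i ih0 ih1 ih2 ih3 ih4 ih5 _ _ _ _ _ _ _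
    obtain ⟨h0, h⟩ := and_rec h
    obtain ⟨h1, h⟩ := and_rec h
    obtain ⟨h2, h⟩ := and_rec h
    obtain ⟨h3, h⟩ := and_rec h
    obtain ⟨h4, h⟩ := and_rec h
    simp only [erase, ih0 h0, ih1 h1, ih2 h2, ih3 h3, ih4 h4, ih5 h]
  · rename_i ih0 ih1 ih2 _ _ _ _
    obtain ⟨h0, h⟩ := and_rec h
    obtain ⟨h1, h⟩ := and_rec h
    simp only [erase, ih0 h0, ih1 h1, ih2 h]

/-- `C x y p`, for a motive `C` of path induction. -/
def motiveJ (j : ℕ) (A C x y p : Ann) : Ann :=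
  app (id A x y) (univ j)
    (app A (pi (id A.wk x.wk (var 0 A.wk)) (univ j))
      (app A (pi A.wk (pi (id A.wk.wk (var 1 A.wk.wk) (var 0 A.wk.wk)) (univ j))) C x) y) p

/-- The type of motives of path induction. -/
def typeMotiveJ (A : Ann) (j : ℕ) : Ann :=
  pi A (pi A.wk (pi (id A.wk.wk (var 1 A.wk.wk) (var 0 A.wk.wk)) (univ j)))

/-- `C z z (refl z)`, with a new variable `z`. -/
def methodJ (j : ℕ) (A C : Ann) : Ann :=
  motiveJ j A.wk C.wk (var 0 A.wk) (var 0 A.wk) (refl A.wk (var 0 A.wk))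

/-- `C (inl a)`, with a new variable `a`. -/
def methodInl (j : ℕ) (A B C : Ann) : Ann :=
  app (sum A.wk B.wk) (univ j) C.wk (inl A.wk B.wk (var 0 A.wk))

/-- `C (inr b)`, with a new variable `b`. -/
def methodInr (j : ℕ) (A B C : Ann) : Ann :=
  app (sum A.wk B.wk) (univ j) C.wk (inr A.wk B.wk (var 0 B.wk))

/-- `C x`, with a new variable `x` in the circle. -/
def circleMotive (j : ℕ) (C : Ann) : Ann :=
  app (const .circle) (univ j) C.wk (var 0 (const .circle))

section

variable (cv : Ann → Ann → Bool) (wh : Ann → Ann)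

/-- Weak head reduction of an application. -/
def whnfApp (A B f a : Ann) : Ann :=
  match wh f with
  | lam A' B' b => bif cv A A' && cv B B' then wh (b.inst a) else app A B f a
  | circleInd j C b _ => match wh a with
    | const .base => bif cv A (const .circle) && cv B (circleMotive j C) then wh b else app A B f a
    | _ => app A B f a
  | f' => app A B f' a

/-- Weak head reduction of a first projection. -/
def whnfFst (A B p : Ann) : Ann :=
  match wh p with
  | pair A' _ a _ => bif cv A A' then wh a else fst A B p
  | p' => fst A B p'

/-- Weak head reduction of a second projection. -/
def whnfSnd (A B p : Ann) : Ann :=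
  match wh p with
  | pair A' B' _ b => bif cv A A' && cv B B' then wh b else snd A B p
  | p' => snd A B p'

/-- Weak head reduction of path induction. -/
def whnfJ (j : ℕ) (A C c x y p : Ann) : Ann :=
  match wh p with
  | refl A' a => bif cv A A' && (cv x a && cv y a) then wh (app A (methodJ j A C) c a)
      else J j A C c x y p
  | _ => J j A C c x y p

/-- Weak head reduction of a case distinction. -/
def whnfSumInd (j : ℕ) (A B C f g x : Ann) : Ann :=
  match wh x with
  | inl A' B' a => bif cv A A' && cv B B' then wh (app A (methodInl j A B C) f a)
      else sumInd j A B C f g x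
  | inr A' B' b => bif cv A A' && cv B B' then wh (app B (methodInr j A B C) g b)
      else sumInd j A B C f g x
  | _ => sumInd j A B C f g x

/-- Weak head reduction, if `wh` is used for the subsequent steps. -/
def whnfStep : Ann → Ann
  | app A B f a => whnfApp cv wh A B f a
  | fst A B p => whnfFst cv wh A B p
  | snd A B p => whnfSnd cv wh A B p
  | J j A C c x y p => whnfJ cv wh j A C c x y p
  | sumInd j A B C f g x => whnfSumInd cv wh j A B C f g x
  | t => t

end

/-- Weak head reduction with a bound on the number of steps, for the test `cv` for conversion. -/
def whnf (cv : Ann → Ann → Bool) (n : ℕ) : Ann → Ann :=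
  Nat.rec (fun t => t) (fun _ wh t => whnfStep cv wh t) n

/-- The type of a neutral term. -/
def neutralType : Ann → Option Ann
  | var _ X => some X
  | app _ B _ a => some (B.inst a)
  | fst A _ _ => some A
  | snd A B p => some (B.inst (fst A B p))
  | _ => none

/-- `f x`, with a new variable `x`. -/
def etaBody (A B f : Ann) : Ann := app A.wk (B.fastShift 1 1) f.wk (var 0 A.wk)

/-- Conversion of neutral terms. -/
def convNeutral (cv : Ann → Ann → Bool) (v u : Ann) : Bool :=
  match v with
  | var m _ => match u with
    | var n _ => Nat.beq m n
    | _ => false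
  | const c => match u with
    | const d => Nat.beq c.code d.code
    | _ => false
  | app A B f a => match u with
    | app A' B' f' a' => cv A A' && (cv B B' && (cv f f' && cv a a'))
    | _ => false
  | fst A B p => match u with
    | fst A' B' p' => cv A A' && (cv B B' && cv p p')
    | _ => false
  | snd A B p => match u with
    | snd A' B' p' => cv A A' && (cv B B' && cv p p')
    | _ => false
  | J j A C c x y p => match u with
    | J j' A' C' c' x' y' p' =>
      ((A.same A' && (C.same C' && c.same c')) ||
        (cv A A' && (cv (typeMotiveJ A j) (typeMotiveJ A' j') && (cv C C' &&
          (cv (pi A (methodJ j A C)) (pi A' (methodJ j' A' C')) && cv c c'))))) &&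
        (cv x x' && (cv y y' && cv p p'))
    | _ => false
  | sumInd _ A B C f g x => match u with
    | sumInd _ A' B' C' f' g' x' =>
      A.same A' && (B.same B' && (C.same C' && (f.same f' && (g.same g' && cv x x'))))
    | _ => false
  | v => v.same u

/-- Conversion of terms in weak head normal form, of which the first is neutral. -/
def convStuck (wh : Ann → Ann) (cv : Ann → Ann → Bool) (v u : Ann) : Bool :=
  match u with
  | lam A' B' b' => match v.neutralType with
    | some N => match wh N with
      | pi A B => cv A A' && (cv B B' && cv (etaBody A B v) b')
      | _ => false
    | none => false
  | pair A' B' a' b' => match v.neutralType with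
    | some N => match wh N with
      | sigma A B => cv A A' && (cv B B' && (cv (fst A B v) a' && cv (snd A B v) b'))
      | _ => false
    | none => false
  | u => convNeutral cv v u

/-- Conversion of terms in weak head normal form. -/
def convWhnf (wh : Ann → Ann) (cv : Ann → Ann → Bool) (v u : Ann) : Bool :=
  match v with
  | univ i => match u with
    | univ j => Nat.beq i j
    | _ => false
  | pi A B => match u with
    | pi A' B' => cv A A' && cv B B'
    | _ => false
  | sigma A B => match u with
    | sigma A' B' => cv A A' && cv B B'
    | _ => false
  | sum A B => match u with
    | sum A' B' => cv A A' && cv B B'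
    | _ => false
  | id A a b => match u with
    | id A' a' b' => cv A A' && (cv a a' && cv b b')
    | _ => false
  | refl A a => match u with
    | refl A' a' => cv A A' && cv a a'
    | _ => false
  | inl A B a => match u with
    | inl A' B' a' => cv A A' && (cv B B' && cv a a')
    | _ => false
  | inr A B b => match u with
    | inr A' B' b' => cv A A' && (cv B B' && cv b b')
    | _ => false
  | lam A B b => match u with
    | lam A' B' b' => cv A A' && (cv B B' && cv b b')
    | u => match u.neutralType with
      | some N => match wh N with
        | pi A' B' => cv A A' && (cv B B' && cv b (etaBody A B u))
        | _ => false
      | none => false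
  | pair A B a b => match u with
    | pair A' B' a' b' => cv A A' && (cv B B' && (cv a a' && cv b b'))
    | u => match u.neutralType with
      | some N => match wh N with
        | sigma A' B' => cv A A' && (cv B B' && (cv a (fst A B u) && cv b (snd A B u)))
        | _ => false
      | none => false
  | v => convStuck wh cv v u

/-- Conversion of applications by conversion of the arguments, if the heads are equal. -/
def convSpine (wh : Ann → Ann) (cv : Ann → Ann → Bool) : Ann → Ann → Bool
  | app A B f a, u => match u with
    | app A' B' f' a' => convSpine wh cv f f' && (cv A A' && (cv B B' && cv a a'))
    | _ => false
  | v, u => match u with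
    | app _ _ _ _ => false
    | u => (wh v).same (wh u)

/-- The test for conversion, with a bound on the number of steps. -/
def conv (n : ℕ) : Ann → Ann → Bool :=
  Nat.rec (fun _ _ => false) (fun n cv v u =>
    Bool.rec (Bool.rec (convWhnf (whnf cv n) cv (whnf cv n v) (whnf cv n u)) true
      (convSpine (whnf cv n) cv v u)) true (v.same u)) n

end Ann

/-! ### Well-typedness of the auxiliary annotated terms: motives and methods of the eliminators. -/

namespace Ok

variable {Γ : Ctx} {A B C a b c f g l p t u v x y : Ann} {T : Tm} {i j : ℕ}

theorem eq_refl (h : Ok Γ t T) : Derivable (.eq Γ t.erase t.erase T) := .eq_refl h.typ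

theorem ctx (h : Ok Γ t T) : Derivable (.ctx Γ) := h.typ.typ_ctx

theorem cons (h : Ok Γ A (.univ i)) : Derivable (.ctx (A.erase :: Γ)) := .ctx_cons h.typ

theorem var_zero (h : Ok Γ A (.univ i)) : Ok (A.erase :: Γ) (.var 0 A.wk) A.erase.wk := by
  have := h.wk h.cons
  rw [← Ann.erase_wk]
  exact .var (by rw [Ann.erase_wk]; exact .var h.cons rfl) this

theorem circle (h : Derivable (.ctx Γ)) : Ok Γ (.const .circle) (.univ 0) := .const .circle 0 0 h

theorem app' {F S : Tm} (hA : Ok Γ A (.univ i)) (hB : Ok (A.erase :: Γ) B (.univ j))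
    (hf : Ok Γ f F) (hF : F = .pi A.erase B.erase) (ha : Ok Γ a S) (hS : S = A.erase)
    (hT : B.erase.inst a.erase = T) : Ok Γ (.app A B f a) T :=
  hT ▸ .app hA hB (hF ▸ hf) (hS ▸ ha)

theorem typeMotiveJ (hA : Ok Γ A (.univ i)) (j : ℕ) :
    Ok Γ (Ann.typeMotiveJ A j) (.univ (max i (j + 1))) := by
  have hAw := hA.wk hA.cons
  have hAw' := hAw.cons
  have hAww := hAw.wk hAw'
  have hv0 := hAw.var_zero
  have hv1 := hA.var_zero.wk hAw'
  rw [Ann.erase_wk] at hv0 hAw' hv1 hAww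
  have hv1' : Ok (A.erase.wk :: A.erase :: Γ) (.var 1 A.wk.wk) A.erase.wk.wk := hv1
  have hI : Ok (A.erase.wk :: A.erase :: Γ) (.id A.wk.wk (.var 1 A.wk.wk) (.var 0 A.wk.wk))
      (.univ i) := .id hAww (by simpa using hv1') (by simpa using hv0)
  exact .pi (hA.cumul_le (le_max_left _ _)) (.pi (hAw.cumul_le (le_max_left _ _))
    (.pi (by simpa using hI.cumul_le (le_max_left _ _))
      ((Ok.univ (i := j) (by simpa using hI.cons)).cumul_le (le_max_right _ _))))

theorem erase_typeMotiveJ : (Ann.typeMotiveJ A j).erase = Derivable.motiveJ A.erase j := by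
  simp [Ann.typeMotiveJ, Derivable.motiveJ, Ann.erase, capp]

theorem motiveJ (hA : Ok Γ A (.univ i)) (hC : Ok Γ C (Derivable.motiveJ A.erase j))
    (hx : Ok Γ x A.erase) (hy : Ok Γ y A.erase)
    (hp : Ok Γ p (capp .id [A.erase, x.erase, y.erase])) :
    Ok Γ (Ann.motiveJ j A C x y p) (.univ j) := by
  have hAw := hA.wk hA.cons
  have hAw' := hAw.cons
  have hAww := hAw.wk hAw'
  have hv0 := hAw.var_zero
  have hv1 := hA.var_zero.wk hAw'
  rw [Ann.erase_wk] at hv0 hAw' hv1 hAww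
  have hv1' : Ok (A.erase.wk :: A.erase :: Γ) (.var 1 A.wk.wk) A.erase.wk.wk := hv1
  have hu {Δ : Ctx} (h : Derivable (.ctx Δ)) := Ok.univ (i := j) h
  have hI : Ok (A.erase.wk :: A.erase :: Γ) (.id A.wk.wk (.var 1 A.wk.wk) (.var 0 A.wk.wk))
      (.univ i) := .id hAww (by simpa using hv1') (by simpa using hv0)
  have hI'' : Ok Γ (.id A x y) (.univ i) := .id hA hx hy
  have hI' : Ok (A.erase :: Γ) (.id A.wk x.wk (.var 0 A.wk)) (.univ i) :=
    .id hAw (by simpa using hx.wk hA.cons) (by simpa using hA.var_zero)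
  have h1 : Ok Γ (.app A (.pi A.wk (.pi (.id A.wk.wk (.var 1 A.wk.wk) (.var 0 A.wk.wk))
      (.univ j))) C x) (.pi A.erase (.pi (capp .id [A.erase.wk, x.erase.wk, .var 0]) (.univ j))) := by
    -- The level `max i (j + 1)` accommodates both `A`, at level `i`, and the universe `j`, which is
    -- an element of universe `j + 1`.
    refine .app' (j := max i (j + 1)) hA (.pi (hAw.cumul_le (le_max_left _ _))
      (.pi (by simpa using hI.cumul_le (le_max_left _ _))
        ((hu (by simpa using hI.cons)).cumul_le (le_max_right _ _)))) hC ?_ hx rfl ?_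
    · simp [Derivable.motiveJ, Ann.erase, capp]
    · simp [Ann.erase, capp, Tm.inst, subst, wk_subst, wk_subst_single, upSub, single]
  have h2 : Ok Γ (.app A (.pi (.id A.wk x.wk (.var 0 A.wk)) (.univ j)) (.app A (.pi A.wk
      (.pi (.id A.wk.wk (.var 1 A.wk.wk) (.var 0 A.wk.wk)) (.univ j))) C x) y)
      (.pi (capp .id [A.erase, x.erase, y.erase]) (.univ j)) := by
    refine .app' (j := max i (j + 1)) hA (.pi (hI'.cumul_le (le_max_left _ _))
      ((hu hI'.cons).cumul_le (le_max_right _ _))) h1 ?_ hy rfl ?_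
    · simp [Ann.erase, capp]
    · simp [Ann.erase, capp, Tm.inst, subst, wk_subst_single, single]
  exact .app' hI'' (hu hI''.cons) h2 rfl hp rfl rfl

theorem methodJ (hA : Ok Γ A (.univ i)) (hC : Ok Γ C (Derivable.motiveJ A.erase j)) :
    Ok (A.erase :: Γ) (Ann.methodJ j A C) (.univ j) := by
  have hAw := hA.wk hA.cons
  have hv : Ok (A.erase :: Γ) (.var 0 A.wk) A.wk.erase := by simpa using hA.var_zero
  refine .motiveJ hAw ?_ hv hv (.refl hAw hv)
  have := hC.wk hA.cons
  rwa [Tm.wk, Derivable.motiveJ_rename, ← Tm.wk, ← Ann.erase_wk] at this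

theorem erase_methodJ : .pi A.erase (Ann.methodJ j A C).erase = Derivable.methodJ A.erase C.erase := by
  simp [Ann.methodJ, Ann.motiveJ, Derivable.methodJ, Ann.erase, capp]

theorem sumMotive (hA : Ok Γ A (.univ i)) (hB : Ok Γ B (.univ i))
    (hC : Ok Γ C (arr (capp .sum [A.erase, B.erase]) (.univ j)))
    (hx : Ok Γ x (capp .sum [A.erase, B.erase])) :
    Ok Γ (.app (.sum A B) (.univ j) C x) (.univ j) :=
  have h := Ok.sum hA hB
  .app' h (.univ h.cons) hC rfl hx rfl rfl

theorem methodInl (hA : Ok Γ A (.univ i)) (hB : Ok Γ B (.univ i))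
    (hC : Ok Γ C (arr (capp .sum [A.erase, B.erase]) (.univ j))) :
    Ok (A.erase :: Γ) (Ann.methodInl j A B C) (.univ j) := by
  have hAw := hA.wk hA.cons
  have hBw := hB.wk hA.cons
  refine .sumMotive hAw hBw ?_ (.inl hAw hBw (by simpa using hA.var_zero))
  simpa [Tm.wk, arr_rename, Tm.rename, capp] using hC.wk hA.cons

theorem methodInr (hA : Ok Γ A (.univ i)) (hB : Ok Γ B (.univ i))
    (hC : Ok Γ C (arr (capp .sum [A.erase, B.erase]) (.univ j))) :
    Ok (B.erase :: Γ) (Ann.methodInr j A B C) (.univ j) := by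
  have hAw := hA.wk hB.cons
  have hBw := hB.wk hB.cons
  refine .sumMotive hAw hBw ?_ (.inr hAw hBw (by simpa using hB.var_zero))
  simpa [Tm.wk, arr_rename, Tm.rename, capp] using hC.wk hB.cons

theorem erase_methodInl :
    .pi A.erase (Ann.methodInl j A B C).erase = Derivable.methodInl A.erase B.erase C.erase := by
  simp [Ann.methodInl, Derivable.methodInl, Ann.erase, capp]

theorem erase_methodInr :
    .pi B.erase (Ann.methodInr j A B C).erase = Derivable.methodInr A.erase B.erase C.erase := by
  simp [Ann.methodInr, Derivable.methodInr, Ann.erase, capp]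

theorem circleMotive (hC : Ok Γ C (arr (.const .circle) (.univ j))) :
    Ok (.const .circle :: Γ) (Ann.circleMotive j C) (.univ j) := by
  have h := circle hC.ctx
  have hc := (circle (h.cons)).cons
  refine .app' (circle h.cons) (.univ hc) (hC.wk h.cons) ?_ h.var_zero rfl rfl
  simp [Tm.wk, Tm.rename, arr, Ann.erase]

theorem erase_circleMotive :
    (Ann.circleMotive j C).erase = .app C.erase.wk (.var 0) := by
  simp [Ann.circleMotive, Ann.erase]

end Ok

end

end HoTT

/-! ### Soundness of weak head reduction. -/

namespace HoTT

open Tm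

/-- The reduct `v` of `t` has the same type, and is judgmentally equal to `t`. -/
def Red (Γ : Ctx) (t v : Ann) (T : Tm) : Prop :=
  Ok Γ v T ∧ Derivable (.eq Γ t.erase v.erase T)

/-- The test `cv` for conversion is sound. -/
def ConvSound (cv : Ann → Ann → Bool) : Prop :=
  ∀ {Γ v u T}, cv v u = true → Ok Γ v T → Ok Γ u T → Derivable (.eq Γ v.erase u.erase T)

theorem ConvSound.types {cv : Ann → Ann → Bool} (hcv : ConvSound cv) {Γ : Ctx} {A B : Ann}
    {i j : ℕ} (h : cv A B = true) (hA : Ok Γ A (.univ i)) (hB : Ok Γ B (.univ j)) :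
    Derivable (.eq Γ A.erase B.erase (.univ (max i j))) :=
  hcv h (hA.cumul_le (le_max_left _ _)) (hB.cumul_le (le_max_right _ _))

/-- The reduction `wh` is sound. -/
def WhnfSound (wh : Ann → Ann) : Prop :=
  ∀ {Γ t T}, Ok Γ t T → Red Γ t (wh t) T

namespace Red

variable {Γ : Ctx} {t u v : Ann} {T : Tm}

theorem refl (h : Ok Γ t T) : Red Γ t t T := ⟨h, h.eq_refl⟩

theorem trans (h : Red Γ t u T) (h' : Red Γ u v T) : Red Γ t v T := ⟨h'.1, .eq_trans h.2 h'.2⟩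

end Red

namespace Derivable

variable {Γ : Ctx} {A C x x' y y' p p' : Tm} {i j : ℕ}

theorem motiveJ_congr (hC : Derivable (.typ Γ C (motiveJ A j))) (hx : Derivable (.eq Γ x x' A))
    (hy : Derivable (.eq Γ y y' A)) (hp : Derivable (.eq Γ p p' (capp .id [A, x, y]))) :
    Derivable (.eq Γ (.app (.app (.app C x) y) p) (.app (.app (.app C x') y') p') (.univ j)) :=
  app_subst_congr (app_subst_congr (app_subst_congr
    (show Derivable (.eq Γ C C ((motiveJ (.var 0) j).subst (Tm.cons A Tm.var))) from .eq_refl hC)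
    hx) hy) hp

end Derivable

namespace Ok

variable {Γ : Ctx} {A A' B B' C a b c f g l p t u v x y : Ann} {T : Tm} {i j : ℕ}

theorem symm_conv (ha : Ok Γ a A'.erase) (h : Derivable (.eq Γ A.erase A'.erase (.univ i))) :
    Ok Γ a A.erase :=
  .conv ha h.eq_symm

/-- Subject reduction for β without injectivity of `Π`: that `A` equals `A'` and `B` equals `B'` is
not deduced from the type of the abstraction, but comes from the two conversion tests. The
equalities move the body from the annotations of the abstraction to those of the application. -/
theorem red_beta (hA : Ok Γ A (.univ i)) (hf : Red Γ f (.lam A' B' b) (.pi A.erase B.erase))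
    (hB : Ok (A.erase :: Γ) B (.univ j)) (ha : Ok Γ a A.erase)
    {cv : Ann → Ann → Bool} (hcv : ConvSound cv) (h1 : cv A A' = true) (h2 : cv B B' = true) :
    Red Γ (.app A B f a) (b.inst a) (B.erase.inst a.erase) := by
  obtain ⟨_, ⟨⟨i', hA'⟩, ⟨j', hB'⟩, hb, _⟩, _⟩ := hf.1.inv
  have eA := hcv.types h1 hA hA'
  have hB'' := hB'.ctx_conv (hA.cumul_le (le_max_left _ _)).typ eA
  have eB := hcv.types h2 hB hB''
  have hb' := hb.ctx_conv (hA.cumul_le (le_max_left _ _)).typ eA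
  refine ⟨(hb'.symm_conv eB).inst ha, .eq_trans (.app_congr hf.2 ha.eq_refl) ?_⟩
  rw [Ann.erase_inst]
  exact .eq_conv (.pi_beta hb.typ (.conv ha.typ eA)) (eB.eq_symm.inst_eq ha.typ)

/-- Only the base point triggers a reduction, since the rule for `loop` holds up to a path and is
the constant `circleLoop`. The test on `B` is needed because the reduct has type `C base`, which
must be converted to the type of the application. -/
theorem red_circle (hA : Ok Γ A (.univ i)) (hf : Red Γ f (.circleInd j C b l) (.pi A.erase B.erase))
    {k : ℕ} (hB : Ok (A.erase :: Γ) B (.univ k)) (ha : Ok Γ a A.erase)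
    (ha' : Red Γ a (.const .base) A.erase)
    {cv : Ann → Ann → Bool} (hcv : ConvSound cv) (h1 : cv A (.const .circle) = true)
    (h2 : cv B (.circleMotive j C) = true) :
    Red Γ (.app A B f a) b (B.erase.inst a.erase) := by
  obtain ⟨_, ⟨hC, hb, hl, _⟩, _⟩ := hf.1.inv
  have eA := hcv.types h1 hA (circle hA.ctx)
  have eB := (hcv.types h2 hB (hC.circleMotive.ctx_conv (hA.cumul_le (le_max_left _ _)).typ eA)).inst_eq ha.typ
  rw [erase_circleMotive] at eB
  have e : Derivable (.eq Γ (B.erase.inst a.erase) (.app C.erase (.const .base))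
      (.univ (max (max k j) j))) := by
    have h : Derivable (.eq Γ (.app C.erase a.erase) (.app C.erase (.const .base)) (.univ j)) :=
      .app_congr hC.eq_refl (.eq_conv ha'.2 eA)
    have e1 : (Tm.app C.erase.wk (.var 0)).inst a.erase = .app C.erase a.erase := by
      simp [Tm.inst, subst, wk_subst_single, single]
    rw [e1] at eB
    exact .eq_trans (eB.eq_cumul_le (le_max_left _ _)) (h.eq_cumul_le (le_max_right _ _))
  exact ⟨.conv hb e.eq_symm, .eq_trans (.app_congr hf.2 ha'.2)
    (.eq_conv (.circle_beta hC.typ hb.typ hl.typ) e.eq_symm)⟩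

theorem red_fst (hA : Ok Γ A (.univ i)) (hp : Red Γ p (.pair A' B' a b) (.sigma A.erase B.erase))
    {cv : Ann → Ann → Bool} (hcv : ConvSound cv) (h1 : cv A A' = true) :
    Red Γ (.fst A B p) a A.erase := by
  obtain ⟨_, ⟨⟨i', hA'⟩, ⟨j', hB'⟩, ha, hb, _⟩, _⟩ := hp.1.inv
  have eA := hcv.types h1 hA hA'
  exact ⟨ha.symm_conv eA, .eq_trans (.fst_congr hp.2)
    (.eq_conv (.fst_beta hB'.typ ha.typ hb.typ) eA.eq_symm)⟩

theorem red_snd (hA : Ok Γ A (.univ i)) (hB : Ok (A.erase :: Γ) B (.univ j))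
    (hp' : Ok Γ p (.sigma A.erase B.erase))
    (hp : Red Γ p (.pair A' B' a b) (.sigma A.erase B.erase))
    {cv : Ann → Ann → Bool} (hcv : ConvSound cv) (h1 : cv A A' = true) (h2 : cv B B' = true) :
    Red Γ (.snd A B p) b (B.erase.inst (.fst p.erase)) := by
  obtain ⟨_, ⟨⟨i', hA'⟩, ⟨j', hB'⟩, ha, hb, _⟩, _⟩ := hp.1.inv
  have eA := hcv.types h1 hA hA'
  have eB := hcv.types h2 hB (hB'.ctx_conv (hA.cumul_le (le_max_left _ _)).typ eA)
  have ha' := ha.symm_conv eA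
  have e1 : Derivable (.eq Γ a.erase (.fst p.erase) A.erase) :=
    .eq_symm (red_fst hA hp hcv h1).2
  have e : Derivable (.eq Γ (B'.erase.inst a.erase) (B.erase.inst (.fst p.erase))
      (.univ (max j j'))) :=
    .eq_trans (eB.eq_symm.inst_eq ha'.typ)
      ((Derivable.inst_congr_type hA.typ hB.typ ha'.typ (.fst hp'.typ) e1).eq_cumul_le
        (le_max_left _ _))
  exact ⟨.conv hb e, .eq_trans (.snd_congr hp.2)
    (.eq_conv (.snd_beta hB'.typ ha.typ hb.typ) e)⟩

/-- The rule `id_beta` requires both endpoints to be the subject of the reflexivity path. Hence `x`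
and `y` are tested against `a`, after which congruence of `J` makes the rule applicable and also
relates the two types. -/
theorem red_J (hA : Ok Γ A (.univ i)) (hC : Ok Γ C (Derivable.motiveJ A.erase j))
    (hc : Ok Γ c (Derivable.methodJ A.erase C.erase)) (hx : Ok Γ x A.erase) (hy : Ok Γ y A.erase)
    (hp : Red Γ p (.refl A' a) (capp .id [A.erase, x.erase, y.erase]))
    {cv : Ann → Ann → Bool} (hcv : ConvSound cv) (h1 : cv A A' = true) (h2 : cv x a = true)
    (h3 : cv y a = true) :
    Red Γ (.J j A C c x y p) (.app A (.methodJ j A C) c a)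
      (.app (.app (.app C.erase x.erase) y.erase) p.erase) := by
  obtain ⟨_, ⟨i', hA', ha', _⟩, _⟩ := hp.1.inv
  have eA := hcv.types h1 hA hA'
  have ha := ha'.symm_conv eA
  have ex := hcv h2 hx ha
  have ey := hcv h3 hy ha
  have ep : Derivable (.eq Γ p.erase (capp .refl [A.erase, a.erase])
      (capp .id [A.erase, x.erase, y.erase])) :=
    .eq_trans hp.2 (.eq_conv (.eq_symm (.refl_congr eA ha.eq_refl))
      (.eq_symm (.id_congr hA.eq_refl ex ey)))
  have eC := Derivable.motiveJ_congr hC.typ ex ey ep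
  refine ⟨.conv (.app' hA (hA.methodJ hC) hc erase_methodJ.symm ha rfl ?_) eC.eq_symm,
    .eq_trans (.J_congr hA.eq_refl hC.eq_refl hc.eq_refl ex ey ep)
      (.eq_conv (.id_beta hA.typ hC.typ hc.typ ha.typ) eC.eq_symm)⟩
  simp [Ann.methodJ, Ann.motiveJ, Ann.erase, capp, Tm.inst, subst, wk_subst_single, single]

theorem red_inl (hA : Ok Γ A (.univ i)) (hB : Ok Γ B (.univ i))
    (hC : Ok Γ C (arr (capp .sum [A.erase, B.erase]) (.univ j)))
    (hf : Ok Γ f (Derivable.methodInl A.erase B.erase C.erase))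
    (hg : Ok Γ g (Derivable.methodInr A.erase B.erase C.erase))
    (hx : Red Γ x (.inl A' B' a) (capp .sum [A.erase, B.erase]))
    {cv : Ann → Ann → Bool} (hcv : ConvSound cv) (h1 : cv A A' = true) (h2 : cv B B' = true) :
    Red Γ (.sumInd j A B C f g x) (.app A (.methodInl j A B C) f a) (.app C.erase x.erase) := by
  obtain ⟨_, ⟨i', hA', hB', ha', _⟩, _⟩ := hx.1.inv
  have eA := hcv.types h1 hA hA'
  have eB := hcv.types h2 hB hB'
  have ha := ha'.symm_conv eA
  have ex : Derivable (.eq Γ x.erase (capp .inl [A.erase, B.erase, a.erase])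
      (capp .sum [A.erase, B.erase])) :=
    .eq_trans hx.2 (.eq_symm (.inl_congr eA eB ha.eq_refl))
  have eC : Derivable (.eq Γ (.app C.erase x.erase)
      (.app C.erase (capp .inl [A.erase, B.erase, a.erase])) (.univ j)) :=
    .app_congr hC.eq_refl ex
  refine ⟨.conv (.app' hA (hA.methodInl hB hC) hf erase_methodInl.symm ha rfl ?_) eC.eq_symm,
    .eq_trans (.sumInd_congr hA.eq_refl hB.eq_refl hC.eq_refl hf.eq_refl hg.eq_refl ex)
      (.eq_conv (.sum_beta_inl hA.typ hB.typ hC.typ hf.typ hg.typ ha.typ) eC.eq_symm)⟩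
  simp [Ann.methodInl, Ann.erase, capp, Tm.inst, subst, wk_subst_single, single]

theorem red_inr (hA : Ok Γ A (.univ i)) (hB : Ok Γ B (.univ i))
    (hC : Ok Γ C (arr (capp .sum [A.erase, B.erase]) (.univ j)))
    (hf : Ok Γ f (Derivable.methodInl A.erase B.erase C.erase))
    (hg : Ok Γ g (Derivable.methodInr A.erase B.erase C.erase))
    (hx : Red Γ x (.inr A' B' b) (capp .sum [A.erase, B.erase]))
    {cv : Ann → Ann → Bool} (hcv : ConvSound cv) (h1 : cv A A' = true) (h2 : cv B B' = true) :
    Red Γ (.sumInd j A B C f g x) (.app B (.methodInr j A B C) g b) (.app C.erase x.erase) := by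
  obtain ⟨_, ⟨i', hA', hB', hb', _⟩, _⟩ := hx.1.inv
  have eA := hcv.types h1 hA hA'
  have eB := hcv.types h2 hB hB'
  have hb := hb'.symm_conv eB
  have ex : Derivable (.eq Γ x.erase (capp .inr [A.erase, B.erase, b.erase])
      (capp .sum [A.erase, B.erase])) :=
    .eq_trans hx.2 (.eq_symm (.inr_congr eA eB hb.eq_refl))
  have eC : Derivable (.eq Γ (.app C.erase x.erase)
      (.app C.erase (capp .inr [A.erase, B.erase, b.erase])) (.univ j)) :=
    .app_congr hC.eq_refl ex
  refine ⟨.conv (.app' hB (hA.methodInr hB hC) hg erase_methodInr.symm hb rfl ?_) eC.eq_symm,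
    .eq_trans (.sumInd_congr hA.eq_refl hB.eq_refl hC.eq_refl hf.eq_refl hg.eq_refl ex)
      (.eq_conv (.sum_beta_inr hA.typ hB.typ hC.typ hf.typ hg.typ hb.typ) eC.eq_symm)⟩
  simp [Ann.methodInr, Ann.erase, capp, Tm.inst, subst, wk_subst_single, single]

end Ok

theorem Red.sub {Γ : Ctx} {t v : Ann} {S T : Tm} (h : Red Γ t v S) (hS : Sub Γ S T) :
    Red Γ t v T :=
  ⟨h.1.sub hS, hS.eq h.2⟩

/-- Induction on the bound: whenever the tests for a redex succeed, the step is one of the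
reductions above, and otherwise the term is kept or its head is replaced by an equal one. -/
theorem Ann.whnf_sound {cv : Ann → Ann → Bool} (hcv : ConvSound cv) (n : ℕ) :
    WhnfSound (whnf cv n) := by
  induction n with
  | zero => intro Γ t T h; exact .refl h
  | succ n ih =>
    intro Γ t T h
    change Red Γ t (whnfStep cv (whnf cv n) t) T
    have h0 := h
    obtain ⟨S, hS, hsub⟩ := h.inv
    cases t with
    | app A B f a =>
      obtain ⟨⟨i, hA⟩, ⟨j, hB⟩, hf, ha, rfl⟩ := hS
      have hf' := ih hf
      simp only [whnfStep, whnfApp]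
      split
      · rename_i A' B' b e
        rw [e] at hf'
        cases hb : (cv A A' && cv B B') with
        | false => exact .refl h0
        | true =>
          rw [Bool.and_eq_true] at hb
          have := (Ok.red_beta hA hf' hB ha hcv hb.1 hb.2).sub hsub
          exact this.trans (ih this.1)
      · rename_i j C b l e
        rw [e] at hf'
        have ha' := ih ha
        split
        · rename_i e'
          rw [e'] at ha'
          cases hb : (cv A (.const .circle) && cv B (.circleMotive j C)) with
          | false => exact .refl h0
          | true =>
            rw [Bool.and_eq_true] at hb
            have := (Ok.red_circle hA hf' hB ha ha' hcv hb.1 hb.2).sub hsub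
            exact this.trans (ih this.1)
        · exact .refl h0
      · exact Red.sub ⟨.app hA hB hf'.1 ha, .app_congr hf'.2 ha.eq_refl⟩ hsub
    | fst A B p =>
      obtain ⟨⟨i, hA⟩, ⟨j, hB⟩, hp, rfl⟩ := hS
      have hp' := ih hp
      simp only [whnfStep, whnfFst]
      split
      · rename_i A' B' a b e
        rw [e] at hp'
        cases hb : cv A A' with
        | false => exact .refl h0
        | true =>
          have := (Ok.red_fst hA hp' hcv hb).sub hsub
          exact this.trans (ih this.1)
      · exact Red.sub ⟨.fst hA hB hp'.1, .fst_congr hp'.2⟩ hsub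
    | snd A B p =>
      obtain ⟨⟨i, hA⟩, ⟨j, hB⟩, hp, rfl⟩ := hS
      have hp' := ih hp
      simp only [whnfStep, whnfSnd]
      split
      · rename_i A' B' a b e
        rw [e] at hp'
        cases hb : (cv A A' && cv B B') with
        | false => exact .refl h0
        | true =>
          rw [Bool.and_eq_true] at hb
          have := (Ok.red_snd hA hB hp hp' hcv hb.1 hb.2).sub hsub
          exact this.trans (ih this.1)
      -- The type of a second projection mentions the pair, so replacing `p` by its reduct changes
      -- the type to a judgmentally equal one.
      · refine Red.sub ⟨.conv (.snd hA hB hp'.1) (i := j) ?_, .snd_congr hp'.2⟩ hsub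
        exact .inst_congr_type hA.typ hB.typ (.fst hp'.1.typ) (.fst hp.typ)
          (.eq_symm (.fst_congr hp'.2))
    | J j A C c x y p =>
      obtain ⟨i, hA, hC, hc, hx, hy, hp, rfl⟩ := hS
      have hp' := ih hp
      simp only [whnfStep, whnfJ]
      split
      · rename_i A' a e
        rw [e] at hp'
        cases hb : (cv A A' && (cv x a && cv y a)) with
        | false => exact .refl h0
        | true =>
          simp only [Bool.and_eq_true] at hb
          have := (Ok.red_J hA hC hc hx hy hp' hcv hb.1 hb.2.1 hb.2.2).sub hsub
          exact this.trans (ih this.1)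
      · exact .refl h0
    | sumInd j A B C f g x =>
      obtain ⟨i, hA, hB, hC, hf, hg, hx, rfl⟩ := hS
      have hx' := ih hx
      simp only [whnfStep, whnfSumInd]
      split
      · rename_i A' B' a e
        rw [e] at hx'
        cases hb : (cv A A' && cv B B') with
        | false => exact .refl h0
        | true =>
          rw [Bool.and_eq_true] at hb
          have := (Ok.red_inl hA hB hC hf hg hx' hcv hb.1 hb.2).sub hsub
          exact this.trans (ih this.1)
      · rename_i A' B' b e
        rw [e] at hx'
        cases hb : (cv A A' && cv B B') with
        | false => exact .refl h0
        | true =>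
          rw [Bool.and_eq_true] at hb
          have := (Ok.red_inr hA hB hC hf hg hx' hcv hb.1 hb.2).sub hsub
          exact this.trans (ih this.1)
      · exact .refl h0
    | _ => exact .refl h0

end HoTT

/-! ### Soundness of the test for conversion. -/

namespace HoTT

open Tm

namespace Ok

variable {Γ : Ctx} {A A' B B' C a b c f g l p t u v x y N : Ann} {T S : Tm} {i j : ℕ}

/-- The η-rules need a `Π`- or `Σ`-type that the neutral term has. The annotations provide an
annotated type that can be reduced to such a form, whereas `T` is an arbitrary raw type. -/
theorem neutralType (h : Ok Γ u T) (hN : u.neutralType = some N) :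
    Ok Γ u N.erase ∧ (∃ i, Ok Γ N (.univ i)) ∧ Sub Γ N.erase T := by
  obtain ⟨S, hS, hsub⟩ := h.inv
  cases u with
  | var n X =>
    obtain ⟨⟨i, hX⟩, hn, rfl⟩ := hS
    obtain rfl : X = N := by simpa [Ann.neutralType] using hN
    exact ⟨.var hn hX, ⟨i, hX⟩, hsub⟩
  | app A B f a =>
    obtain ⟨⟨i, hA⟩, ⟨j, hB⟩, hf, ha, rfl⟩ := hS
    obtain rfl : B.inst a = N := by simpa [Ann.neutralType] using hN
    rw [Ann.erase_inst]
    exact ⟨.app hA hB hf ha, ⟨j, hB.inst ha⟩, hsub⟩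
  | fst A B p =>
    obtain ⟨⟨i, hA⟩, ⟨j, hB⟩, hp, rfl⟩ := hS
    obtain rfl : A = N := by simpa [Ann.neutralType] using hN
    exact ⟨.fst hA hB hp, ⟨i, hA⟩, hsub⟩
  | snd A B p =>
    obtain ⟨⟨i, hA⟩, ⟨j, hB⟩, hp, rfl⟩ := hS
    obtain rfl : B.inst (.fst A B p) = N := by simpa [Ann.neutralType] using hN
    rw [Ann.erase_inst]
    exact ⟨.snd hA hB hp, ⟨j, hB.inst (.fst hA hB hp)⟩, hsub⟩
  | _ => simp [Ann.neutralType] at hN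

theorem erase_etaBody : (Ann.etaBody A B f).erase = .app f.erase.wk (.var 0) := by
  simp [Ann.etaBody, Ann.erase]

theorem etaBody (hA : Ok Γ A (.univ i)) (hB : Ok (A.erase :: Γ) B (.univ j))
    (hf : Ok Γ f (.pi A.erase B.erase)) : Ok (A.erase :: Γ) (Ann.etaBody A B f) B.erase := by
  have hAw := hA.wk hA.cons
  have hr : RenOk (Ann.shiftRen 1 0) Γ (A.erase :: Γ) := by
    rw [Ann.shiftRen_zero]; exact .succ _ _
  have hBw := hB.shift 1 (d := 1) hAw.cons (by simpa [Ann.wk_eq] using up_shift hr)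
  rw [← Ann.fastShift_eq] at hBw
  have e : Ann.shiftRen 1 1 = upRen Nat.succ := by rw [← Ann.upRen_shiftRen, Ann.shiftRen_zero]
  refine .app' hAw hBw (hf.wk hA.cons) ?_ hA.var_zero (by simp) ?_
  · simp [Tm.wk, Tm.rename, Ann.fastShift_eq, Ann.erase_shift, e]
  · rw [Ann.fastShift_eq, Ann.erase_shift, e]; exact rename_upRen_succ_inst _


variable {wh : Ann → Ann} {cv : Ann → Ann → Bool}

/-- Two types may have been annotated at different levels, while their equality is derived at the
larger one. This brings the equality back to the common type `T`; it holds because the maximum is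
one of the two levels. -/
theorem _root_.HoTT.Sub.univ_max (h : Sub Γ (.univ i) T) (h' : Sub Γ (.univ j) T) :
    Sub Γ (.univ (max i j)) T := by
  rcases max_choice i j with e | e <;> rwa [e]

theorem binder_congr (hcv : ConvSound cv) {i' j' : ℕ} (h1 : cv A A' = true) (h2 : cv B B' = true)
    (hA : Ok Γ A (.univ i)) (hA' : Ok Γ A' (.univ i'))
    (hB : Ok (A.erase :: Γ) B (.univ j)) (hB' : Ok (A'.erase :: Γ) B' (.univ j')) :
    Derivable (.eq Γ A.erase A'.erase (.univ (max (max i i') (max j j')))) ∧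
    Derivable (.eq (A.erase :: Γ) B.erase B'.erase (.univ (max (max i i') (max j j')))) := by
  have eA := hcv.types h1 hA hA'
  exact ⟨eA.eq_cumul_le (le_max_left _ _), (hcv.types h2 hB
    (hB'.ctx_conv (hA.cumul_le (le_max_left _ _)).typ eA)).eq_cumul_le (le_max_right _ _)⟩

/-- Congruence rules apply once the two sides are compared at one type, as `ConvSound` demands. For
this reason the annotations are compared before the subterms, and each success is used to convert
the subterms of `u` to the types of those of `v`. -/
theorem convNeutral (hcv : ConvSound cv) (h : Ann.convNeutral cv v u = true) (hv : Ok Γ v T)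
    (hu : Ok Γ u T) : Derivable (.eq Γ v.erase u.erase T) := by
  have hv0 := hv
  obtain ⟨T', hv, hT⟩ := hv.inv
  obtain ⟨S, hu, -⟩ := hu.inv
  cases v with
  | var m X =>
    cases u <;> simp only [Ann.convNeutral, Bool.false_eq_true] at h
    rename_i n Y
    rw [Nat.beq_eq] at h
    subst h
    exact hv0.eq_refl
  | const c =>
    cases u <;> simp only [Ann.convNeutral, Bool.false_eq_true] at h
    rename_i d
    rw [Nat.beq_eq] at h
    obtain rfl := Const.code_injective h
    exact hv0.eq_refl
  | app A B f a =>
    cases u <;> simp only [Ann.convNeutral, Bool.false_eq_true, Bool.and_eq_true] at h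
    obtain ⟨⟨i, hA⟩, ⟨j, hB⟩, hf, ha, rfl⟩ := hv
    obtain ⟨⟨i', hA'⟩, ⟨j', hB'⟩, hf', ha', -⟩ := hu
    obtain ⟨eA, eB⟩ := binder_congr hcv h.1 h.2.1 hA hA' hB hB'
    exact hT.eq (.app_congr (hcv h.2.2.1 hf (.conv hf' (.eq_symm (.pi_congr eA eB))))
      (hcv h.2.2.2 ha (.conv ha' eA.eq_symm)))
  | fst A B p =>
    cases u <;> simp only [Ann.convNeutral, Bool.false_eq_true, Bool.and_eq_true] at h
    obtain ⟨⟨i, hA⟩, ⟨j, hB⟩, hp, rfl⟩ := hv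
    obtain ⟨⟨i', hA'⟩, ⟨j', hB'⟩, hp', -⟩ := hu
    obtain ⟨eA, eB⟩ := binder_congr hcv h.1 h.2.1 hA hA' hB hB'
    exact hT.eq (.fst_congr (hcv h.2.2 hp (.conv hp' (.eq_symm (.sigma_congr eA eB)))))
  | snd A B p =>
    cases u <;> simp only [Ann.convNeutral, Bool.false_eq_true, Bool.and_eq_true] at h
    obtain ⟨⟨i, hA⟩, ⟨j, hB⟩, hp, rfl⟩ := hv
    obtain ⟨⟨i', hA'⟩, ⟨j', hB'⟩, hp', -⟩ := hu
    obtain ⟨eA, eB⟩ := binder_congr hcv h.1 h.2.1 hA hA' hB hB'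
    exact hT.eq (.snd_congr (hcv h.2.2 hp (.conv hp' (.eq_symm (.sigma_congr eA eB)))))
  | J j A C c x y p =>
    cases u <;> simp only [Ann.convNeutral, Bool.false_eq_true, Bool.and_eq_true] at h
    obtain ⟨i, h1, h2, h3, h4, h5, h6, rfl⟩ := hv
    obtain ⟨i', h1', h2', h3', h4', h5', h6', -⟩ := hu
    rename_i j' A' C' c' x' y' p'
    obtain ⟨e, e4, e5, e6⟩ := h
    have e : (∃ k, Derivable (.eq Γ A.erase A'.erase (.univ k))) ∧
        Derivable (.eq Γ C.erase C'.erase (Derivable.motiveJ A.erase j)) ∧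
        Derivable (.eq Γ c.erase c'.erase (Derivable.methodJ A.erase C.erase)) := by
      simp only [Bool.or_eq_true, Bool.and_eq_true] at e
      rcases e with e | e
      · rw [← Ann.erase_eq_of_same e.1, ← Ann.erase_eq_of_same e.2.1,
          ← Ann.erase_eq_of_same e.2.2]
        exact ⟨⟨_, h1.eq_refl⟩, h2.eq_refl, h3.eq_refl⟩
      -- The motives may be compared only after their types `eT` agree, and the base cases only
      -- after the types `eM` of the base cases agree. The levels `j` and `j'` may differ a priori.
      · obtain ⟨eA, eT, eC, eM, ec⟩ := e
        have eT := hcv.types eT (h1.typeMotiveJ j) (h1'.typeMotiveJ j')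
        rw [erase_typeMotiveJ, erase_typeMotiveJ] at eT
        have eM := hcv.types eM (.pi (i := max i j) (h1.cumul_le (le_max_left _ _))
            ((h1.methodJ h2).cumul_le (le_max_right _ _)))
          (.pi (i := max i' j') (h1'.cumul_le (le_max_left _ _))
            ((h1'.methodJ h2').cumul_le (le_max_right _ _)))
        simp only [Ann.erase, erase_methodJ] at eM
        exact ⟨⟨_, hcv.types eA h1 h1'⟩, hcv eC h2 (h2'.conv eT.eq_symm),
          hcv ec h3 (h3'.conv eM.eq_symm)⟩
    obtain ⟨⟨k, eA⟩, eC, ec⟩ := e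
    have e4 := hcv e4 h4 (h4'.conv eA.eq_symm)
    have e5 := hcv e5 h5 (h5'.conv eA.eq_symm)
    exact hT.eq (.J_congr (eA.eq_cumul_le (le_max_right i k))
      eC ec e4 e5 (hcv e6 h6 (.conv h6' (.eq_symm (.id_congr eA e4 e5)))))
  | sumInd j A B C f g x =>
    cases u <;> simp only [Ann.convNeutral, Bool.false_eq_true, Bool.and_eq_true] at h
    obtain ⟨i, h1, h2, h3, h4, h5, h6, rfl⟩ := hv
    obtain ⟨i', h1', h2', h3', h4', h5', h6', -⟩ := hu
    obtain ⟨eA, eB, eC, ef, eg, hcx⟩ := h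
    replace eA := Ann.erase_eq_of_same eA
    replace eB := Ann.erase_eq_of_same eB
    replace eC := Ann.erase_eq_of_same eC
    replace ef := Ann.erase_eq_of_same ef
    replace eg := Ann.erase_eq_of_same eg
    rw [← eA, ← eB] at h6'
    have := Derivable.sumInd_congr h1.eq_refl h2.eq_refl h3.eq_refl h4.eq_refl h5.eq_refl
      (hcv hcx h6 h6')
    simp only [Ann.erase, ← eA, ← eB, ← eC, ← ef, ← eg]
    exact hT.eq this
  | _ =>
    simp only [Ann.convNeutral] at h
    rw [← Ann.erase_eq_of_same h]
    exact hv0.eq_refl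

/-- This shortcut compares two iterated applications argument by argument, without contracting them.
The tests on the annotations give equal function types, so the induction can pass to the function
parts; at the bottom the heads have syntactically equal weak head reducts. -/
theorem convSpine (hwh : WhnfSound wh) (hcv : ConvSound cv)
    (h : Ann.convSpine wh cv v u = true)
    (hv : Ok Γ v T) (hu : Ok Γ u T) : Derivable (.eq Γ v.erase u.erase T) := by
  induction v generalizing u T with
  | app A B f a _ _ ihf =>
    obtain ⟨T', hv, hT⟩ := hv.inv
    obtain ⟨S, hu, -⟩ := hu.inv
    cases u <;> simp only [Ann.convSpine, Bool.false_eq_true, Bool.and_eq_true] at h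
    obtain ⟨⟨i, hA⟩, ⟨j, hB⟩, hf, ha, rfl⟩ := hv
    obtain ⟨⟨i', hA'⟩, ⟨j', hB'⟩, hf', ha', -⟩ := hu
    obtain ⟨eA, eB⟩ := binder_congr hcv h.2.1 h.2.2.1 hA hA' hB hB'
    exact hT.eq (.app_congr (ihf h.1 hf (.conv hf' (.eq_symm (.pi_congr eA eB)))) (hcv h.2.2.2 ha (.conv ha' eA.eq_symm)))
  | _ =>
    simp only [Ann.convSpine] at h
    split at h
    · cases h
    · have h' := (hwh hu).2
      rw [← Ann.erase_eq_of_same h] at h'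
      exact .eq_trans (hwh hv).2 h'.eq_symm

/-- Only one side is an abstraction or a pair, so the neutral side is expanded by η at the type read
off from its annotations and then compared componentwise. -/
theorem convStuck (hwh : WhnfSound wh) (hcv : ConvSound cv) (h : Ann.convStuck wh cv v u = true)
    (hv : Ok Γ v T) (hu : Ok Γ u T) : Derivable (.eq Γ v.erase u.erase T) := by
  cases u with
  | lam A' B' b' =>
    simp only [Ann.convStuck] at h
    split at h
    · rename_i N hN
      obtain ⟨hvN, ⟨i, hNi⟩, hT⟩ := hv.neutralType hN
      have hr := hwh hNi
      split at h
      · rename_i A B e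
        rw [e] at hr
        obtain ⟨hP, eP⟩ := hr
        have hvP := hvN.conv eP
        obtain ⟨-, ⟨k, hA, hB, -⟩, -⟩ := hP.inv
        obtain ⟨-, ⟨⟨i', hA'⟩, ⟨j', hB'⟩, hb', -⟩, -⟩ := hu.inv
        simp only [Bool.and_eq_true] at h
        obtain ⟨eA, eB⟩ := binder_congr hcv h.1 h.2.1 hA hA' hB hB'
        have eb := hcv h.2.2 (hA.etaBody hB hvP) (.conv (hb'.ctx_conv
          (hA.cumul_le (le_max_of_le_left (le_max_left _ _))).typ eA) eB.eq_symm)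
        rw [erase_etaBody] at eb
        exact hT.eq (.eq_conv (.eq_trans (.pi_eta hvP.typ) (.lam_congr eA eb)) eP.eq_symm)
      · cases h
    · cases h
  | pair A' B' a' b' =>
    simp only [Ann.convStuck] at h
    split at h
    · rename_i N hN
      obtain ⟨hvN, ⟨i, hNi⟩, hT⟩ := hv.neutralType hN
      have hr := hwh hNi
      split at h
      · rename_i A B e
        rw [e] at hr
        obtain ⟨hP, eP⟩ := hr
        have hvP := hvN.conv eP
        obtain ⟨-, ⟨k, hA, hB, -⟩, -⟩ := hP.inv
        obtain ⟨-, ⟨⟨i', hA'⟩, ⟨j', hB'⟩, ha', hb', -⟩, -⟩ := hu.inv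
        simp only [Bool.and_eq_true] at h
        obtain ⟨eA, eB⟩ := binder_congr hcv h.1 h.2.1 hA hA' hB hB'
        have ha'' := Ok.conv ha' eA.eq_symm
        have ea := hcv h.2.2.1 (.fst hA hB hvP) ha''
        have eb := hcv h.2.2.2 (.snd hA hB hvP) (.conv (.conv hb' (eB.eq_symm.inst_eq ha''.typ))
          (.eq_symm (.inst_congr_type hA.typ hB.typ (.fst hvP.typ) ha''.typ ea)))
        exact hT.eq (.eq_conv (.eq_trans (.sigma_eta hvP.typ) (.pair_congr hB.typ ea eb))
          eP.eq_symm)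
      · cases h
    · cases h
  | _ => exact convNeutral hcv h hv hu

theorem convWhnf (hwh : WhnfSound wh) (hcv : ConvSound cv) (h : Ann.convWhnf wh cv v u = true)
    (hv : Ok Γ v T) (hu : Ok Γ u T) : Derivable (.eq Γ v.erase u.erase T) := by
  have hv0 := hv
  have hu0 := hu
  obtain ⟨T', hv, hT⟩ := hv.inv
  obtain ⟨S', hu, hS⟩ := hu.inv
  cases v with
  | univ i =>
    cases u <;> simp only [Ann.convWhnf, Bool.false_eq_true] at h
    rw [Nat.beq_eq] at h
    subst h
    exact hv0.eq_refl
  | pi A B =>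
    cases u <;> simp only [Ann.convWhnf, Bool.false_eq_true, Bool.and_eq_true] at h
    obtain ⟨i, hA, hB, rfl⟩ := hv
    obtain ⟨i', hA', hB', rfl⟩ := hu
    obtain ⟨eA, eB⟩ := binder_congr hcv h.1 h.2 hA hA' hB hB'
    rw [max_self] at eA eB
    exact (hT.univ_max hS).eq (.pi_congr eA eB)
  | sigma A B =>
    cases u <;> simp only [Ann.convWhnf, Bool.false_eq_true, Bool.and_eq_true] at h
    obtain ⟨i, hA, hB, rfl⟩ := hv
    obtain ⟨i', hA', hB', rfl⟩ := hu
    obtain ⟨eA, eB⟩ := binder_congr hcv h.1 h.2 hA hA' hB hB'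
    rw [max_self] at eA eB
    exact (hT.univ_max hS).eq (.sigma_congr eA eB)
  | sum A B =>
    cases u <;> simp only [Ann.convWhnf, Bool.false_eq_true, Bool.and_eq_true] at h
    obtain ⟨i, hA, hB, rfl⟩ := hv
    obtain ⟨i', hA', hB', rfl⟩ := hu
    exact (hT.univ_max hS).eq (.sum_congr (hcv.types h.1 hA hA') (hcv.types h.2 hB hB'))
  | id A a b =>
    cases u <;> simp only [Ann.convWhnf, Bool.false_eq_true, Bool.and_eq_true] at h
    obtain ⟨i, h1, h2, h3, rfl⟩ := hv
    obtain ⟨i', h1', h2', h3', rfl⟩ := hu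
    have e := hcv.types h.1 h1 h1'
    exact (hT.univ_max hS).eq (.id_congr e (hcv h.2.1 h2 (h2'.conv e.eq_symm))
      (hcv h.2.2 h3 (h3'.conv e.eq_symm)))
  | refl A a =>
    cases u <;> simp only [Ann.convWhnf, Bool.false_eq_true, Bool.and_eq_true] at h
    obtain ⟨i, h1, h2, rfl⟩ := hv
    obtain ⟨i', h1', h2', -⟩ := hu
    have e := hcv.types h.1 h1 h1'
    exact hT.eq (.refl_congr e (hcv h.2 h2 (h2'.conv e.eq_symm)))
  | inl A B a =>
    cases u <;> simp only [Ann.convWhnf, Bool.false_eq_true, Bool.and_eq_true] at h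
    obtain ⟨i, h1, h2, h3, rfl⟩ := hv
    obtain ⟨i', h1', h2', h3', -⟩ := hu
    have e := hcv.types h.1 h1 h1'
    exact hT.eq (.inl_congr e (hcv.types h.2.1 h2 h2') (hcv h.2.2 h3 (h3'.conv e.eq_symm)))
  | inr A B b =>
    cases u <;> simp only [Ann.convWhnf, Bool.false_eq_true, Bool.and_eq_true] at h
    obtain ⟨i, h1, h2, h3, rfl⟩ := hv
    obtain ⟨i', h1', h2', h3', -⟩ := hu
    have e := hcv.types h.2.1 h2 h2'
    exact hT.eq (.inr_congr (hcv.types h.1 h1 h1') e (hcv h.2.2 h3 (h3'.conv e.eq_symm)))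
  | lam A B b =>
    obtain ⟨⟨i, hA⟩, ⟨j, hB⟩, hb, rfl⟩ := hv
    simp only [Ann.convWhnf] at h
    split at h
    · obtain ⟨⟨i', hA'⟩, ⟨j', hB'⟩, hb', -⟩ := hu
      simp only [Bool.and_eq_true] at h
      obtain ⟨eA, eB⟩ := binder_congr hcv h.1 h.2.1 hA hA' hB hB'
      exact hT.eq (.lam_congr eA (hcv h.2.2 hb (.conv (hb'.ctx_conv
        (hA.cumul_le (le_max_of_le_left (le_max_left _ _))).typ eA) eB.eq_symm)))
    · split at h
      · rename_i N hN
        obtain ⟨huN, ⟨k, hNk⟩, -⟩ := hu0.neutralType hN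
        have hr := hwh hNk
        split at h
        · rename_i A' B' e
          rw [e] at hr
          obtain ⟨hP, eP⟩ := hr
          obtain ⟨-, ⟨k', hA', hB', -⟩, -⟩ := hP.inv
          simp only [Bool.and_eq_true] at h
          obtain ⟨eA, eB⟩ := binder_congr hcv h.1 h.2.1 hA hA' hB hB'
          have huP : Ok Γ u (.pi A.erase B.erase) := .conv (huN.conv eP)
            (.eq_symm (.pi_congr eA eB))
          have eb := hcv h.2.2 hb (hA.etaBody hB huP)
          rw [erase_etaBody] at eb
          exact hT.eq (.eq_trans (.lam_congr hA.eq_refl eb) (.eq_symm (.pi_eta huP.typ)))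
        · cases h
      · cases h
  | pair A B a b =>
    obtain ⟨⟨i, hA⟩, ⟨j, hB⟩, ha, hb, rfl⟩ := hv
    simp only [Ann.convWhnf] at h
    split at h
    · obtain ⟨⟨i', hA'⟩, ⟨j', hB'⟩, ha', hb', -⟩ := hu
      simp only [Bool.and_eq_true] at h
      obtain ⟨eA, eB⟩ := binder_congr hcv h.1 h.2.1 hA hA' hB hB'
      have ha'' := Ok.conv ha' eA.eq_symm
      have ea := hcv h.2.2.1 ha ha''
      exact hT.eq (.pair_congr hB.typ ea (hcv h.2.2.2 hb
        (.conv (.conv hb' (eB.eq_symm.inst_eq ha''.typ))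
          (.eq_symm (.inst_congr_type hA.typ hB.typ ha.typ ha''.typ ea)))))
    · split at h
      · rename_i N hN
        obtain ⟨huN, ⟨k, hNk⟩, -⟩ := hu0.neutralType hN
        have hr := hwh hNk
        split at h
        · rename_i A' B' e
          rw [e] at hr
          obtain ⟨hP, eP⟩ := hr
          obtain ⟨-, ⟨k', hA', hB', -⟩, -⟩ := hP.inv
          simp only [Bool.and_eq_true] at h
          obtain ⟨eA, eB⟩ := binder_congr hcv h.1 h.2.1 hA hA' hB hB'
          have huP : Ok Γ u (.sigma A.erase B.erase) := .conv (huN.conv eP)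
            (.eq_symm (.sigma_congr eA eB))
          have ea := hcv h.2.2.1 ha (.fst hA hB huP)
          have eb := hcv h.2.2.2 hb (.conv (.snd hA hB huP)
            (.eq_symm (.inst_congr_type hA.typ hB.typ ha.typ (.fst huP.typ) ea)))
          exact hT.eq (.eq_trans (.pair_congr hB.typ ea eb) (.eq_symm (.sigma_eta huP.typ)))
        · cases h
      · cases h
  | _ => exact convStuck hwh hcv h hv0 hu0

end Ok

/-- Reduction and conversion call each other, but the test with bound `n + 1` only uses reduction
over the test with bound `n`. A single induction on the bound therefore yields both, and the
exhausted bound is harmless because it answers `false`. -/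
theorem Ann.conv_sound (n : ℕ) : ConvSound (Ann.conv n) := by
  induction n with
  | zero => intro Γ v u T h; cases h
  | succ n ih =>
    intro Γ v u T h hv hu
    change (Bool.rec (Bool.rec (Ann.convWhnf _ _ (Ann.whnf _ n v) (Ann.whnf _ n u)) _
      (Ann.convSpine (Ann.whnf _ n) _ v u)) _ (v.same u) : Bool) = true at h
    cases hs : v.same u with
    | true =>
      rw [← Ann.erase_eq_of_same hs]
      exact hv.eq_refl
    | false =>
      rw [hs] at h
      cases hp : Ann.convSpine (Ann.whnf (Ann.conv n) n) (Ann.conv n) v u with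
      | true => exact Ok.convSpine (Ann.whnf_sound ih n) ih hp hv hu
      | false =>
      change (Bool.rec _ _ (Ann.convSpine (Ann.whnf (Ann.conv n) n) (Ann.conv n) v u) : Bool) = true at h
      rw [hp] at h
      have hv' := Ann.whnf_sound ih n hv
      have hu' := Ann.whnf_sound ih n hu
      exact .eq_trans hv'.2 (.eq_trans
        (Ok.convWhnf (Ann.whnf_sound ih n) ih h hv'.1 hu'.1) hu'.2.eq_symm)

end HoTT

namespace HoTT

open Tm

noncomputable section

/-! ## Type inference -/

/-- The shapes of raw terms that are treated differently by type inference. -/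
inductive View where
  | var (n : ℕ)
  | univ (i : ℕ)
  | pi (A B : Tm)
  | lam (A b : Tm)
  | app (f a : Tm)
  | sigma (A B : Tm)
  | pair (a b : Tm)
  | fst (p : Tm)
  | snd (p : Tm)
  | const (c : Const)
  | id (A a b : Tm)
  | refl (A a : Tm)
  | J (A C c x y p : Tm)
  | sum (A B : Tm)
  | inl (A B a : Tm)
  | inr (A B b : Tm)
  | sumInd (A B C f g x : Tm)
  | circleInd (C b l : Tm)

namespace View

/-- The raw term of a given shape. -/
def toTm : View → Tm
  | var n => .var n
  | univ i => .univ i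
  | pi A B => .pi A B
  | lam A b => .lam A b
  | app f a => .app f a
  | sigma A B => .sigma A B
  | pair a b => .pair a b
  | fst p => .fst p
  | snd p => .snd p
  | const c => .const c
  | id A a b => .app (.app (.app (.const .id) A) a) b
  | refl A a => .app (.app (.const .refl) A) a
  | J A C c x y p => .app (.app (.app (.app (.app (.app (.const .J) A) C) c) x) y) p
  | sum A B => .app (.app (.const .sum) A) B
  | inl A B a => .app (.app (.app (.const .inl) A) B) a
  | inr A B b => .app (.app (.app (.const .inr) A) B) b
  | sumInd A B C f g x => .app (.app (.app (.app (.app (.app (.const .sumInd) A) B) C) f) g) x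
  | circleInd C b l => .app (.app (.app (.const .circleInd) C) b) l

/-- The shape of an application with a constant as its head. -/
def ofArgs (c : Const) (args : List Tm) : Option View :=
  match args with
  | [A, B] => match c with
    | .refl => some (refl A B)
    | .sum => some (sum A B)
    | _ => none
  | [A, B, a] => match c with
    | .id => some (id A B a)
    | .inl => some (inl A B a)
    | .inr => some (inr A B a)
    | .circleInd => some (circleInd A B a)
    | _ => none
  | [A, C, c', x, y, p] => match c with
    | .J => some (J A C c' x y p)
    | .sumInd => some (sumInd A C c' x y p)
    | _ => none
  | _ => none

/-- The shape of the term `t` applied to `args`, if `t` has a constant as its head. -/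
def ofApp : Tm → List Tm → Option View
  | .app f a, args => ofApp f (a :: args)
  | .const c, args => ofArgs c args
  | _, _ => none

/-- The shape of a raw term. -/
def ofTm : Tm → View
  | .var n => var n
  | .univ i => univ i
  | .pi A B => pi A B
  | .lam A b => lam A b
  | .app f a => (ofApp f [a]).getD (app f a)
  | .sigma A B => sigma A B
  | .pair a b => pair a b
  | .fst p => fst p
  | .snd p => snd p
  | .const c => const c

theorem toTm_ofArgs {c : Const} {args : List Tm} {v : View} (h : ofArgs c args = some v) :
    v.toTm = capp c args := by
  unfold ofArgs at h
  split at h <;> first | cases h | (split at h <;> cases h <;> rfl)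

theorem toTm_ofApp {t : Tm} {args : List Tm} {v : View} (h : ofApp t args = some v) :
    v.toTm = args.foldl Tm.app t := by
  induction t generalizing args with
  | app f a ih => exact ih h
  | const c => exact toTm_ofArgs h
  | _ => cases h

/-- This is all that soundness requires of `View.ofTm`: whichever shape is recognised, it denotes
the original term. -/
theorem toTm_ofTm (t : Tm) : (ofTm t).toTm = t := by
  cases t with
  | app f a =>
    rw [ofTm]
    cases h : ofApp f [a] with
    | none => rfl
    | some v => exact toTm_ofApp h
  | _ => rfl

end View

/-- The levels at which a constant is used. -/
def Const.level : Const → ℕ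
  | .circleLoop => 1
  | _ => 0

/-- The first failure, or the value of the second computation. -/
def andThen {α β : Type} (o : Option α) (f : α → Option β) : Option β := Option.rec none f o

theorem andThen_eq_some {α β : Type} {o : Option α} {f : α → Option β} {b : β} :
    andThen o f = some b ↔ ∃ a, o = some a ∧ f a = some b := by
  cases o with
  | none => simp [andThen]
  | some a => exact ⟨fun h => ⟨a, rfl, h⟩, fun ⟨_, h, h'⟩ => by cases h; exact h'⟩

/-- Fails unless the condition holds. -/
def guarded {α : Type} (c : Bool) (o : Option α) : Option α := Bool.rec none o c

theorem guarded_eq_some {α : Type} {c : Bool} {o : Option α} {a : α} :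
    guarded c o = some a ↔ c = true ∧ o = some a := by
  cases c with
  | false => simp [guarded]
  | true => exact ⟨fun h => ⟨rfl, h⟩, fun h => h.2⟩

namespace Ann

/-- The type of a variable in its context, without weakening. -/
def lookup (Γ : List Ann) : ℕ → Option Ann :=
  List.rec (fun _ => none) (fun X _ ih n => Nat.rec (some X) (fun n _ => ih n) n) Γ

theorem lookup_eq (Γ : List Ann) (n : ℕ) : lookup Γ n = Γ[n]? := by
  induction Γ generalizing n with
  | nil => rfl
  | cons X Γ ih =>
    cases n with
    | zero => rfl
    | succ n => exact ih n

/-- The level of the universe in which an iterated function type ends. -/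
def finalLevel (wh : Ann → Ann) : ℕ → Ann → ℕ
  | 0, _ => 0
  | n + 1, T => match wh T with
    | pi _ B => finalLevel wh n B
    | univ i => i
    | _ => 0

section

variable (wh : Ann → Ann) (cv : Ann → Ann → Bool)

/-- Whether terms of type `S` are also of type `T`. -/
def subtype (S T : Ann) : Bool :=
  S.same T || match wh S with
  | univ i => match wh T with
    | univ j => Nat.ble i j
    | _ => false
  | _ => cv S T

variable (known : ℕ → Tm → Option (Ann × Ann))
  (syn : List Ann → Tm → Option Ann → Option (Ann × Ann)) (Γ : List Ann)

/-- Annotates a type, and determines its level. -/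
def inferType (A : Tm) : Option (Ann × ℕ) :=
  andThen (syn Γ A none) fun r => match wh r.2 with
    | univ i => some (r.1, i)
    | _ => none

/-- Annotates a term of given type. -/
def check (a : Tm) (T : Ann) : Option Ann := andThen (syn Γ a (some T)) fun r => some r.1

/-- Annotates a term of type `T j`, where the level `j` is to be determined. -/
def inferMotive (C : Tm) (T : ℕ → Ann) : Option (Ann × ℕ) :=
  andThen (syn Γ C none) fun r =>
    -- Motives of path induction have three arguments, so four steps reach their universe; `5` is
    -- enough for every eliminator treated here. A wrong level is rejected by the guard.
    guarded (cv r.2 (T (finalLevel wh 5 r.2))) (some (r.1, finalLevel wh 5 r.2))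

def inferVar (n : ℕ) : Option (Ann × Ann) :=
  andThen (lookup Γ n) fun X => some (var n (X.fastShift (.succ n) 0), X.fastShift (.succ n) 0)

def inferPi (A B : Tm) : Option (Ann × Ann) :=
  andThen (inferType wh syn Γ A) fun A => andThen (inferType wh syn (A.1 :: Γ) B) fun B =>
    some (pi A.1 B.1, univ (max A.2 B.2))

def inferLam (A b : Tm) : Option (Ann × Ann) :=
  andThen (inferType wh syn Γ A) fun A => andThen (syn (A.1 :: Γ) b none) fun b =>
    some (lam A.1 b.2 b.1, pi A.1 b.2)

def inferApp (f a : Tm) : Option (Ann × Ann) :=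
  andThen (syn Γ f none) fun f => match wh f.2 with
    | pi A B => andThen (check syn Γ a A) fun a => some (app A B f.1 a, B.inst a)
    | _ => none

def inferSigma (A B : Tm) : Option (Ann × Ann) :=
  andThen (inferType wh syn Γ A) fun A => andThen (inferType wh syn (A.1 :: Γ) B) fun B =>
    some (sigma A.1 B.1, univ (max A.2 B.2))

def inferFst (p : Tm) : Option (Ann × Ann) :=
  andThen (syn Γ p none) fun p => match wh p.2 with
    | sigma A B => some (fst A B p.1, A)
    | _ => none

def inferSnd (p : Tm) : Option (Ann × Ann) :=
  andThen (syn Γ p none) fun p => match wh p.2 with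
    -- The first projection is reduced before it enters the type. For a component deep inside a
    -- closed tuple this avoids projections of the whole tuple in the types of the later components.
    | sigma A B => some (snd A B p.1, B.inst (wh (fst A B p.1)))
    | _ => none

def inferConst (c : Const) : Option (Ann × Ann) :=
  andThen (inferType wh syn Γ (c.type c.level c.level).close) fun T => some (const c, T.1)

def inferId (A a b : Tm) : Option (Ann × Ann) :=
  andThen (inferType wh syn Γ A) fun A => andThen (check syn Γ a A.1) fun a =>
    andThen (check syn Γ b A.1) fun b => some (id A.1 a b, univ A.2)

def inferRefl (A a : Tm) : Option (Ann × Ann) :=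
  andThen (inferType wh syn Γ A) fun A => andThen (check syn Γ a A.1) fun a =>
    some (refl A.1 a, id A.1 a a)

def inferJ (A C c x y p : Tm) : Option (Ann × Ann) :=
  andThen (inferType wh syn Γ A) fun A =>
  andThen (inferMotive wh cv syn Γ C (typeMotiveJ A.1)) fun C =>
  andThen (check syn Γ c (pi A.1 (methodJ C.2 A.1 C.1))) fun c =>
  andThen (check syn Γ x A.1) fun x =>
  andThen (check syn Γ y A.1) fun y =>
  andThen (check syn Γ p (id A.1 x y)) fun p =>
    some (J C.2 A.1 C.1 c x y p, motiveJ C.2 A.1 C.1 x y p)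

def inferSum (A B : Tm) : Option (Ann × Ann) :=
  andThen (inferType wh syn Γ A) fun A => andThen (inferType wh syn Γ B) fun B =>
    some (sum A.1 B.1, univ (max A.2 B.2))

def inferInl (A B a : Tm) : Option (Ann × Ann) :=
  andThen (inferType wh syn Γ A) fun A => andThen (inferType wh syn Γ B) fun B =>
    andThen (check syn Γ a A.1) fun a => some (inl A.1 B.1 a, sum A.1 B.1)

def inferInr (A B b : Tm) : Option (Ann × Ann) :=
  andThen (inferType wh syn Γ A) fun A => andThen (inferType wh syn Γ B) fun B =>
    andThen (check syn Γ b B.1) fun b => some (inr A.1 B.1 b, sum A.1 B.1)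

def inferSumInd (A B C f g x : Tm) : Option (Ann × Ann) :=
  andThen (inferType wh syn Γ A) fun A =>
  andThen (inferType wh syn Γ B) fun B =>
  andThen (inferMotive wh cv syn Γ C fun j => pi (sum A.1 B.1) (univ j)) fun C =>
  andThen (check syn Γ f (pi A.1 (methodInl C.2 A.1 B.1 C.1))) fun f =>
  andThen (check syn Γ g (pi B.1 (methodInr C.2 A.1 B.1 C.1))) fun g =>
  andThen (check syn Γ x (sum A.1 B.1)) fun x =>
    some (sumInd C.2 A.1 B.1 C.1 f g x, app (sum A.1 B.1) (univ C.2) C.1 x)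

def inferCircleInd (C b l : Tm) : Option (Ann × Ann) :=
  andThen (inferMotive wh cv syn Γ C fun j => pi (const .circle) (univ j)) fun C' =>
  andThen (check syn Γ b (app (const .circle) (univ C'.2) C'.1 (const .base))) fun b' =>
  -- The type of the path part is annotated by inference from the raw type in the typing rule.
  andThen (inferType wh syn Γ (circleMethod C b)) fun L =>
  andThen (check syn Γ l L.1) fun l =>
    some (circleInd C'.2 C'.1 b' l, pi (const .circle) (circleMotive C'.2 C'.1))

/-- Annotates a term of given shape, and determines its type. -/
def infer : View → Option (Ann × Ann)
  | .var n => inferVar Γ n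
  | .univ i => some (univ i, univ (.succ i))
  | .pi A B => inferPi wh syn Γ A B
  | .lam A b => inferLam wh syn Γ A b
  | .app f a => inferApp wh syn Γ f a
  | .sigma A B => inferSigma wh syn Γ A B
  -- The `Σ`-type of a pair is not determined by its components, so a pair that is not checked
  -- against a given type must have been annotated beforehand.
  | .pair a b => known Γ.length (.pair a b)
  | .fst p => inferFst wh syn Γ p
  | .snd p => inferSnd wh syn Γ p
  | .const c => inferConst wh syn Γ c
  | .id A a b => inferId wh syn Γ A a b
  | .refl A a => inferRefl wh syn Γ A a
  | .J A C c x y p => inferJ wh cv syn Γ A C c x y p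
  | .sum A B => inferSum wh syn Γ A B
  | .inl A B a => inferInl wh syn Γ A B a
  | .inr A B b => inferInr wh syn Γ A B b
  | .sumInd A B C f g x => inferSumInd wh cv syn Γ A B C f g x
  | .circleInd C b l => inferCircleInd wh cv syn Γ C b l

def checkLam (A b : Tm) (T : Ann) : Option (Ann × Ann) :=
  match wh T with
  | pi A' B => andThen (inferType wh syn Γ A) fun A => guarded (cv A.1 A')
      -- The expected codomain `B` lives over `A'`, so the body is checked there; the guard allows
      -- the result to be moved over the written domain.
      (andThen (check syn (A' :: Γ) b B) fun b => some (lam A.1 B b, T))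
  | _ => none

def checkPair (a b : Tm) (T : Ann) : Option (Ann × Ann) :=
  match wh T with
  | sigma A B => andThen (check syn Γ a A) fun a => andThen (check syn Γ b (B.inst a)) fun b =>
      some (pair A B a b, T)
  | _ => none

/-- Annotates a term of given shape, with a given type. -/
def checkView (v : View) (T : Ann) : Option (Ann × Ann) :=
  match v with
  | .lam A b => checkLam wh cv syn Γ A b T
  | .pair a b => checkPair wh syn Γ a b T
  | v => andThen (infer wh cv known syn Γ v) fun r => guarded (subtype wh cv r.2 T) (some (r.1, T))

end

/-- Annotates a raw term, and determines its type if this is not given. The recursion is bounded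
by the argument `n`; the types of the pairs `t` with `known m t` in contexts of length `m` are
known. -/
def synth (known : ℕ → Tm → Option (Ann × Ann)) (n : ℕ) :
    List Ann → Tm → Option Ann → Option (Ann × Ann) :=
  Nat.rec (fun _ _ _ => none) (fun n syn Γ t T => Option.rec
    (infer (whnf (conv n) n) (conv n) known syn Γ (View.ofTm t))
    (checkView (whnf (conv n) n) (conv n) known syn Γ (View.ofTm t)) T) n

end Ann

end

end HoTT

namespace HoTT

open Exp

/-! ## The wild CwF of types with a loop at each element -/

namespace LoopModel

/-- Types with a loop at each element. -/
def con : Exp := Sig (U 0) fun A => Pi A fun x => Id A x x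

/-- Functions are not required to respect the loops. The loops of a context thus play no role in any
component except the right unit law. -/
def sub (Γ Δ : Exp) : Exp := fst Γ ⟶ₑ fst Δ

def ty (Γ : Exp) : Exp := fst Γ ⟶ₑ U 0

def tm (Γ A : Exp) : Exp := Pi (fst Γ) fun x => A ⬝ₑ x

/-- The terms of the substituted type `A[σ]`. -/
def tmSub (Γ A σ : Exp) : Exp := Pi (fst Γ) fun x => A ⬝ₑ (σ ⬝ₑ x)

def total (Γ A : Exp) : Exp := Sig (fst Γ) fun x => A ⬝ₑ x

/-- Function extensionality for non-dependent functions. -/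
def funextArr (A B f g : Exp) : Exp := cst .funext ⬝ₑ A ⬝ₑ (Lam A fun _ => B) ⬝ₑ f ⬝ₑ g

/-- The path between `f` and `g` that is given by the homotopy `h`. -/
def funPath (A B f g h : Exp) : Exp := fst (fst (funextArr A B f g)) ⬝ₑ h

/-- The right unit law, which is given by the loops. -/
def idr : Exp :=
  Lam con fun Γ => Lam con fun Δ => Lam (sub Γ Δ) fun σ =>
    -- The composite `σ ∘ id` is judgmentally `σ`, so a path from `σ` to itself has the required
    -- type.
    funPath (fst Γ) (fst Δ) σ σ (Lam (fst Γ) fun x => snd Δ ⬝ₑ (σ ⬝ₑ x))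

/-- If the path from the identity of `Γ` to itself that is given by the right unit law is trivial,
then the loop at `b : Γ` is trivial. -/
def reflEqLoop : Exp :=
  Lam con fun Γ => Lam (fst Γ) fun b =>
    let A := fst Γ
    let i := Lam A fun x => x
    let h := Lam A fun x => snd Γ ⬝ₑ (i ⬝ₑ x)
    let r := idr ⬝ₑ Γ ⬝ₑ Γ ⬝ₑ i
    let apply (p : Exp) : Exp := happly A (fun x => (Lam A fun _ => A) ⬝ₑ x) i i ⬝ₑ p
    Lam (Id (Id (A ⟶ₑ A) i i) (rfle (A ⟶ₑ A) i) r) fun w =>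
      -- The right inverse of `happly` identifies `apply r` with `h`, since `r` reduces to the path
      -- that function extensionality assigns to `h`. This replaces `apply r ⬝ₑ b` by `h ⬝ₑ b`,
      -- which is the loop at `b`.
      transport (Pi A fun x => Id A x x) (fun k => Id (Id A b b) (rfle A b) (k ⬝ₑ b)) (apply r) h
        (snd (fst (funextArr A A i i)) ⬝ₑ h)
        -- The action of `apply` on `w`; its left endpoint reduces to `refl`, because `happly`
        -- computes on reflexivity.
        (pathInd (Id (A ⟶ₑ A) i i) (fun r s _ => Id (Id A b b) (apply r ⬝ₑ b) (apply s ⬝ₑ b))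
          (fun r => rfle (Id A b b) (apply r ⬝ₑ b)) (rfle (A ⟶ₑ A) i) r w)

/-- Since composition, substitution and pairing are defined pointwise, β and η make the two sides of
every law coincide, and all laws are `refl` with two exceptions: `idr`, which carries the loops, and
the uniqueness of maps into the empty context. -/
def model : Exp :=
  pair con <|
  pair (Lam con fun Γ => Lam con fun Δ => sub Γ Δ) <|
  pair (Lam con fun Γ => Lam con fun Θ => Lam con fun Δ => Lam (sub Θ Δ) fun σ =>
    Lam (sub Γ Θ) fun δ => Lam (fst Γ) fun x => σ ⬝ₑ (δ ⬝ₑ x)) <|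
  pair (Lam con fun Ξ => Lam con fun Γ => Lam con fun Θ => Lam con fun Δ => Lam (sub Θ Δ) fun σ =>
    Lam (sub Γ Θ) fun δ => Lam (sub Ξ Γ) fun ν =>
      rfle (sub Ξ Δ) (Lam (fst Ξ) fun x => σ ⬝ₑ (δ ⬝ₑ (ν ⬝ₑ x)))) <|
  pair (Lam con fun Γ => Lam (fst Γ) fun x => x) <|
  pair (Lam con fun Γ => Lam con fun Δ => Lam (sub Γ Δ) fun σ => rfle (sub Γ Δ) σ) <|
  pair idr <|
  pair (pair (cst .unit) (Lam (cst .unit) fun x => rfle (cst .unit) x)) <|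
  pair (Lam con fun Γ => Lam (fst Γ) fun _ => cst .star) <|
  pair (Lam con fun Γ => Lam (fst Γ ⟶ₑ cst .unit) fun σ =>
    -- The unit type has no judgmental η, so this law needs induction on the unit type and function
    -- extensionality.
    funPath (fst Γ) (cst .unit) σ (Lam (fst Γ) fun _ => cst .star) (Lam (fst Γ) fun x =>
      cst .unitInd ⬝ₑ (Lam (cst .unit) fun u => Id (cst .unit) u (cst .star))
        ⬝ₑ rfle (cst .unit) (cst .star) ⬝ₑ (σ ⬝ₑ x))) <|
  pair (Lam con fun Γ => ty Γ) <|
  pair (Lam con fun Γ => Lam con fun Δ => Lam (ty Δ) fun A => Lam (sub Γ Δ) fun σ =>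
    Lam (fst Γ) fun x => A ⬝ₑ (σ ⬝ₑ x)) <|
  pair (Lam con fun Γ => Lam (ty Γ) fun A => rfle (ty Γ) A) <|
  pair (Lam con fun Γ => Lam con fun Θ => Lam con fun Δ => Lam (ty Δ) fun A =>
    Lam (sub Θ Δ) fun σ => Lam (sub Γ Θ) fun δ =>
      rfle (ty Γ) (Lam (fst Γ) fun x => A ⬝ₑ (σ ⬝ₑ (δ ⬝ₑ x)))) <|
  pair (Lam con fun Γ => Lam (ty Γ) fun A => tm Γ A) <|
  pair (Lam con fun Γ => Lam con fun Δ => Lam (ty Δ) fun A => Lam (tm Δ A) fun t =>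
    Lam (sub Γ Δ) fun σ => Lam (fst Γ) fun x => t ⬝ₑ (σ ⬝ₑ x)) <|
  pair (Lam con fun Γ => Lam (ty Γ) fun A => Lam (tm Γ A) fun t => rfle (tm Γ A) t) <|
  pair (Lam con fun Γ => Lam con fun Θ => Lam con fun Δ => Lam (ty Δ) fun A =>
    Lam (tm Δ A) fun t => Lam (sub Θ Δ) fun σ => Lam (sub Γ Θ) fun δ =>
      rfle (Pi (fst Γ) fun x => A ⬝ₑ (σ ⬝ₑ (δ ⬝ₑ x)))
        (Lam (fst Γ) fun x => t ⬝ₑ (σ ⬝ₑ (δ ⬝ₑ x)))) <|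
  pair (Lam con fun Γ => Lam (ty Γ) fun A =>
    -- The loops of an extended context are unconstrained; the trivial ones are the simplest choice.
    pair (total Γ A) (Lam (total Γ A) fun z => rfle (total Γ A) z)) <|
  pair (Lam con fun Γ => Lam (ty Γ) fun A => Lam (total Γ A) fun z => fst z) <|
  pair (Lam con fun Γ => Lam (ty Γ) fun A => Lam (total Γ A) fun z => snd z) <|
  pair (Lam con fun Γ => Lam con fun Δ => Lam (ty Δ) fun A => Lam (sub Γ Δ) fun σ =>
    Lam (tmSub Γ A σ) fun t => Lam (fst Γ) fun x => pair (σ ⬝ₑ x) (t ⬝ₑ x)) <|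
  pair (Lam con fun Γ => Lam con fun Δ => Lam (ty Δ) fun A => Lam (sub Γ Δ) fun σ =>
    Lam (tmSub Γ A σ) fun _ => rfle (sub Γ Δ) σ) <|
  pair (Lam con fun Γ => Lam con fun Δ => Lam (ty Δ) fun A => Lam (sub Γ Δ) fun σ =>
    Lam (tmSub Γ A σ) fun t => rfle (tmSub Γ A σ) t) <|
  pair (Lam con fun Γ => Lam (ty Γ) fun A =>
    rfle (total Γ A ⟶ₑ total Γ A) (Lam (total Γ A) fun z => z)) <|
  Lam con fun Γ => Lam con fun Θ => Lam con fun Δ => Lam (ty Δ) fun A => Lam (sub Θ Δ) fun σ =>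
    Lam (tmSub Θ A σ) fun t => Lam (sub Γ Θ) fun ν => rfle (fst Γ ⟶ₑ total Δ A)
      (Lam (fst Γ) fun x => pair (σ ⬝ₑ (ν ⬝ₑ x)) (t ⬝ₑ (ν ⬝ₑ x)))

end LoopModel

/-! ## The circle with its loops -/

namespace CircleLoops

def circle : Exp := cst .circle
def base : Exp := cst .base
def loop : Exp := cst .loop

/-- Concatenation of `r : w = x` and `u : x = y`. -/
def cat (w x y r u : Exp) : Exp :=
  pathInd circle (fun w x _ => Id circle x y ⟶ₑ Id circle w y)
    (fun x => Lam (Id circle x y) fun u => u) w x r ⬝ₑ u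

/-- `u ∙ refl = u`, for `u : w = x`. -/
def catRefl (w x u : Exp) : Exp :=
  pathInd circle (fun w x u => Id (Id circle w x) (cat w x x u (rfle circle x)) u)
    (fun x => rfle (Id circle x x) (rfle circle x)) w x u

/-- The family of loops in the circle. -/
def loops : Exp := Lam circle fun x => Id circle x x

/-- If `u ∙ p = p ∙ v`, then the transport of `u` along `p` in the family of loops is `v`. -/
def transportLoops (x y p : Exp) : Exp :=
  pathInd circle
    (fun x y p => Pi (Id circle x x) fun u => Pi (Id circle y y) fun v =>
      Id (Id circle x y) (cat x x y u p) (cat x y y p v) ⟶ₑ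
        Id (loops ⬝ₑ y) (transport circle (fun z => loops ⬝ₑ z) x y p u) v)
    -- For `p = refl` the concatenation `refl ∙ v` reduces to `v`, because `cat` recurses on its
    -- first path, and the transport of `u` reduces to `u`. The hypothesis becomes `u ∙ refl = v`,
    -- which `catRefl` turns into `u = v`.
    (fun x => Lam (Id circle x x) fun u => Lam (Id circle x x) fun v =>
      Lam (Id (Id circle x x) (cat x x x u (rfle circle x)) v) fun h =>
        transport (Id circle x x) (fun w => Id (Id circle x x) w v)
          (cat x x x u (rfle circle x)) u (catRefl x x u) h)
    x y p

/-- The section of the family of loops whose value at the base point is `loop`. -/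
def loopSection : Exp :=
  -- With `u`, `v` and `p` all equal to `loop`, the commutation hypothesis is an instance of
  -- reflexivity.
  cst .circleInd ⬝ₑ loops ⬝ₑ loop ⬝ₑ (transportLoops base base loop ⬝ₑ loop ⬝ₑ loop ⬝ₑ
    rfle (Id circle base base) (cat base base base loop loop))

/-- The circle with a loop at each element, as a context. -/
def context : Exp := pair circle loopSection

/-! ## The loop of the circle is not trivial -/

def bool : Exp := cst .sum ⬝ₑ cst .unit ⬝ₑ cst .unit
def inl (u : Exp) : Exp := cst .inl ⬝ₑ cst .unit ⬝ₑ cst .unit ⬝ₑ u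
def inr (u : Exp) : Exp := cst .inr ⬝ₑ cst .unit ⬝ₑ cst .unit ⬝ₑ u
def tt : Exp := inl (cst .star)
def ff : Exp := inr (cst .star)

/-- Case distinction on the boolean `b`. -/
def boolInd (C f g : Exp → Exp) (b : Exp) : Exp :=
  cst .sumInd ⬝ₑ cst .unit ⬝ₑ cst .unit ⬝ₑ (Lam bool C) ⬝ₑ (Lam (cst .unit) f)
    ⬝ₑ (Lam (cst .unit) g) ⬝ₑ b

def neg : Exp := Lam bool fun b => boolInd (fun _ => bool) inr inl b

/-- Negation exchanges the injections but keeps the element of the unit type. Hence applying it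
twice to an injection of a variable reduces to that injection, and reflexivity works in both cases
without η for the unit type. -/
def negNeg : Exp :=
  Lam bool fun b => boolInd (fun b => Id bool (neg ⬝ₑ (neg ⬝ₑ b)) b)
    (fun u => rfle bool (inl u)) (fun u => rfle bool (inr u)) b

def negEquiv : Exp := pair neg (pair (pair neg negNeg) (pair neg negNeg))

def uaBool : Exp := cst (.ua 0) ⬝ₑ bool ⬝ₑ bool

/-- The path from the booleans to themselves that is given by negation. -/
def negPath : Exp := fst (fst uaBool) ⬝ₑ negEquiv

/-- If negation is the trivial path from the booleans to themselves, then `tt = ff`. -/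
def ttEqFf : Exp :=
  let mapTt (r : Exp) : Exp := fst (idToEquiv 0 bool bool ⬝ₑ r) ⬝ₑ tt
  Lam (Id (Id (U 0) bool bool) (rfle (U 0) bool) negPath) fun w =>
    -- The right inverse of `idToEquiv` given by univalence identifies the image of `negPath` with
    -- `negEquiv`, whose value at `tt` reduces to `ff`. At the trivial path, `mapTt` reduces to
    -- `tt`.
    transport (Equiv bool bool) (fun k => Id bool tt (fst k ⬝ₑ tt))
      (idToEquiv 0 bool bool ⬝ₑ negPath) negEquiv (snd (fst uaBool) ⬝ₑ negEquiv)
      (pathInd (Id (U 0) bool bool) (fun r s _ => Id bool (mapTt r) (mapTt s))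
        (fun r => rfle bool (mapTt r)) (rfle (U 0) bool) negPath w)

/-- If `tt = ff`, then the empty type has an element. -/
def emptyElement : Exp :=
  Lam (Id bool tt ff) fun w =>
    transport bool (fun b => boolInd (fun _ => U 0) (fun _ => cst .unit) (fun _ => cst .empty) b)
      tt ff w (cst .star)

/-- The constant family of universes over the circle. -/
def universes : Exp := Lam circle fun _ => U 0

def pathLoops : Exp := Id circle base base

/-- At `r = loop` this is the type of the path part in circle induction; at `r = refl` it reduces to
`X = X`. Keeping `r` general makes path induction on `refl = loop` possible. -/
def transportUniv (X r : Exp) : Exp :=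
  Id (U 0) (transport circle (fun x => universes ⬝ₑ x) base base r X) X

/-- If `refl = loop`, and if the image of `loop` under a map to the universe is the transport
of `u`, then `u` is trivial. -/
def reflEqMonodromy : Exp :=
  Lam (Pi circle fun x => universes ⬝ₑ x) fun f =>
    let X := f ⬝ₑ base
    let ap (r : Exp) : Exp := apd circle (fun x => universes ⬝ₑ x) f base base r
    Lam (Id pathLoops (rfle circle base) loop) fun q =>
      -- The endpoints of `q` are generalised to `r` and `s`. When they coincide, the transport of
      -- `u` is `u` and the claim is an identity function.
      pathInd pathLoops
        (fun r s p => Pi (transportUniv X r) fun u =>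
          Id (transportUniv X s) (ap s) (transport pathLoops (fun r => transportUniv X r) r s p u) ⟶ₑ
            Id (transportUniv X r) (ap r) u)
        (fun r => Lam (transportUniv X r) fun u => Lam (Id (transportUniv X r) (ap r) u) fun h => h)
        (rfle circle base) loop q

/-- The method of the family over the circle with fibre the booleans and monodromy negation,
if `q : refl = loop`. -/
def coverMethod (q : Exp) : Exp :=
  -- Using `q` here makes it unnecessary to prove that transport in a constant family is trivial:
  -- over `refl` the path `negPath` already has the right type.
  transport pathLoops (fun r => transportUniv bool r) (rfle circle base) loop q negPath

/-- If `refl = loop`, then the empty type has an element. -/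
def loopNontrivial : Exp :=
  Lam (Id pathLoops (rfle circle base) loop) fun q => emptyElement ⬝ₑ (ttEqFf ⬝ₑ
    -- The hypothesis is the computation rule `circleLoop` for the cover. The conclusion speaks of
    -- the action on `refl`, which reduces to `refl`, so it reads `refl = negPath` as `ttEqFf`
    -- requires.
    (reflEqMonodromy ⬝ₑ (cst .circleInd ⬝ₑ universes ⬝ₑ bool ⬝ₑ coverMethod q) ⬝ₑ q ⬝ₑ negPath
      ⬝ₑ (cst .circleLoop ⬝ₑ universes ⬝ₑ bool ⬝ₑ coverMethod q)))

/-- The refutation of `idl = idr` at the circle. -/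
def refutation : Exp :=
  let i := Lam circle fun x => x
  -- In the model, `idl` at the identity reduces to `refl` and composition with the identity
  -- disappears, so this domain is judgmentally the type `idl = idr` at the circle.
  Lam (Id (Id (circle ⟶ₑ circle) i i) (rfle (circle ⟶ₑ circle) i)
    (LoopModel.idr ⬝ₑ context ⬝ₑ context ⬝ₑ i)) fun w =>
      loopNontrivial ⬝ₑ (LoopModel.reflEqLoop ⬝ₑ context ⬝ₑ base ⬝ₑ w)

end CircleLoops

end HoTT

namespace HoTT

open Tm

/-! ## Soundness of type inference -/

namespace Ann

/-- The context is well-formed, and its annotations are correct. -/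
def CtxOk : List Ann → Prop
  | [] => True
  | A :: Γ => CtxOk Γ ∧ ∃ i, Ok (Γ.map erase) A (.univ i)

theorem CtxOk.ctx : ∀ {Γ : List Ann}, CtxOk Γ → Derivable (.ctx (Γ.map erase))
  | [], _ => .ctx_nil
  | _ :: _, ⟨_, _, h⟩ => h.cons

theorem CtxOk.lookup {Γ : List Ann} {n : ℕ} {X : Ann} (hΓ : CtxOk Γ) (h : Γ[n]? = some X) :
    ∃ i, Ok (Γ.map erase) (X.shift (n + 1) 0) (.univ i) := by
  induction Γ generalizing n with
  | nil => cases h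
  | cons A Γ ih =>
    obtain ⟨hΓ, i, hA⟩ := hΓ
    cases n with
    | zero =>
      obtain rfl : A = X := by simpa using h
      exact ⟨i, by rw [← wk_eq]; exact hA.wk hA.cons⟩
    | succ n =>
      obtain ⟨j, hX⟩ := ih hΓ (n := n) (by simpa using h)
      exact ⟨j, by rw [← shift_shift, ← wk_eq]; exact hX.wk hA.cons⟩

/-- The pair `r` consists of an annotation of `t` and of its type. -/
structure Typed (Γ : List Ann) (t : Tm) (r : Ann × Ann) : Prop where
  erase_eq : r.1.erase = t
  ok : Ok (Γ.map erase) r.1 r.2.erase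
  type : ∃ i, Ok (Γ.map erase) r.2 (.univ i)

/-- The function `syn` annotates terms correctly. -/
structure SynthSound (syn : List Ann → Tm → Option Ann → Option (Ann × Ann)) : Prop where
  infer {Γ t r} : CtxOk Γ → syn Γ t none = some r → Typed Γ t r
  check {Γ t T r i} : CtxOk Γ → Ok (Γ.map erase) T (.univ i) → syn Γ t (some T) = some r →
    Typed Γ t r ∧ r.2 = T

/-- The function `known` only returns correct annotations. -/
def KnownSound (known : ℕ → Tm → Option (Ann × Ann)) : Prop :=
  ∀ {Γ t r}, CtxOk Γ → known Γ.length t = some r → Typed Γ t r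

section

variable {wh : Ann → Ann} {cv : Ann → Ann → Bool}
  {syn : List Ann → Tm → Option Ann → Option (Ann × Ann)} {Γ : List Ann}

theorem inferType_sound (hwh : WhnfSound wh) (hsyn : SynthSound syn) (hΓ : CtxOk Γ) {A : Tm}
    {r : Ann × ℕ} (h : inferType wh syn Γ A = some r) :
    r.1.erase = A ∧ Ok (Γ.map erase) r.1 (.univ r.2) := by
  obtain ⟨r', h', h⟩ := andThen_eq_some.1 h
  obtain ⟨he, hok, i, ht⟩ := hsyn.infer hΓ h'
  split at h
  · rename_i j hj
    cases h
    have := (hwh ht).2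
    rw [hj] at this
    exact ⟨he, .conv hok this⟩
  · cases h

theorem check_sound (hsyn : SynthSound syn) (hΓ : CtxOk Γ) {a : Tm} {a' T : Ann} {i : ℕ}
    (hT : Ok (Γ.map erase) T (.univ i)) (h : check syn Γ a T = some a') :
    a'.erase = a ∧ Ok (Γ.map erase) a' T.erase := by
  obtain ⟨r, h', h⟩ := andThen_eq_some.1 h
  cases h
  obtain ⟨hr, rfl⟩ := hsyn.check hΓ hT h'
  exact ⟨hr.erase_eq, hr.ok⟩

theorem inferMotive_sound (hcv : ConvSound cv) (hsyn : SynthSound syn) (hΓ : CtxOk Γ) {C : Tm}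
    {T : ℕ → Ann} {r : Ann × ℕ} (hT : ∀ j, ∃ i, Ok (Γ.map erase) (T j) (.univ i))
    (h : inferMotive wh cv syn Γ C T = some r) :
    r.1.erase = C ∧ Ok (Γ.map erase) r.1 (T r.2).erase := by
  obtain ⟨r', h', h⟩ := andThen_eq_some.1 h
  obtain ⟨hc, h⟩ := guarded_eq_some.1 h
  cases h
  obtain ⟨he, hok, i, ht⟩ := hsyn.infer hΓ h'
  obtain ⟨k, hk⟩ := hT (finalLevel wh 5 r'.2)
  exact ⟨he, .conv hok (hcv.types hc ht hk)⟩

theorem subtype_sound (hwh : WhnfSound wh) (hcv : ConvSound cv) {Δ : Ctx} {S T t : Ann} {i j : ℕ}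
    (hS : Ok Δ S (.univ i)) (hT : Ok Δ T (.univ j)) (h : subtype wh cv S T = true)
    (ht : Ok Δ t S.erase) : Ok Δ t T.erase := by
  rw [subtype, Bool.or_eq_true] at h
  rcases h with h | h
  · rwa [← erase_eq_of_same h]
  have hS' := (hwh hS).2
  have hT' := (hwh hT).2
  split at h
  · rename_i k hk
    rw [hk] at hS'
    split at h
    · rename_i l hl
      rw [hl] at hT'
      exact .conv ((Ok.conv ht hS').cumul_le (Nat.le_of_ble_eq_true h)) hT'.eq_symm
    · cases h
  · exact .conv ht (hcv.types h hS hT)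

theorem inferVar_sound (hΓ : CtxOk Γ) {n : ℕ} {r : Ann × Ann} (h : inferVar Γ n = some r) :
    Typed Γ (.var n) r := by
  obtain ⟨X, eX, h⟩ := andThen_eq_some.1 h
  cases h
  rw [lookup_eq] at eX
  obtain ⟨i, hi⟩ := hΓ.lookup eX
  rw [← fastShift_eq] at hi
  refine ⟨rfl, .var ?_ hi, i, hi⟩
  rw [fastShift_eq, erase_shift, shiftRen_zero]
  exact .var hΓ.ctx (by simp [eX])

theorem inferBinder_sound (hwh : WhnfSound wh) (hsyn : SynthSound syn) (hΓ : CtxOk Γ) {A B : Tm}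
    {A' B' : Ann × ℕ} (eA : inferType wh syn Γ A = some A')
    (eB : inferType wh syn (A'.1 :: Γ) B = some B') :
    (A'.1.erase = A ∧ B'.1.erase = B) ∧ Ok (Γ.map erase) A'.1 (.univ (max A'.2 B'.2)) ∧
      Ok (A'.1.erase :: Γ.map erase) B'.1 (.univ (max A'.2 B'.2)) := by
  obtain ⟨rfl, hA⟩ := inferType_sound hwh hsyn hΓ eA
  obtain ⟨rfl, hB⟩ := inferType_sound hwh hsyn (Γ := A'.1 :: Γ) ⟨hΓ, _, hA⟩ eB
  exact ⟨⟨rfl, rfl⟩, hA.cumul_le (le_max_left _ _), hB.cumul_le (le_max_right _ _)⟩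

theorem inferPi_sound (hwh : WhnfSound wh) (hsyn : SynthSound syn) (hΓ : CtxOk Γ) {A B : Tm}
    {r : Ann × Ann} (h : inferPi wh syn Γ A B = some r) : Typed Γ (.pi A B) r := by
  obtain ⟨A', eA, h⟩ := andThen_eq_some.1 h
  obtain ⟨B', eB, h⟩ := andThen_eq_some.1 h
  cases h
  obtain ⟨⟨rfl, rfl⟩, hA, hB⟩ := inferBinder_sound hwh hsyn hΓ eA eB
  exact ⟨rfl, .pi hA hB, _, .univ hΓ.ctx⟩

theorem inferSigma_sound (hwh : WhnfSound wh) (hsyn : SynthSound syn) (hΓ : CtxOk Γ) {A B : Tm}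
    {r : Ann × Ann} (h : inferSigma wh syn Γ A B = some r) : Typed Γ (.sigma A B) r := by
  obtain ⟨A', eA, h⟩ := andThen_eq_some.1 h
  obtain ⟨B', eB, h⟩ := andThen_eq_some.1 h
  cases h
  obtain ⟨⟨rfl, rfl⟩, hA, hB⟩ := inferBinder_sound hwh hsyn hΓ eA eB
  exact ⟨rfl, .sigma hA hB, _, .univ hΓ.ctx⟩

theorem inferLam_sound (hwh : WhnfSound wh) (hsyn : SynthSound syn) (hΓ : CtxOk Γ) {A b : Tm}
    {r : Ann × Ann} (h : inferLam wh syn Γ A b = some r) : Typed Γ (.lam A b) r := by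
  obtain ⟨A', eA, h⟩ := andThen_eq_some.1 h
  obtain ⟨b', eb, h⟩ := andThen_eq_some.1 h
  cases h
  obtain ⟨rfl, hA⟩ := inferType_sound hwh hsyn hΓ eA
  obtain ⟨rfl, hb, j, hB⟩ := hsyn.infer (Γ := A'.1 :: Γ) ⟨hΓ, _, hA⟩ eb
  exact ⟨rfl, .lam hA hB hb, _, .pi (hA.cumul_le (le_max_left _ _))
    (hB.cumul_le (le_max_right _ _))⟩

theorem inferApp_sound (hwh : WhnfSound wh) (hsyn : SynthSound syn) (hΓ : CtxOk Γ) {f a : Tm}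
    {r : Ann × Ann} (h : inferApp wh syn Γ f a = some r) : Typed Γ (.app f a) r := by
  rw [inferApp, andThen_eq_some] at h
  obtain ⟨f', ef, h⟩ := h
  obtain ⟨rfl, hf, i, hT⟩ := hsyn.infer hΓ ef
  have hT := hwh hT
  split at h
  · rename_i A B hF
    obtain ⟨a', ea, h⟩ := andThen_eq_some.1 h
    cases h
    rw [hF] at hT
    obtain ⟨_, ⟨j, hA, hB, _⟩, _⟩ := hT.1.inv
    obtain ⟨rfl, ha⟩ := check_sound hsyn hΓ hA ea
    have := Ok.app hA hB (.conv hf hT.2) ha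
    exact ⟨rfl, by rwa [← erase_inst] at this, j, hB.inst ha⟩
  · cases h

theorem inferFst_sound (hwh : WhnfSound wh) (hsyn : SynthSound syn) (hΓ : CtxOk Γ) {p : Tm}
    {r : Ann × Ann} (h : inferFst wh syn Γ p = some r) : Typed Γ (.fst p) r := by
  rw [inferFst, andThen_eq_some] at h
  obtain ⟨p', ep, h⟩ := h
  obtain ⟨rfl, hp, i, hT⟩ := hsyn.infer hΓ ep
  have hT := hwh hT
  split at h
  · rename_i A B hF
    cases h
    rw [hF] at hT
    obtain ⟨_, ⟨j, hA, hB, _⟩, _⟩ := hT.1.inv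
    exact ⟨rfl, .fst hA hB (.conv hp hT.2), j, hA⟩
  · cases h

theorem inferSnd_sound (hwh : WhnfSound wh) (hsyn : SynthSound syn) (hΓ : CtxOk Γ) {p : Tm}
    {r : Ann × Ann} (h : inferSnd wh syn Γ p = some r) : Typed Γ (.snd p) r := by
  rw [inferSnd, andThen_eq_some] at h
  obtain ⟨p', ep, h⟩ := h
  obtain ⟨rfl, hp, i, hT⟩ := hsyn.infer hΓ ep
  have hT := hwh hT
  split at h
  · rename_i A B hF
    cases h
    rw [hF] at hT
    obtain ⟨_, ⟨j, hA, hB, _⟩, _⟩ := hT.1.inv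
    have hp := Ok.conv hp hT.2
    have h1 := Ok.fst hA hB hp
    obtain ⟨h2, h3⟩ := hwh h1
    -- The returned type contains the reduced first projection `h2` instead of the projection in the
    -- typing rule; the two instances of `B` are equal by `inst_congr_type`.
    refine ⟨rfl, .conv (i := j) (.snd hA hB hp) ?_, j, hB.inst h2⟩
    rw [erase_inst]
    exact .inst_congr_type hA.typ hB.typ h1.typ h2.typ h3
  · cases h

theorem inferConst_sound (hwh : WhnfSound wh) (hsyn : SynthSound syn) (hΓ : CtxOk Γ) {c : Const}
    {r : Ann × Ann} (h : inferConst wh syn Γ c = some r) : Typed Γ (.const c) r := by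
  obtain ⟨T, eT, h⟩ := andThen_eq_some.1 h
  cases h
  obtain ⟨he, hT⟩ := inferType_sound hwh hsyn hΓ eT
  exact ⟨rfl, by rw [he]; exact .const c _ _ hΓ.ctx, _, hT⟩

theorem inferId_sound (hwh : WhnfSound wh) (hsyn : SynthSound syn) (hΓ : CtxOk Γ) {A a b : Tm}
    {r : Ann × Ann} (h : inferId wh syn Γ A a b = some r) : Typed Γ (View.id A a b).toTm r := by
  obtain ⟨A', eA, h⟩ := andThen_eq_some.1 h
  obtain ⟨a', ea, h⟩ := andThen_eq_some.1 h
  obtain ⟨b', eb, h⟩ := andThen_eq_some.1 h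
  cases h
  obtain ⟨rfl, hA⟩ := inferType_sound hwh hsyn hΓ eA
  obtain ⟨rfl, ha⟩ := check_sound hsyn hΓ hA ea
  obtain ⟨rfl, hb⟩ := check_sound hsyn hΓ hA eb
  exact ⟨rfl, .id hA ha hb, _, .univ hΓ.ctx⟩

theorem inferRefl_sound (hwh : WhnfSound wh) (hsyn : SynthSound syn) (hΓ : CtxOk Γ) {A a : Tm}
    {r : Ann × Ann} (h : inferRefl wh syn Γ A a = some r) : Typed Γ (View.refl A a).toTm r := by
  obtain ⟨A', eA, h⟩ := andThen_eq_some.1 h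
  obtain ⟨a', ea, h⟩ := andThen_eq_some.1 h
  cases h
  obtain ⟨rfl, hA⟩ := inferType_sound hwh hsyn hΓ eA
  obtain ⟨rfl, ha⟩ := check_sound hsyn hΓ hA ea
  exact ⟨rfl, .refl hA ha, _, .id hA ha ha⟩

theorem inferJ_sound (hwh : WhnfSound wh) (hcv : ConvSound cv) (hsyn : SynthSound syn)
    (hΓ : CtxOk Γ) {A C c x y p : Tm} {r : Ann × Ann}
    (h : inferJ wh cv syn Γ A C c x y p = some r) : Typed Γ (View.J A C c x y p).toTm r := by
  obtain ⟨A', eA, h⟩ := andThen_eq_some.1 h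
  obtain ⟨C', eC, h⟩ := andThen_eq_some.1 h
  obtain ⟨c', ec, h⟩ := andThen_eq_some.1 h
  obtain ⟨x', ex, h⟩ := andThen_eq_some.1 h
  obtain ⟨y', ey, h⟩ := andThen_eq_some.1 h
  obtain ⟨p', ep, h⟩ := andThen_eq_some.1 h
  cases h
  obtain ⟨rfl, hA⟩ := inferType_sound hwh hsyn hΓ eA
  obtain ⟨rfl, hC⟩ := inferMotive_sound hcv hsyn hΓ (fun j => ⟨_, hA.typeMotiveJ j⟩) eC
  rw [Ok.erase_typeMotiveJ] at hC
  have hM := hA.methodJ hC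
  obtain ⟨rfl, hc⟩ := check_sound hsyn hΓ
    (.pi (hA.cumul_le (le_max_left _ _)) (hM.cumul_le (le_max_right _ _))) ec
  obtain ⟨rfl, hx⟩ := check_sound hsyn hΓ hA ex
  obtain ⟨rfl, hy⟩ := check_sound hsyn hΓ hA ey
  obtain ⟨rfl, hp⟩ := check_sound hsyn hΓ (.id hA hx hy) ep
  rw [erase, Ok.erase_methodJ] at hc
  exact ⟨rfl, .J hA hC hc hx hy hp, _, .motiveJ hA hC hx hy hp⟩

theorem inferSum_sound (hwh : WhnfSound wh) (hsyn : SynthSound syn) (hΓ : CtxOk Γ) {A B : Tm}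
    {r : Ann × Ann} (h : inferSum wh syn Γ A B = some r) : Typed Γ (View.sum A B).toTm r := by
  obtain ⟨A', eA, h⟩ := andThen_eq_some.1 h
  obtain ⟨B', eB, h⟩ := andThen_eq_some.1 h
  cases h
  obtain ⟨rfl, hA⟩ := inferType_sound hwh hsyn hΓ eA
  obtain ⟨rfl, hB⟩ := inferType_sound hwh hsyn hΓ eB
  exact ⟨rfl, .sum (hA.cumul_le (le_max_left _ _)) (hB.cumul_le (le_max_right _ _)), _,
    .univ hΓ.ctx⟩

theorem inferInl_sound (hwh : WhnfSound wh) (hsyn : SynthSound syn) (hΓ : CtxOk Γ) {A B a : Tm}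
    {r : Ann × Ann} (h : inferInl wh syn Γ A B a = some r) : Typed Γ (View.inl A B a).toTm r := by
  obtain ⟨A', eA, h⟩ := andThen_eq_some.1 h
  obtain ⟨B', eB, h⟩ := andThen_eq_some.1 h
  obtain ⟨a', ea, h⟩ := andThen_eq_some.1 h
  cases h
  obtain ⟨rfl, hA⟩ := inferType_sound hwh hsyn hΓ eA
  obtain ⟨rfl, hB⟩ := inferType_sound hwh hsyn hΓ eB
  obtain ⟨rfl, ha⟩ := check_sound hsyn hΓ hA ea
  have hA := hA.cumul_le (le_max_left A'.2 B'.2)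
  have hB := hB.cumul_le (le_max_right A'.2 B'.2)
  exact ⟨rfl, .inl hA hB ha, _, .sum hA hB⟩

theorem inferInr_sound (hwh : WhnfSound wh) (hsyn : SynthSound syn) (hΓ : CtxOk Γ) {A B b : Tm}
    {r : Ann × Ann} (h : inferInr wh syn Γ A B b = some r) : Typed Γ (View.inr A B b).toTm r := by
  obtain ⟨A', eA, h⟩ := andThen_eq_some.1 h
  obtain ⟨B', eB, h⟩ := andThen_eq_some.1 h
  obtain ⟨b', eb, h⟩ := andThen_eq_some.1 h
  cases h
  obtain ⟨rfl, hA⟩ := inferType_sound hwh hsyn hΓ eA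
  obtain ⟨rfl, hB⟩ := inferType_sound hwh hsyn hΓ eB
  obtain ⟨rfl, hb⟩ := check_sound hsyn hΓ hB eb
  have hA := hA.cumul_le (le_max_left A'.2 B'.2)
  have hB := hB.cumul_le (le_max_right A'.2 B'.2)
  exact ⟨rfl, .inr hA hB hb, _, .sum hA hB⟩

theorem inferSumInd_sound (hwh : WhnfSound wh) (hcv : ConvSound cv) (hsyn : SynthSound syn)
    (hΓ : CtxOk Γ) {A B C f g x : Tm} {r : Ann × Ann}
    (h : inferSumInd wh cv syn Γ A B C f g x = some r) :
    Typed Γ (View.sumInd A B C f g x).toTm r := by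
  obtain ⟨A', eA, h⟩ := andThen_eq_some.1 h
  obtain ⟨B', eB, h⟩ := andThen_eq_some.1 h
  obtain ⟨C', eC, h⟩ := andThen_eq_some.1 h
  obtain ⟨f', ef, h⟩ := andThen_eq_some.1 h
  obtain ⟨g', eg, h⟩ := andThen_eq_some.1 h
  obtain ⟨x', ex, h⟩ := andThen_eq_some.1 h
  cases h
  obtain ⟨rfl, hA⟩ := inferType_sound hwh hsyn hΓ eA
  obtain ⟨rfl, hB⟩ := inferType_sound hwh hsyn hΓ eB
  have hA := hA.cumul_le (le_max_left A'.2 B'.2)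
  have hB := hB.cumul_le (le_max_right A'.2 B'.2)
  have hS := Ok.sum hA hB
  obtain ⟨rfl, hC⟩ := inferMotive_sound hcv hsyn hΓ (fun j => ⟨_, .pi
    (hS.cumul_le (le_max_left _ _)) ((Ok.univ hS.cons).cumul_le (le_max_right _ (j + 1)))⟩) eC
  change Ok _ C'.1 (arr (capp .sum [A'.1.erase, B'.1.erase]) (.univ C'.2)) at hC
  obtain ⟨rfl, hf⟩ := check_sound hsyn hΓ (.pi (hA.cumul_le (le_max_left _ _))
    ((hA.methodInl hB hC).cumul_le (le_max_right _ _))) ef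
  obtain ⟨rfl, hg⟩ := check_sound hsyn hΓ (.pi (hB.cumul_le (le_max_left _ _))
    ((hA.methodInr hB hC).cumul_le (le_max_right _ _))) eg
  obtain ⟨rfl, hx⟩ := check_sound hsyn hΓ hS ex
  rw [erase, Ok.erase_methodInl] at hf
  rw [erase, Ok.erase_methodInr] at hg
  exact ⟨rfl, .sumInd hA hB hC hf hg hx, _, .sumMotive hA hB hC hx⟩

theorem inferCircleInd_sound (hwh : WhnfSound wh) (hcv : ConvSound cv) (hsyn : SynthSound syn)
    (hΓ : CtxOk Γ) {C b l : Tm} {r : Ann × Ann}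
    (h : inferCircleInd wh cv syn Γ C b l = some r) : Typed Γ (View.circleInd C b l).toTm r := by
  obtain ⟨C', eC, h⟩ := andThen_eq_some.1 h
  obtain ⟨b', eb, h⟩ := andThen_eq_some.1 h
  obtain ⟨L, eL, h⟩ := andThen_eq_some.1 h
  obtain ⟨l', el, h⟩ := andThen_eq_some.1 h
  cases h
  have hS := Ok.circle hΓ.ctx
  obtain ⟨rfl, hC⟩ := inferMotive_sound hcv hsyn hΓ (fun j => ⟨_, .pi
    (hS.cumul_le (Nat.zero_le (j + 1))) (.univ hS.cons)⟩) eC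
  have hB : Ok (Γ.map erase) (.const .base) (.const .circle) := .const .base 0 0 hΓ.ctx
  obtain ⟨rfl, hb⟩ := check_sound hsyn hΓ
    (Ok.app' hS (.univ hS.cons) hC rfl hB rfl rfl) eb
  obtain ⟨he, hL⟩ := inferType_sound hwh hsyn hΓ eL
  obtain ⟨rfl, hl⟩ := check_sound hsyn hΓ hL el
  rw [he] at hl
  refine ⟨rfl, ?_, _, .pi (hS.cumul_le (Nat.zero_le _)) (.circleMotive hC)⟩
  rw [erase, Ok.erase_circleMotive]
  exact .circleInd hC hb hl

variable {known : ℕ → Tm → Option (Ann × Ann)}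

theorem infer_sound (hwh : WhnfSound wh) (hcv : ConvSound cv) (hk : KnownSound known)
    (hsyn : SynthSound syn) (hΓ : CtxOk Γ) {v : View} {r : Ann × Ann}
    (h : infer wh cv known syn Γ v = some r) : Typed Γ v.toTm r := by
  cases v with
  | var => exact inferVar_sound hΓ h
  | univ i => cases h; exact ⟨rfl, .univ hΓ.ctx, _, .univ hΓ.ctx⟩
  | pi => exact inferPi_sound hwh hsyn hΓ h
  | lam => exact inferLam_sound hwh hsyn hΓ h
  | app => exact inferApp_sound hwh hsyn hΓ h
  | sigma => exact inferSigma_sound hwh hsyn hΓ h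
  | pair => exact hk hΓ h
  | fst => exact inferFst_sound hwh hsyn hΓ h
  | snd => exact inferSnd_sound hwh hsyn hΓ h
  | const => exact inferConst_sound hwh hsyn hΓ h
  | id => exact inferId_sound hwh hsyn hΓ h
  | refl => exact inferRefl_sound hwh hsyn hΓ h
  | J => exact inferJ_sound hwh hcv hsyn hΓ h
  | sum => exact inferSum_sound hwh hsyn hΓ h
  | inl => exact inferInl_sound hwh hsyn hΓ h
  | inr => exact inferInr_sound hwh hsyn hΓ h
  | sumInd => exact inferSumInd_sound hwh hcv hsyn hΓ h
  | circleInd => exact inferCircleInd_sound hwh hcv hsyn hΓ h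

theorem checkLam_sound (hwh : WhnfSound wh) (hcv : ConvSound cv) (hsyn : SynthSound syn)
    (hΓ : CtxOk Γ) {A b : Tm} {T : Ann} {r : Ann × Ann} {i : ℕ}
    (hT : Ok (Γ.map erase) T (.univ i)) (h : checkLam wh cv syn Γ A b T = some r) :
    Typed Γ (.lam A b) r ∧ r.2 = T := by
  have hT' := hwh hT
  rw [checkLam] at h
  split at h
  · rename_i A' B hF
    obtain ⟨A₁, eA, h⟩ := andThen_eq_some.1 h
    obtain ⟨hc, h⟩ := guarded_eq_some.1 h
    obtain ⟨b', eb, h⟩ := andThen_eq_some.1 h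
    cases h
    rw [hF] at hT'
    obtain ⟨_, ⟨j, hA', hB, _⟩, _⟩ := hT'.1.inv
    obtain ⟨rfl, hA⟩ := inferType_sound hwh hsyn hΓ eA
    have hAA' := hcv.types hc hA hA'
    obtain ⟨rfl, hb⟩ := check_sound hsyn (Γ := A' :: Γ) ⟨hΓ, _, hA'⟩ hB eb
    have hB₁ := Ok.ctx_conv (hA.cumul_le (le_max_left _ j)).typ hAA' hB
    refine ⟨⟨rfl, .conv (.conv (.lam hA hB₁ (Ok.ctx_conv (hA.cumul_le (le_max_left _ j)).typ hAA' hb))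
      (.pi_congr (hAA'.eq_cumul_le (le_max_left _ _)) (Derivable.eq_cumul_le hB₁.eq_refl
        (le_max_right _ _)))) hT'.2.eq_symm, i, hT⟩, rfl⟩
  · cases h

theorem checkPair_sound (hwh : WhnfSound wh) (hsyn : SynthSound syn)
    (hΓ : CtxOk Γ) {a b : Tm} {T : Ann} {r : Ann × Ann} {i : ℕ}
    (hT : Ok (Γ.map erase) T (.univ i)) (h : checkPair wh syn Γ a b T = some r) :
    Typed Γ (.pair a b) r ∧ r.2 = T := by
  have hT' := hwh hT
  rw [checkPair] at h
  split at h
  · rename_i A B hF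
    obtain ⟨a', ea, h⟩ := andThen_eq_some.1 h
    obtain ⟨b', eb, h⟩ := andThen_eq_some.1 h
    cases h
    rw [hF] at hT'
    obtain ⟨_, ⟨j, hA, hB, _⟩, _⟩ := hT'.1.inv
    obtain ⟨rfl, ha⟩ := check_sound hsyn hΓ hA ea
    obtain ⟨rfl, hb⟩ := check_sound hsyn hΓ (hB.inst ha) eb
    rw [erase_inst] at hb
    exact ⟨⟨rfl, .conv (.pair hA hB ha hb) hT'.2.eq_symm, i, hT⟩, rfl⟩
  · cases h

theorem checkView_sound (hwh : WhnfSound wh) (hcv : ConvSound cv) (hk : KnownSound known)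
    (hsyn : SynthSound syn) (hΓ : CtxOk Γ) {v : View} {T : Ann} {r : Ann × Ann} {i : ℕ}
    (hT : Ok (Γ.map erase) T (.univ i)) (h : checkView wh cv known syn Γ v T = some r) :
    Typed Γ v.toTm r ∧ r.2 = T := by
  unfold checkView at h
  split at h
  · exact checkLam_sound hwh hcv hsyn hΓ hT h
  · exact checkPair_sound hwh hsyn hΓ hT h
  · obtain ⟨s, hs, h⟩ := andThen_eq_some.1 h
    obtain ⟨hc, h⟩ := guarded_eq_some.1 h
    cases h
    obtain ⟨he, hok, j, hS⟩ := infer_sound hwh hcv hk hsyn hΓ hs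
    exact ⟨⟨he, subtype_sound hwh hcv hS hT hc hok, i, hT⟩, rfl⟩

/-- Each level of the recursion uses inference, reduction and conversion with the smaller bound
only, so soundness follows by induction on the bound from the soundness of the individual rules. -/
theorem synth_sound (hk : KnownSound known) (n : ℕ) : SynthSound (synth known n) := by
  induction n with
  | zero => exact ⟨(fun _ h => nomatch h), (fun _ _ h => nomatch h)⟩
  | succ n ih =>
    have hcv : ConvSound (conv n) := conv_sound n
    have hwh : WhnfSound (whnf (conv n) n) := whnf_sound hcv n
    constructor
    · intro Γ t r hΓ h
      rw [← View.toTm_ofTm t]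
      exact infer_sound hwh hcv hk ih hΓ h
    · intro Γ t T r i hΓ hT h
      rw [← View.toTm_ofTm t]
      exact checkView_sound hwh hcv hk ih hΓ hT h

end

end Ann

end HoTT

namespace HoTT

open Tm Exp

/-! ## Raising the levels of all universes -/

/-- Raises the level of a constant by `s`. -/
def Const.lift (s : ℕ) : Const → Const
  | .ua i => .ua (s + i)
  | c => c

namespace Tm

/-- Raises the levels of all universes by `s`. -/
def lift (s : ℕ) : Tm → Tm
  | var n => var n
  | univ i => univ (s + i)
  | pi A B => pi (A.lift s) (B.lift s)
  | lam A b => lam (A.lift s) (b.lift s)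
  | app f a => app (f.lift s) (a.lift s)
  | sigma A B => sigma (A.lift s) (B.lift s)
  | pair a b => pair (a.lift s) (b.lift s)
  | fst p => fst (p.lift s)
  | snd p => snd (p.lift s)
  | const c => const (c.lift s)

theorem lift_rename (s : ℕ) (t : Tm) (ρ : ℕ → ℕ) : (t.rename ρ).lift s = (t.lift s).rename ρ := by
  induction t generalizing ρ <;> simp_all [lift, rename]

theorem lift_wk (s : ℕ) (t : Tm) : t.wk.lift s = (t.lift s).wk := lift_rename s t _

theorem lift_subst (s : ℕ) (t : Tm) (σ : ℕ → Tm) :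
    (t.subst σ).lift s = (t.lift s).subst (fun n => (σ n).lift s) := by
  have up (σ : ℕ → Tm) : (fun n => (upSub σ n).lift s) = upSub (fun n => (σ n).lift s) := by
    funext n
    cases n with
    | zero => rfl
    | succ n => exact lift_wk s (σ n)
  induction t generalizing σ <;> simp_all [lift, subst]

theorem lift_inst (s : ℕ) (b a : Tm) : (b.inst a).lift s = (b.lift s).inst (a.lift s) := by
  rw [inst, lift_subst, inst]
  congr 1; funext n; cases n <;> rfl

theorem lift_arr (s : ℕ) (A B : Tm) : (arr A B).lift s = arr (A.lift s) (B.lift s) := by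
  simp only [arr, lift, lift_wk]

end Tm

theorem circleMethod_lift (s : ℕ) (C b : Tm) :
    (circleMethod C b).lift s = circleMethod (C.lift s) (b.lift s) := by
  simp [circleMethod, capp, lift, lift_arr, lift_wk, Const.lift]

namespace Judgment

/-- Raises the levels of all universes by `s`. -/
def lift (s : ℕ) : Judgment → Judgment
  | ctx Γ => ctx (Γ.map (Tm.lift s))
  | typ Γ a A => typ (Γ.map (Tm.lift s)) (a.lift s) (A.lift s)
  | eq Γ a b A => eq (Γ.map (Tm.lift s)) (a.lift s) (b.lift s) (A.lift s)

end Judgment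

/-- The types of the constants are uniform in `i` and `j`, so lifting amounts to raising these
parameters. The exceptions are the four closed base types, which stay in universe `0` and reach
universe `s` by cumulativity. -/
theorem Derivable.const_lift {Γ : Ctx} (s : ℕ) (c : Const) (i j : ℕ) (h : Derivable (.ctx Γ)) :
    Derivable (.typ Γ (.const (c.lift s)) ((c.type i j).close.lift s)) := by
  cases c with
  | empty | unit | nat | circle =>
    exact Derivable.cumul_le (.const _ 0 0 h) (Nat.zero_le s)
  | _ => exact .const _ (s + i) (s + j) h

/-- Every rule is uniform in the universe levels, so it is mapped to an instance of itself. Adding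
`s` on the left makes `s + (i + 1)` and `(s + i) + 1` agree by computation, as the universe rules
require. -/
theorem Derivable.lift {J : Judgment} (h : Derivable J) (s : ℕ) : Derivable (J.lift s) := by
  induction h <;> simp only [Judgment.lift, List.map_nil, List.map_cons, Tm.lift, lift_inst, lift_wk,
    lift_rename, lift_arr, circleMethod_lift, capp, List.foldl, Const.lift] at *
  case ctx_nil => exact .ctx_nil
  case ctx_cons ih => exact .ctx_cons ih
  case var hn ih => exact .var ih (by simp [hn])
  case eq_refl ih => exact .eq_refl ih
  case eq_symm ih => exact .eq_symm ih
  case eq_trans ih ih' => exact .eq_trans ih ih'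
  case conv ih ih' => exact .conv ih ih'
  case eq_conv ih ih' => exact .eq_conv ih ih'
  case univ ih => exact .univ ih
  case cumul ih => exact .cumul ih
  case eq_cumul ih => exact .eq_cumul ih
  case pi ih ih' => exact .pi ih ih'
  case pi_congr ih ih' => exact .pi_congr ih ih'
  case lam ih => exact .lam ih
  case lam_congr ih ih' => exact .lam_congr ih ih'
  case app ih ih' => exact .app ih ih'
  case app_congr ih ih' => exact .app_congr ih ih'
  case pi_beta => apply Derivable.pi_beta <;> assumption
  case pi_eta ih => exact .pi_eta ih
  case sigma ih ih' => exact .sigma ih ih'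
  case sigma_congr ih ih' => exact .sigma_congr ih ih'
  case pair => apply Derivable.pair <;> assumption
  case pair_congr => apply Derivable.pair_congr <;> assumption
  case fst ih => exact .fst ih
  case fst_congr ih => exact .fst_congr ih
  case snd ih => exact .snd ih
  case snd_congr ih => exact .snd_congr ih
  case fst_beta => apply Derivable.fst_beta <;> assumption
  case snd_beta => apply Derivable.snd_beta <;> assumption
  case sigma_eta ih => exact .sigma_eta ih
  case const ih => exact .const_lift s _ _ _ ih
  case unit_beta => apply Derivable.unit_beta <;> assumption
  case sum_beta_inl => apply Derivable.sum_beta_inl <;> assumption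
  case sum_beta_inr => apply Derivable.sum_beta_inr <;> assumption
  case nat_beta_zero => apply Derivable.nat_beta_zero <;> assumption
  case nat_beta_succ => apply Derivable.nat_beta_succ <;> assumption
  case id_beta => apply Derivable.id_beta <;> assumption
  case circle_beta => apply Derivable.circle_beta <;> assumption

/-- Lifting a closed type expression evaluates to the same expression at the raised levels, so this
is `Derivable.lift` up to computation; the same holds for the two types below. -/
theorem Closed.lift_wildCwF {s : ℕ} {M : Tm} (h : Closed M (wildCwF 1 0 1 0)) :
    Closed (M.lift s) (wildCwF (s + 1) s (s + 1) s) :=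
  Derivable.lift h s

theorem Closed.lift_con {s : ℕ} {M G : Tm} (h : Closed G (WildCwF.Con (ofClosed M))) :
    Closed (G.lift s) (WildCwF.Con (ofClosed (M.lift s))) :=
  Derivable.lift h s

theorem Closed.lift_neg {s : ℕ} {M G e : Tm}
    (h : Closed e (Neg (WildCwF.idlEqIdr (ofClosed M) (ofClosed G)))) :
    Closed (e.lift s) (Neg (WildCwF.idlEqIdr (ofClosed (M.lift s)) (ofClosed (G.lift s)))) :=
  Derivable.lift h s

end HoTT

/-! ### Evaluation of the type checker on the model and on the refutation. -/

namespace HoTT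

open Exp

namespace Ann

/-- Annotates the closed term `t` and its type `T`. -/
noncomputable def checkClosed (known : ℕ → Tm → Option (Ann × Ann)) (n : ℕ) (t T : Tm) :
    Option (Ann × Ann) :=
  andThen (inferType (whnf (conv n) n) (synth known n) [] T) fun T =>
    andThen (check (synth known n) [] t T.1) fun t => some (t, T.1)

theorem checkClosed_sound {known : ℕ → Tm → Option (Ann × Ann)} (hk : KnownSound known) {n : ℕ}
    {t T : Tm} {r : Ann × Ann} (h : checkClosed known n t T = some r) :
    Typed [] t r ∧ r.2.erase = T := by
  obtain ⟨T', hT, h⟩ := andThen_eq_some.1 h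
  obtain ⟨t', ht, h⟩ := andThen_eq_some.1 h
  cases h
  have hs := synth_sound hk n
  obtain ⟨he, hT⟩ := inferType_sound (whnf_sound (conv_sound n) n) hs (Γ := []) trivial hT
  obtain ⟨he', ht⟩ := check_sound hs (Γ := []) trivial hT ht
  exact ⟨⟨he', ht, _, hT⟩, he⟩

theorem closed_of_checkClosed {known : ℕ → Tm → Option (Ann × Ann)} (hk : KnownSound known) {n : ℕ}
    {t : Tm} {T : Exp} {r : Ann × Ann} (h : checkClosed known n t T.close = some r) :
    Closed t T := by
  obtain ⟨⟨rfl, ht, -⟩, hT⟩ := checkClosed_sound hk h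
  rw [hT] at ht
  exact ht.typ

/-- The only closed term whose annotation is known is that of `r`. -/
noncomputable def knownClosed (r : Ann × Ann) (n : ℕ) (t : Tm) : Option (Ann × Ann) :=
  guarded (Nat.beq n 0 && r.1.erase.beq t) (some r)

/-- The annotation was established in the empty context and is reused only there; no weakening is
involved. -/
theorem knownClosed_sound {r : Ann × Ann} (hr : Typed [] r.1.erase r) :
    KnownSound (knownClosed r) := by
  intro Γ t s _ h
  obtain ⟨hc, h⟩ := guarded_eq_some.1 h
  cases h
  rw [Bool.and_eq_true] at hc
  obtain rfl := List.length_eq_zero_iff.1 (Nat.eq_of_beq_eq_true hc.1)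
  rwa [← Tm.eq_of_beq hc.2]

end Ann

open Ann in
set_option maxRecDepth 100000 in
-- The computational core: the checker succeeds on all three terms. The model is a pair which occurs
-- under projections in the types of the other two terms, where its type cannot be inferred; hence
-- the annotation `r` obtained in the first check is passed on. The number `60` only bounds the
-- recursion, and any bound for which the checks succeed would serve.
theorem checkClosed_refutation :
    (andThen (checkClosed (fun _ _ => none) 60 LoopModel.model.close (wildCwF 1 0 1 0).close) fun r =>
      andThen (checkClosed (knownClosed r) 60 CircleLoops.context.close
        (WildCwF.Con (ofClosed LoopModel.model.close)).close) fun _ =>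
      checkClosed (knownClosed r) 60 CircleLoops.refutation.close
        (Neg (WildCwF.idlEqIdr (ofClosed LoopModel.model.close)
          (ofClosed CircleLoops.context.close))).close).isSome = true := by
  decide +kernel

theorem closed_refutation :
    Closed LoopModel.model.close (wildCwF 1 0 1 0) ∧
      Closed CircleLoops.context.close (WildCwF.Con (ofClosed LoopModel.model.close)) ∧
      Closed CircleLoops.refutation.close (Neg (WildCwF.idlEqIdr (ofClosed LoopModel.model.close)
        (ofClosed CircleLoops.context.close))) := by
  obtain ⟨r', h⟩ := Option.isSome_iff_exists.1 checkClosed_refutation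
  obtain ⟨r, hM, h⟩ := andThen_eq_some.1 h
  obtain ⟨s, hG, he⟩ := andThen_eq_some.1 h
  have hn : Ann.KnownSound fun _ _ => none := fun _ h => nomatch h
  have hr := (Ann.checkClosed_sound hn hM).1
  have hk : Ann.KnownSound (Ann.knownClosed r) := Ann.knownClosed_sound ⟨rfl, hr.ok, hr.type⟩
  exact ⟨Ann.closed_of_checkClosed hn hM, Ann.closed_of_checkClosed hk hG,
    Ann.closed_of_checkClosed hk he⟩

end HoTT

theorem mainTheorem5 (i : ℕ) :
    ∃ M G e : HoTT.Tm,
      HoTT.Closed M (HoTT.wildCwF (i + 1) i (i + 1) i) ∧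
      HoTT.Closed G (HoTT.WildCwF.Con (HoTT.Exp.ofClosed M)) ∧
      HoTT.Closed e
        (HoTT.Neg (HoTT.WildCwF.idlEqIdr (HoTT.Exp.ofClosed M) (HoTT.Exp.ofClosed G))) := by
  obtain ⟨hM, hG, he⟩ := HoTT.closed_refutation
  exact ⟨_, _, _, hM.lift_wildCwF, hG.lift_con, he.lift_neg⟩
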